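/- Let $\mathfrak{L}$ be a finite-dimensional Lie algebra over $\mathbb{C}$ with a fixed Levi decomposition $\mathfrak{L}=\mathfrak{g}\ltimes\mathfrak{r}$, where $\mathfrak{g}$ is a semisimple subalgebra and $\mathfrak{r}$ is the radical of $\mathfrak{L}$, and assume that $\mathfrak{r}$ is abelian (that is, $\mathfrak{L}$ is a generalized Takiff Lie algebra). Write $U(\cdot)$ for universal enveloping algebras, $Z(\mathfrak{L})$ for the center of $U(\mathfrak{L})$ and $\overline{Z(\mathfrak{L})}:=Z(\mathfrak{L})\cap U(\mathfrak{r})$. A $\mathfrak{g}$-Harish-Chandra module is an $\mathfrak{L}$-module whose restriction to $\mathfrak{g}$ is a direct sum of simple finite-dimensional $\mathfrak{g}$-modules in which every isomorphism class occurs with finite multiplicity; its $\mathfrak{g}$-types are its simple $\mathfrak{g}$-submodules. A radical central character is an algebra homomorphism $\chi\colon\overline{Z(\mathfrak{L})}\to\mathbb{C}$; an $\mathfrak{L}$-module has radical central character $\chi$ if every $z\in\overline{Z(\mathfrak{L})}$ acts on it by the scalar $\chi(z)$. Let $Q(0)=U(\mathfrak{L})\otimes_{U(\mathfrak{g})}\mathbb{C}$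 be the module induced from the trivial $\mathfrak{g}$-module, let $Q(0,\chi)=Q(0)/(\operatorname{Ker}\chi)\,Q(0)$, and let $V(0,\chi)$ be the unique simple quotient of $Q(0,\chi)$. For a simple finite-dimensional $\mathfrak{g}$-module $M$ let $[V:M]=\dim\operatorname{Hom}_{\mathfrak{g}}(M,V)$ denote the multiplicity of $M$ in a $\mathfrak{g}$-module $V$ that is a direct sum of simple finite-dimensional modules. Let $\chi$ be a radical central character and let $L$ be a simple finite-dimensional $\mathfrak{g}$-module. Then there exists a simple $\mathfrak{g}$-Harish-Chandra module for $\mathfrak{L}$ with radical central character $\chi$ having $L$ as one of its $\mathfrak{g}$-types. Moreover, the number of isomorphism classes of simple $\mathfrak{g}$-Harish-Chandra modules with radical central character $\chi$ having $L$ as one of their $\mathfrak{g}$-types is at most $$\sum_{M} l_{M,L}^{L}\,[V(0,\chi):M]<\infty,$$ where $M$ runs through the isomorphism classes of simple finite-dimensional $\mathfrak{g}$-modules and $l_{M,L}^{L}=[M\otimes L:L]$ is the multiplicity of $L$ in $M\otimes L$. -/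

import Mathlib

open scoped TensorProduct

universe u

namespace GenTakiff

section Modules

/-- A module over a complex Lie algebra `A`, bundled with its structure. -/
structure LieMod (A : Type u) [LieRing A] [LieAlgebra ℂ A] where
  /-- the underlying type -/
  carrier : Type u
  [addCommGroup : AddCommGroup carrier]
  [module : Module ℂ carrier]
  [lieRingModule : LieRingModule A carrier]
  [lieModule : LieModule ℂ A carrier]

variable {A : Type u} [LieRing A] [LieAlgebra ℂ A]

instance : CoeSort (LieMod A) (Type u) := ⟨LieMod.carrier⟩

instance (V : LieMod A) : AddCommGroup V := V.addCommGroup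
instance (V : LieMod A) : Module ℂ V := V.module
instance (V : LieMod A) : LieRingModule A V := V.lieRingModule
instance (V : LieMod A) : LieModule ℂ A V := V.lieModule

/-- Isomorphism of `A`-modules as an equivalence relation. -/
instance LieMod.isoSetoid (A : Type u) [LieRing A] [LieAlgebra ℂ A] : Setoid (LieMod A) where
  r V W := Nonempty (V ≃ₗ⁅ℂ, A⁆ W)
  iseqv :=
    ⟨fun _ => ⟨LieModuleEquiv.refl⟩, fun ⟨e⟩ => ⟨e.symm⟩, fun ⟨e⟩ ⟨f⟩ => ⟨e.trans f⟩⟩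

/-- The set of isomorphism classes of the `A`-modules that have the property `P`. -/
def isoClasses (P : LieMod A → Prop) : Set (Quotient (LieMod.isoSetoid A)) :=
  (fun V : LieMod A => Quotient.mk (LieMod.isoSetoid A) V) '' {V | P V}

/-- The multiplicity `[V : M] = dim Hom_A(M, V)` of a simple finite-dimensional module `M` in a
semisimple module `V`, as an element of `ℕ∞`. -/
noncomputable def mult (A : Type u) [LieRing A] [LieAlgebra ℂ A]
    (V : Type u) [AddCommGroup V] [Module ℂ V] [LieRingModule A V] [LieModule ℂ A V]
    (M : Type u) [AddCommGroup M] [Module ℂ M] [LieRingModule A M] [LieModule ℂ A M] : ℕ∞ :=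
  Cardinal.toENat (Module.rank ℂ (M →ₗ⁅ℂ, A⁆ V))

/-- Simple finite-dimensional modules. -/
def IsSimpleFinDim (M : LieMod A) : Prop :=
  LieModule.IsIrreducible ℂ A M ∧ FiniteDimensional ℂ M

end Modules

section HarishChandra

variable {𝔏 : Type u} [LieRing 𝔏] [LieAlgebra ℂ 𝔏]

/-- `𝔏 = g ⋉ r` is a Levi decomposition, `r` being the (solvable) radical of `𝔏`. -/
structure IsLevi (g : LieSubalgebra ℂ 𝔏) : Prop where
  semisimple : LieAlgebra.IsSemisimple ℂ g
  isCompl : IsCompl g.toSubmodule (LieAlgebra.radical ℂ 𝔏).toSubmodule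

/-- The `𝔏`-module `V` is a `g`-Harish-Chandra module: as a `g`-module it is a direct sum of simple
finite-dimensional submodules, among which every isomorphism class occurs finitely often. -/
def IsHarishChandra (g : LieSubalgebra ℂ 𝔏)
    (V : Type u) [AddCommGroup V] [Module ℂ V] [LieRingModule 𝔏 V] [LieModule ℂ 𝔏 V] : Prop :=
  ∃ (ι : Type u) (_ : DecidableEq ι) (S : ι → LieSubmodule ℂ g V),
    (∀ i, LieModule.IsIrreducible ℂ g (S i) ∧ FiniteDimensional ℂ (S i)) ∧
    DirectSum.IsInternal (fun i => (S i).toSubmodule) ∧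
    ∀ i, {j | Nonempty (S j ≃ₗ⁅ℂ, g⁆ S i)}.Finite

/-- The simple `g`-module `L` is (isomorphic to) a `g`-type of the `𝔏`-module `V`. -/
def HasType (g : LieSubalgebra ℂ 𝔏)
    (V : Type u) [AddCommGroup V] [Module ℂ V] [LieRingModule 𝔏 V] [LieModule ℂ 𝔏 V]
    (L : Type u) [AddCommGroup L] [Module ℂ L] [LieRingModule g L] [LieModule ℂ g L] : Prop :=
  ∃ S : LieSubmodule ℂ g V, Nonempty (S ≃ₗ⁅ℂ, g⁆ L)

end HarishChandra

section Center

variable (𝔏 : Type u) [LieRing 𝔏] [LieAlgebra ℂ 𝔏]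

/-- The universal enveloping algebra `U(𝔏)`. -/
abbrev Env : Type u := UniversalEnvelopingAlgebra ℂ 𝔏

/-- The purely radical part `Z(𝔏) ∩ U(r)` of the center of `U(𝔏)`; here `U(r)` is the subalgebra
of `U(𝔏)` generated by the radical `r`. -/
noncomputable def radicalCenter : Subalgebra ℂ (Env 𝔏) :=
  Subalgebra.center ℂ (Env 𝔏) ⊓
    Algebra.adjoin ℂ (UniversalEnvelopingAlgebra.ι ℂ '' (LieAlgebra.radical ℂ 𝔏 : Set 𝔏))

variable {𝔏}

/-- The purely radical part of the center acts on the `𝔏`-module `V` through `χ`. -/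
def HasRadicalCharacter (χ : radicalCenter 𝔏 →ₐ[ℂ] ℂ)
    (V : Type u) [AddCommGroup V] [Module ℂ V] [LieRingModule 𝔏 V] [LieModule ℂ 𝔏 V] : Prop :=
  ∀ (z : radicalCenter 𝔏) (v : V),
    UniversalEnvelopingAlgebra.lift ℂ (LieModule.toEnd ℂ 𝔏 V) (z : Env 𝔏) v = χ z • v

end Center

section Universal

variable {𝔏 : Type u} [LieRing 𝔏] [LieAlgebra ℂ 𝔏]

/-- The left ideal `U(𝔏) g` of `U(𝔏)`. -/
noncomputable def leftIdeal (g : LieSubalgebra ℂ 𝔏) : Submodule (Env 𝔏) (Env 𝔏) :=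
  Submodule.span (Env 𝔏) (UniversalEnvelopingAlgebra.ι ℂ '' (g : Set 𝔏))

/-- The universal module `Q(0) = U(𝔏) ⊗_{U(g)} L(0) = U(𝔏) / U(𝔏) g`, induced from the trivial
`g`-module `L(0) = U(g) / U(g) g`. -/
abbrev Q₀ (g : LieSubalgebra ℂ 𝔏) : Type u := Env 𝔏 ⧸ leftIdeal g

/-- The submodule `𝐦_χ Q(0)` of `Q(0)`, where `𝐦_χ = Ker χ`. -/
noncomputable def charSubmodule (g : LieSubalgebra ℂ 𝔏) (χ : radicalCenter 𝔏 →ₐ[ℂ] ℂ) :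
    Submodule (Env 𝔏) (Q₀ g) :=
  Submodule.span (Env 𝔏) {q | ∃ z : radicalCenter 𝔏, χ z = 0 ∧ ∃ p : Q₀ g, q = (z : Env 𝔏) • p}

/-- The universal module `Q(0, χ) = Q(0) / 𝐦_χ Q(0)`. -/
abbrev Q₀χ (g : LieSubalgebra ℂ 𝔏) (χ : radicalCenter 𝔏 →ₐ[ℂ] ℂ) : Type u :=
  Q₀ g ⧸ charSubmodule g χ

/-- The sum of all proper submodules of `Q(0, χ)`; it is the unique maximal submodule. -/
noncomputable def maxSubmodule (g : LieSubalgebra ℂ 𝔏) (χ : radicalCenter 𝔏 →ₐ[ℂ] ℂ) :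
    Submodule (Env 𝔏) (Q₀χ g χ) :=
  sSup {N | N ≠ ⊤}

/-- The underlying space of `V(0, χ)`, the unique simple quotient of `Q(0, χ)`. -/
abbrev V₀ (g : LieSubalgebra ℂ 𝔏) (χ : radicalCenter 𝔏 →ₐ[ℂ] ℂ) : Type u :=
  Q₀χ g χ ⧸ maxSubmodule g χ

/-- A `U(𝔏)`-module is an `𝔏`-module. -/
noncomputable instance (g : LieSubalgebra ℂ 𝔏) (χ : radicalCenter 𝔏 →ₐ[ℂ] ℂ) :
    LieRingModule 𝔏 (V₀ g χ) where
  bracket x v := (UniversalEnvelopingAlgebra.ι ℂ x : Env 𝔏) • v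
  add_lie x y v := by
    rw [map_add, add_smul]
  lie_add x v w := smul_add (UniversalEnvelopingAlgebra.ι ℂ x : Env 𝔏) v w
  leibniz_lie x y v := by
    change (UniversalEnvelopingAlgebra.ι ℂ x : Env 𝔏) • (UniversalEnvelopingAlgebra.ι ℂ y : Env 𝔏) • v
      = (UniversalEnvelopingAlgebra.ι ℂ ⁅x, y⁆ : Env 𝔏) • v
        + (UniversalEnvelopingAlgebra.ι ℂ y : Env 𝔏) • (UniversalEnvelopingAlgebra.ι ℂ x : Env 𝔏) • v
    let _ : LieRing (Env 𝔏) := LieRing.ofAssociativeRing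
    rw [LieHom.map_lie, LieRing.of_associative_ring_bracket, sub_smul, mul_smul, mul_smul,
      sub_add_cancel]

instance (g : LieSubalgebra ℂ 𝔏) (χ : radicalCenter 𝔏 →ₐ[ℂ] ℂ) : LieModule ℂ 𝔏 (V₀ g χ) where
  smul_lie c x v := by
    change (UniversalEnvelopingAlgebra.ι ℂ (c • x) : Env 𝔏) • v
      = c • (UniversalEnvelopingAlgebra.ι ℂ x : Env 𝔏) • v
    rw [map_smul, smul_assoc]
  lie_smul c x v := by
    change (UniversalEnvelopingAlgebra.ι ℂ x : Env 𝔏) • (c • v)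
      = c • (UniversalEnvelopingAlgebra.ι ℂ x : Env 𝔏) • v
    rw [← algebraMap_smul (Env 𝔏) c v, ← mul_smul, ← Algebra.commutes, mul_smul, algebraMap_smul]

/-- The expression `∑_M l_{M,L}^L [V(0, χ) : M]`, where `M` runs through the isomorphism classes of
simple finite-dimensional `g`-modules and `l_{M,L}^L` is the multiplicity of `L` in `M ⊗ L`. -/
noncomputable def bound (g : LieSubalgebra ℂ 𝔏) (χ : radicalCenter 𝔏 →ₐ[ℂ] ℂ)
    (L : Type u) [AddCommGroup L] [Module ℂ L] [LieRingModule g L] [LieModule ℂ g L] : ℕ∞ :=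
  ∑' M : isoClasses (A := g) IsSimpleFinDim,
    mult g (M.1.out ⊗[ℂ] L) L * mult g (V₀ g χ) M.1.out

/-- Simple `g`-Harish-Chandra modules with radical central character `χ` that have `L` as a
`g`-type. -/
def IsSimpleHC (g : LieSubalgebra ℂ 𝔏) (χ : radicalCenter 𝔏 →ₐ[ℂ] ℂ)
    (L : Type u) [AddCommGroup L] [Module ℂ L] [LieRingModule g L] [LieModule ℂ g L]
    (V : LieMod 𝔏) : Prop :=
  LieModule.IsIrreducible ℂ 𝔏 V ∧ IsHarishChandra g V ∧ HasRadicalCharacter χ V ∧ HasType g V L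

end Universal

end GenTakiff

set_option linter.unusedSectionVars false

namespace GenTakiff

/-! ### Complete reducibility of finite-dimensional modules, via Casimir operators. -/

section Weyl

open LieModule Module

variable {K g W : Type*} [Field K] [CharZero K] [LieRing g] [LieAlgebra K g]
  [FiniteDimensional K g] [AddCommGroup W] [Module K W] [LieRingModule g W] [LieModule K g W]

/-! All simple modules in question are quotients of one module, C = V(0, χ) ⊗ L, on which r acts
through the first factor only (`Cover`).

Let V be such a simple module and φ : L → V a g-embedding. Then φ is a g-invariant vector of Hom(L,
V), and r acts there through V alone, so the orbit map of φ factors through Q(0, χ). The key point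
(`act_hom_eq_zero`) is that it factors through V(0, χ). Let I be the ideal of elements of U(r) whose
image in Q(0, χ) lies in the sum of all proper submodules. By simplicity IV is 0 or V. If IV = V,
then, V being finitely generated over U(r), Nakayama's lemma gives s in 1 + I annihilating V, hence
φ. The annihilator of φ has proper image in Q(0, χ), so s, and with it 1 = s - (s - 1), falls into
the sum of proper submodules, which is absurd. So IV = 0, and by adjunction the map V(0, χ) → Hom(L,
V) becomes a nonzero map C → V (`exists_hom_cover`).

For the bound, pairwise nonisomorphic simple quotients of C are jointly independent, and by complete
reducibility the embeddings of L into them lift to linearly independent g-maps L → C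
(`card_le_finrank_of_hasType`). Their number is thus at most [C : L], and splitting V(0, χ) into
simple g-modules M bounds this by the sum (`finrank_hom_tensor_le`). Only simple quotients M of
End(L) contribute, so the sum is finite. Each [V(0, χ) : M] is finite by Hilbert's argument: U(r) is
commutative and Noetherian, and the Reynolds operator turns coefficients in U(r) into values of χ
(`finiteDimensional_maxTriv`).

For existence, C is nonzero and Noetherian over U(r), hence has a maximal submodule. It cannot
contain the generating subspace 1 ⊗ L, so L survives in the quotient.

That the sum of all proper submodules of Q(0, χ) is proper (`toQ_one_notMem`) follows from a
functional: χ of the g-invariant part is well defined on Q(0, χ), vanishes on every proper submodule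
and equals 1 at the generator. -/

theorem lie_top_top_eq_top [LieAlgebra.IsKilling K g] : ⁅(⊤ : LieIdeal K g), (⊤ : LieIdeal K g)⁆ = ⊤ := by
  set D : LieIdeal K g := ⁅(⊤ : LieIdeal K g), (⊤ : LieIdeal K g)⁆ with hD
  have h := D.isCompl_killingCompl
  have h0 : D.killingCompl = ⊥ := by
    rw [LieSubmodule.eq_bot_iff]
    intro x hx
    have hc : x ∈ LieAlgebra.center K g := by
      rw [LieModule.mem_maxTrivSubmodule]
      intro b
      refine (LieAlgebra.IsKilling.killingForm_nondegenerate K g).2 _ fun a => ?_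
      rw [← LieModule.traceForm_apply_lie_apply]
      exact (LieIdeal.mem_killingCompl K g D).mp hx _
        (LieSubmodule.lie_mem_lie (LieSubmodule.mem_top a) (LieSubmodule.mem_top b))
    simpa using hc
  rw [h0] at h
  simpa using h.sup_eq_top

/-- A vanishing trace form makes the derived algebra, which is all of g, act nilpotently. Since g =
[g, g], writing x = [a, b] turns xw into a(bw) - b(aw), so the lower central series of W is constant
from its first step on. A nilpotent action then forces gW = 0. -/
theorem isTrivial_of_traceForm_eq_zero [LieAlgebra.IsKilling K g] [FiniteDimensional K W]
    (h : traceForm K g W = 0) : IsTrivial g W := by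
  have h1 := isNilpotent_derivedSeries_of_traceForm_eq_zero h
  have hD : LieAlgebra.derivedSeries K g 1 = ⊤ := by
    rw [LieAlgebra.derivedSeries_def, LieAlgebra.derivedSeriesOfIdeal_succ,
      LieAlgebra.derivedSeriesOfIdeal_zero, lie_top_top_eq_top]
  have h2 : LieModule.IsNilpotent g W := by
    rw [isNilpotent_iff_forall' (R := K)] at h1 ⊢
    intro x
    exact h1 ⟨x, by rw [hD]; exact LieSubmodule.mem_top x⟩
  have h3 : ∀ k, lowerCentralSeries K g W 1 ≤ lowerCentralSeries K g W k := by
    intro k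
    induction k with
    | zero => simp
    | succ k ih =>
      rw [LieModule.lowerCentralSeries_succ, LieModule.lowerCentralSeries_zero]
      conv_lhs => rw [← lie_top_top_eq_top (K := K) (g := g)]
      rw [LieSubmodule.lieIdeal_oper_eq_span, LieSubmodule.lieSpan_le]
      rintro _ ⟨⟨x, hx⟩, ⟨w, -⟩, rfl⟩
      rw [SetLike.mem_coe]
      change ⁅x, w⁆ ∈ _
      have hx' : x ∈ (⁅(⊤ : LieIdeal K g), (⊤ : LieIdeal K g)⁆ : LieIdeal K g).toSubmodule := hx
      rw [LieSubmodule.lieIdeal_oper_eq_linear_span'] at hx'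
      clear hx
      induction hx' using Submodule.span_induction with
      | mem u hu =>
        obtain ⟨a, -, b, -, rfl⟩ := hu
        rw [lie_lie]
        refine sub_mem ?_ ?_ <;>
        · rw [LieModule.lowerCentralSeries_succ]
          refine LieSubmodule.lie_mem_lie (LieSubmodule.mem_top _) (ih ?_)
          rw [LieModule.lowerCentralSeries_succ]
          exact LieSubmodule.lie_mem_lie (LieSubmodule.mem_top _) (LieSubmodule.mem_top _)
      | zero => simp
      | add u v _ _ hu hv => rw [add_lie]; exact add_mem hu hv
      | smul t u _ hu => rw [smul_lie]; exact SMulMemClass.smul_mem _ hu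
  obtain ⟨k, hk⟩ := (LieModule.isNilpotent_iff K g W).mp h2
  refine ⟨fun x m => ?_⟩
  have := h3 k
  rw [hk] at this
  have h4 := this (x := ⁅x, m⁆) (by
    rw [LieModule.lowerCentralSeries_succ]
    exact LieSubmodule.lie_mem_lie (LieSubmodule.mem_top _) (LieSubmodule.mem_top _))
  simpa using h4

/-- The Casimir operator of an ideal with respect to an invariant nondegenerate form, with a basis
chosen. -/
noncomputable def casimir {ι : Type*} [Fintype ι] (W : Type*) [AddCommGroup W] [Module K W]
    [LieRingModule g W] [LieModule K g W] (b b' : ι → g) : W →ₗ[K] W :=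
  ∑ i, toEnd K g W (b i) * toEnd K g W (b' i)

theorem casimir_apply {ι : Type*} [Fintype ι] (b b' : ι → g) (w : W) :
    casimir (K := K) W b b' w = ∑ i, ⁅b i, ⁅b' i, w⁆⁆ := by
  simp [casimir, LinearMap.sum_apply]

/-- By invariance of B, the matrices of ad x in the basis and in the dual basis are negative
transposes of each other, so the two families of commutator terms cancel. -/
theorem casimir_lie {ι : Type*} [Fintype ι] [DecidableEq ι] (J : LieIdeal K g)
    (B : LinearMap.BilinForm K g) (hB : ∀ x y z : g, B ⁅x, y⁆ z = - B y ⁅x, z⁆)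
    (hs : LinearMap.BilinForm.IsSymm (B.restrict J.toSubmodule))
    (hn : (B.restrict J.toSubmodule).Nondegenerate) (b : Basis ι K J) (x : g) (w : W) :
    casimir (K := K) W (fun i => (b i : g))
      (fun i => (((B.restrict J.toSubmodule).dualBasis hn b i : J) : g)) ⁅x, w⁆ =
    ⁅x, casimir (K := K) W (fun i => (b i : g))
      (fun i => (((B.restrict J.toSubmodule).dualBasis hn b i : J) : g)) w⁆ := by
  set b' := (B.restrict J.toSubmodule).dualBasis hn b with hb'
  have hbb (i j) : B (b i) (b' j) = if i = j then 1 else 0 :=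
    LinearMap.BilinForm.apply_dualBasis_right hn hs b i j
  have e1 (y : J) : y = ∑ k, B y (b' k) • b k := by
    conv_lhs => rw [← b.sum_repr y]
    refine Finset.sum_congr rfl fun k _ => ?_
    congr 1
    have : (y : g) = ∑ i, b.repr y i • (b i : g) := by
      conv_lhs => rw [← b.sum_repr y]
      simp only [AddSubmonoidClass.coe_finsetSum, SetLike.val_smul]
    rw [this]
    simp [LinearMap.sum_apply, hbb]
  have e2 (y : J) : y = ∑ k, B (b k) y • b' k := by
    conv_lhs => rw [← b'.sum_repr y]
    refine Finset.sum_congr rfl fun k _ => ?_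
    congr 1
    have : (y : g) = ∑ i, b'.repr y i • (b' i : g) := by
      conv_lhs => rw [← b'.sum_repr y]
      simp only [AddSubmonoidClass.coe_finsetSum, SetLike.val_smul]
    rw [this]
    simp [hbb]
  have f1 (i) : ⁅x, (b i : g)⁆ = ∑ k, B ⁅x, (b i : g)⁆ (b' k) • (b k : g) := by
    have := congrArg (Subtype.val) (e1 ⁅x, b i⁆)
    simpa using this
  have f2 (i) : ⁅x, (b' i : g)⁆ = ∑ k, B (b k) ⁅x, (b' i : g)⁆ • (b' k : g) := by
    have := congrArg (Subtype.val) (e2 ⁅x, b' i⁆)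
    simpa using this
  rw [casimir_apply, casimir_apply, lie_sum, ← sub_eq_zero, ← Finset.sum_sub_distrib]
  have : ∀ i, ⁅(b i : g), ⁅(b' i : g), ⁅x, w⁆⁆⁆ - ⁅x, ⁅(b i : g), ⁅(b' i : g), w⁆⁆⁆ =
      (-∑ k, B (b k) ⁅x, (b' i : g)⁆ • ⁅(b i : g), ⁅(b' k : g), w⁆⁆) +
      ∑ k, B (b i) ⁅x, (b' k : g)⁆ • ⁅(b k : g), ⁅(b' i : g), w⁆⁆ := by
    intro i
    have g1 : ⁅(b i : g), ⁅⁅x, (b' i : g)⁆, w⁆⁆ =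
        ∑ k, B (b k) ⁅x, (b' i : g)⁆ • ⁅(b i : g), ⁅(b' k : g), w⁆⁆ := by
      conv_lhs => rw [f2, sum_lie, lie_sum]
      simp only [smul_lie, lie_smul]
    have g2 : ⁅⁅x, (b i : g)⁆, ⁅(b' i : g), w⁆⁆ =
        -∑ k, B (b i) ⁅x, (b' k : g)⁆ • ⁅(b k : g), ⁅(b' i : g), w⁆⁆ := by
      rw [f1, sum_lie, ← Finset.sum_neg_distrib]
      simp only [hB, neg_smul, neg_lie, smul_lie]
    rw [← g1, ← neg_eq_iff_eq_neg.mpr g2]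
    simp only [lie_lie, lie_sub]
    abel
  simp_rw [this]
  rw [Finset.sum_add_distrib, Finset.sum_neg_distrib, Finset.sum_comm]
  simp

/-- Each summand has trace B(bᵢ, b'ᵢ) = 1. In characteristic zero this shows that the operator is
not nilpotent when J is nonzero. -/
theorem trace_casimir {ι : Type*} [Fintype ι] [DecidableEq ι] [FiniteDimensional K W]
    (J : LieIdeal K g) (hs : LinearMap.BilinForm.IsSymm ((traceForm K g W).restrict J.toSubmodule))
    (hn : ((traceForm K g W).restrict J.toSubmodule).Nondegenerate) (b : Basis ι K J) :
    LinearMap.trace K W (casimir (K := K) W (fun i => (b i : g))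
      (fun i => ((((traceForm K g W).restrict J.toSubmodule).dualBasis hn b i : J) : g))) =
    Fintype.card ι := by
  rw [casimir, map_sum]
  have (i : ι) : LinearMap.trace K W (toEnd K g W (b i : g) * toEnd K g W
      ((((traceForm K g W).restrict J.toSubmodule).dualBasis hn b i : J) : g)) = 1 := by
    have := LinearMap.BilinForm.apply_dualBasis_right hn hs b i i
    rw [if_pos rfl] at this
    exact this
  simp [this]

/-- Every nontrivial finite-dimensional module has an equivariant, non-nilpotent operator which is a
sum of products of two elements of the Lie algebra. -/
theorem exists_casimir [LieAlgebra.IsKilling K g] [FiniteDimensional K W] (h : ¬ IsTrivial g W) :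
    ∃ C : W →ₗ⁅K, g⁆ W, ¬ IsNilpotent (C : W →ₗ[K] W) ∧
      (∀ w, C w ∈ ⁅(⊤ : LieIdeal K g), (⊤ : LieSubmodule K g W)⁆) ∧
      ∀ w ∈ maxTrivSubmodule K g W, C w = 0 := by
  classical
  set B := traceForm K g W with hBdef
  have hinv := traceForm_lieInvariant K g W
  let N : LieIdeal K g := LieAlgebra.InvariantForm.orthogonal B hinv ⊤
  have hN (x) : x ∈ N ↔ ∀ y, B y x = 0 := by
    simp [N, LieAlgebra.InvariantForm.mem_orthogonal]
  -- N is the kernel of the trace form of W. Its Killing complement J carries a nondegenerate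
  -- restriction of that form: an element of J orthogonal to J is also orthogonal to N, hence lies
  -- in N ∩ J. If J were zero, the trace form would vanish and W would be trivial.
  let J := N.killingCompl
  have hJ : IsCompl N J := N.isCompl_killingCompl
  have hJ0 : J ≠ ⊥ := by
    intro h0
    rw [h0] at hJ
    apply h
    apply isTrivial_of_traceForm_eq_zero (K := K)
    ext x y
    have : y ∈ N := by rw [show N = ⊤ by simpa using hJ.sup_eq_top]; exact LieSubmodule.mem_top y
    exact (hN y).mp this x
  have hs : LinearMap.BilinForm.IsSymm (B.restrict J.toSubmodule) :=
    ⟨fun x y => traceForm_comm K g W x y⟩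
  have hn : (B.restrict J.toSubmodule).Nondegenerate := by
    have key : ∀ x : J, (∀ y : J, B y x = 0) → x = 0 := by
      intro x hx
      have : (x : g) ∈ N := by
        rw [hN]
        intro y
        have hy : y ∈ N ⊔ J := by rw [hJ.sup_eq_top]; exact LieSubmodule.mem_top y
        obtain ⟨n, hn, j, hj, rfl⟩ := (LieSubmodule.mem_sup _ _ _).mp hy
        rw [map_add, LinearMap.add_apply, hx ⟨j, hj⟩, traceForm_comm, (hN n).mp hn, add_zero]
      have h' : (x : g) ∈ N ⊓ J := ⟨this, x.2⟩
      rw [hJ.inf_eq_bot] at h'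
      exact Subtype.ext (by simpa using h')
    refine ⟨fun x hx => key x fun y => ?_, fun y hy => key y fun x => hy x⟩
    rw [traceForm_comm]; exact hx y
  let b := Module.finBasis K J
  let b' := (B.restrict J.toSubmodule).dualBasis hn b
  have hd : 0 < Module.finrank K J := by
    rw [Module.finrank_pos_iff]
    exact (LieSubmodule.nontrivial_iff_ne_bot K g g).mpr hJ0
  refine ⟨{ casimir (K := K) W (fun i => (b i : g)) (fun i => (b' i : g)) with
    map_lie' := fun {x w} => casimir_lie J B hinv hs hn b x w }, ?_, ?_, ?_⟩
  · intro hnil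
    have h1 := LinearMap.isNilpotent_trace_of_isNilpotent hnil
    have h2 := trace_casimir J hs hn b
    have h3 : LinearMap.trace K W (casimir (K := K) W (fun i => (b i : g)) (fun i => (b' i : g)))
      = 0 := h1.eq_zero
    rw [h3, Fintype.card_fin] at h2
    exact hd.ne (by exact_mod_cast h2)
  · intro w
    change casimir (K := K) W (fun i => (b i : g)) (fun i => (b' i : g)) w ∈ _
    rw [casimir_apply]
    exact sum_mem fun i _ => LieSubmodule.lie_mem_lie (LieSubmodule.mem_top _)
      (LieSubmodule.mem_top _)
  · intro w hw
    change casimir (K := K) W (fun i => (b i : g)) (fun i => (b' i : g)) w = _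
    rw [casimir_apply]
    exact Finset.sum_eq_zero fun i _ => by
      rw [(mem_maxTrivSubmodule K g W w).mp hw, lie_zero]

variable (K g W) in
/-- The submodule `g W` spanned by all `⁅x, w⁆`. -/
abbrev lieRange : LieSubmodule K g W := ⁅(⊤ : LieIdeal K g), (⊤ : LieSubmodule K g W)⁆

theorem lie_mem_lieRange (x : g) (w : W) : ⁅x, w⁆ ∈ lieRange K g W :=
  LieSubmodule.lie_mem_lie (LieSubmodule.mem_top _) (LieSubmodule.mem_top _)

theorem map_mem_lieRange {W' : Type*} [AddCommGroup W'] [Module K W'] [LieRingModule g W']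
    [LieModule K g W'] (f : W →ₗ⁅K, g⁆ W') {w : W} (hw : w ∈ lieRange K g W) :
    f w ∈ lieRange K g W' := by
  rw [lieRange, ← LieSubmodule.mem_toSubmodule, LieSubmodule.lieIdeal_oper_eq_linear_span'] at hw
  induction hw using Submodule.span_induction with
  | mem u hu =>
    obtain ⟨a, -, b, -, rfl⟩ := hu
    rw [LieModuleHom.map_lie]
    exact lie_mem_lieRange _ _
  | zero => simp
  | add u v _ _ hu hv => rw [map_add]; exact add_mem hu hv
  | smul t u _ hu => rw [map_smul]; exact SMulMemClass.smul_mem _ hu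

/-- Induction on the dimension through the Fitting decomposition of a Casimir operator C: its stable
range lies in gW, its stable kernel contains all invariants, and the kernel is smaller than W
because C is not nilpotent. -/
theorem isCompl_maxTriv_lieRange_aux [LieAlgebra.IsKilling K g] (n : ℕ) :
    ∀ (W : Type u) [AddCommGroup W] [Module K W] [LieRingModule g W] [LieModule K g W]
    [FiniteDimensional K W], Module.finrank K W = n →
    IsCompl (maxTrivSubmodule K g W) (lieRange K g W) := by
  induction n using Nat.strong_induction_on with
  | _ n ih =>
  intro W _ _ _ _ _ hW
  by_cases htriv : IsTrivial g W
  · have h1 : maxTrivSubmodule K g W = ⊤ := by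
      rwa [← isTrivial_iff_max_triv_eq_top]
    have h2 : lieRange K g W = ⊥ := by
      rw [LieSubmodule.lie_eq_bot_iff]
      intro x _ m _
      exact htriv.trivial x m
    rw [h1, h2]
    exact isCompl_top_bot
  · obtain ⟨C, hC1, hC2, hC3⟩ := exists_casimir (K := K) htriv
    obtain ⟨k, hk⟩ := Filter.eventually_atTop.mp
      (LinearMap.eventually_isCompl_ker_pow_range_pow (C : W →ₗ[K] W))
    -- The exponent is taken positive so that the power factors through C: its range then lies in gW
    -- and it kills the invariants.
    have hk' := hk (k + 1) (by omega)
    have hpow : ∀ (m : ℕ) (x : g) (w : W), ((C : W →ₗ[K] W) ^ m) ⁅x, w⁆ =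
        ⁅x, ((C : W →ₗ[K] W) ^ m) w⁆ := by
      intro m x
      induction m with
      | zero => simp
      | succ m ihm =>
        intro w
        rw [pow_succ, Module.End.mul_apply, LieModuleHom.coe_toLinearMap, LieModuleHom.map_lie,
          ihm, Module.End.mul_apply, LieModuleHom.coe_toLinearMap]
    let D : W →ₗ⁅K, g⁆ W :=
      { ((C : W →ₗ[K] W) ^ (k + 1)) with map_lie' := fun {x w} => hpow _ x w }
    have hD : IsCompl D.ker D.range := by
      rw [← LieSubmodule.isCompl_toSubmodule, LieModuleHom.ker_toSubmodule,
        LieModuleHom.toSubmodule_range]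
      exact hk'
    have hDne : D.ker ≠ ⊤ := by
      intro h0
      apply hC1
      refine ⟨k + 1, LinearMap.ext fun w => ?_⟩
      have : w ∈ D.ker := by rw [h0]; exact LieSubmodule.mem_top w
      exact this
    have hlt : Module.finrank K D.ker < n := by
      rw [← hW]
      refine Submodule.finrank_lt (s := D.ker.toSubmodule) ?_
      rw [Ne, LieSubmodule.toSubmodule_eq_top]
      exact hDne
    have ihD := ih _ hlt D.ker rfl
    have hrange : ∀ w ∈ D.range, w ∈ lieRange K g W := by
      intro w hw
      obtain ⟨v, rfl⟩ := (LieModuleHom.mem_range D w).mp hw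
      have : D v = C (((C : W →ₗ[K] W) ^ k) v) := by
        change ((C : W →ₗ[K] W) ^ (k + 1)) v = _
        rw [pow_succ']
        rfl
      rw [this]
      exact hC2 _
    have htriv_ker : ∀ w ∈ maxTrivSubmodule K g W, w ∈ D.ker := by
      intro w hw
      rw [LieModuleHom.mem_ker]
      change ((C : W →ₗ[K] W) ^ (k + 1)) w = _
      rw [pow_succ, Module.End.mul_apply, LieModuleHom.coe_toLinearMap, hC3 w hw, map_zero]
    constructor
    · rw [disjoint_iff, LieSubmodule.eq_bot_iff]
      rintro w ⟨hw1, hw2⟩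
      -- The decomposition splits gW into g(ker D) and a part inside the range. An invariant w lies
      -- in ker D, so b lies in both summands and vanishes, and induction applies to a.
      have hw2' : ∃ a ∈ lieRange K g D.ker, ∃ b ∈ D.range, w = (a : W) + b := by
        change w ∈ (lieRange K g W).toSubmodule at hw2
        rw [lieRange, LieSubmodule.lieIdeal_oper_eq_linear_span'] at hw2
        clear hw1
        induction hw2 using Submodule.span_induction with
        | mem u hu =>
          obtain ⟨x, -, v, -, rfl⟩ := hu
          have hv : v ∈ D.ker ⊔ D.range := by rw [hD.sup_eq_top]; exact LieSubmodule.mem_top v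
          obtain ⟨p, hp, q, hq, rfl⟩ := (LieSubmodule.mem_sup _ _ _).mp hv
          exact ⟨⁅x, (⟨p, hp⟩ : D.ker)⁆, lie_mem_lieRange _ _, ⁅x, q⁆, D.range.lie_mem hq, by simp⟩
        | zero => exact ⟨0, zero_mem _, 0, zero_mem _, by simp⟩
        | add u v _ _ hu hv =>
          obtain ⟨a, ha, b, hb, rfl⟩ := hu
          obtain ⟨a', ha', b', hb', rfl⟩ := hv
          exact ⟨a + a', add_mem ha ha', b + b', add_mem hb hb', by push_cast; abel⟩
        | smul t u _ hu =>
          obtain ⟨a, ha, b, hb, rfl⟩ := hu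
          exact ⟨t • a, SMulMemClass.smul_mem _ ha, t • b, SMulMemClass.smul_mem _ hb, by simp⟩
      obtain ⟨a, ha, b, hb, rfl⟩ := hw2'
      have hker := htriv_ker _ hw1
      have hb' : b ∈ D.ker ⊓ D.range := ⟨by simpa using sub_mem hker a.2, hb⟩
      rw [hD.inf_eq_bot] at hb'
      have hb0 : b = 0 := by simpa using hb'
      subst hb0
      have ha' : a ∈ maxTrivSubmodule K g D.ker ⊓ lieRange K g D.ker := by
        refine ⟨?_, ha⟩
        refine (mem_maxTrivSubmodule K g _ _).mpr ?_
        intro x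
        have := (mem_maxTrivSubmodule K g W _).mp hw1 x
        exact Subtype.ext (by simpa using this)
      rw [ihD.inf_eq_bot] at ha'
      have : a = 0 := by simpa using ha'
      simp [this]
    · rw [codisjoint_iff, eq_top_iff]
      intro w _
      have hw : w ∈ D.ker ⊔ D.range := by rw [hD.sup_eq_top]; exact LieSubmodule.mem_top w
      obtain ⟨p, hp, q, hq, rfl⟩ := (LieSubmodule.mem_sup _ _ _).mp hw
      have hp' : (⟨p, hp⟩ : D.ker) ∈ maxTrivSubmodule K g D.ker ⊔ lieRange K g D.ker := by
        rw [ihD.sup_eq_top]; exact LieSubmodule.mem_top _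
      obtain ⟨s, hs, t, ht, hst⟩ := (LieSubmodule.mem_sup _ _ _).mp hp'
      have hst' : p = (s : W) + t := by simpa using (congrArg Subtype.val hst).symm
      rw [LieSubmodule.mem_sup]
      refine ⟨s, ?_, t + q, add_mem (map_mem_lieRange D.ker.incl ht) (hrange q hq), ?_⟩
      · rw [mem_maxTrivSubmodule]
        intro x
        simpa using congrArg Subtype.val ((mem_maxTrivSubmodule K g _ _).mp hs x)
      · rw [hst', add_assoc]

/-- **Weyl's theorem**, in terms of invariants: a finite-dimensional module is the direct sum of its
invariants and of the span of all `⁅x, w⁆`. -/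
theorem isCompl_maxTriv_lieRange [LieAlgebra.IsKilling K g] [FiniteDimensional K W] :
    IsCompl (maxTrivSubmodule K g W) (lieRange K g W) :=
  isCompl_maxTriv_lieRange_aux _ W rfl

end Weyl

/-! ### Locally finite modules: Reynolds operator, lifting of homomorphisms, semisimplicity. -/

section LocallyFinite

open LieModule Module

variable {K g W W' M : Type*} [Field K] [LieRing g] [LieAlgebra K g]
  [AddCommGroup W] [Module K W] [LieRingModule g W] [LieModule K g W]
  [AddCommGroup W'] [Module K W'] [LieRingModule g W'] [LieModule K g W']
  [AddCommGroup M] [Module K M] [LieRingModule g M] [LieModule K g M]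

variable (K g W) in
/-- A module is locally finite if every vector lies in a finite-dimensional submodule. -/
def LocFin : Prop :=
  ∀ w : W, ∃ N : LieSubmodule K g W, FiniteDimensional K N ∧ w ∈ N

theorem LocFin.of_finiteDimensional [FiniteDimensional K W] : LocFin K g W := fun w =>
  ⟨⊤, Module.Finite.equiv (LinearEquiv.ofTop (⊤ : Submodule K W) rfl).symm, LieSubmodule.mem_top w⟩

theorem LocFin.of_surjective (h : LocFin K g W) (f : W →ₗ⁅K, g⁆ W') (hf : Function.Surjective f) :
    LocFin K g W' := by
  intro w'
  obtain ⟨w, rfl⟩ := hf w'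
  obtain ⟨N, hN, hw⟩ := h w
  refine ⟨N.map f, ?_, LieSubmodule.mem_map_of_mem hw⟩
  exact Module.Finite.map N.toSubmodule (f : W →ₗ[K] W')

theorem LocFin.of_injective (h : LocFin K g W') (f : W →ₗ⁅K, g⁆ W') (hf : Function.Injective f) :
    LocFin K g W := by
  intro w
  obtain ⟨N, hN, hw⟩ := h (f w)
  refine ⟨N.comap f, ?_, hw⟩
  let φ : N.comap f →ₗ[K] N :=
    { toFun := fun x => ⟨f x, x.2⟩
      map_add' := fun x y => Subtype.ext (map_add f _ _)
      map_smul' := fun t x => Subtype.ext (map_smul f _ _) }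
  exact Module.Finite.of_injective φ fun x y hxy =>
    Subtype.ext (hf (congrArg Subtype.val hxy))

theorem LocFin.lieSubmodule (h : LocFin K g W) (N : LieSubmodule K g W) : LocFin K g N :=
  h.of_injective N.incl N.injective_incl

theorem finiteDimensional_sup (N N' : LieSubmodule K g W) [FiniteDimensional K N]
    [FiniteDimensional K N'] : FiniteDimensional K (N ⊔ N' : LieSubmodule K g W) :=
  Submodule.finite_sup N.toSubmodule N'.toSubmodule

theorem LocFin.exists_finset (h : LocFin K g W) (s : Finset W) :
    ∃ N : LieSubmodule K g W, FiniteDimensional K N ∧ ∀ w ∈ s, w ∈ N := by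
  classical
  induction s using Finset.induction_on with
  | empty =>
    exact ⟨⊥, inferInstanceAs (FiniteDimensional K (⊥ : Submodule K W)), by simp⟩
  | insert a s _ ih =>
    obtain ⟨N, hN, hs⟩ := ih
    obtain ⟨N', hN', ha⟩ := h a
    refine ⟨N' ⊔ N, finiteDimensional_sup _ _, fun w hw => ?_⟩
    rcases Finset.mem_insert.mp hw with rfl | hw
    · exact LieSubmodule.mem_sup_left ha
    · exact LieSubmodule.mem_sup_right (hs w hw)

theorem LocFin.exists_range_le (h : LocFin K g W) [FiniteDimensional K M] (f : M →ₗ[K] W) :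
    ∃ N : LieSubmodule K g W, FiniteDimensional K N ∧ ∀ m, f m ∈ N := by
  classical
  let b := Module.finBasis K M
  obtain ⟨N, hN, hs⟩ := h.exists_finset (Finset.univ.image fun i => f (b i))
  refine ⟨N, hN, fun m => ?_⟩
  rw [← b.sum_repr m, map_sum]
  refine sum_mem fun i _ => ?_
  rw [map_smul]
  exact SMulMemClass.smul_mem _ (hs _ (Finset.mem_image_of_mem _ (Finset.mem_univ i)))

/-- The maps into `W` that take values in the submodule `N`. -/
def homInto (M : Type*) [AddCommGroup M] [Module K M] [LieRingModule g M] [LieModule K g M]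
    (N : LieSubmodule K g W) : LieSubmodule K g (M →ₗ[K] W) where
  carrier := {f | ∀ m, f m ∈ N}
  add_mem' := fun hf hf' m => add_mem (hf m) (hf' m)
  zero_mem' := fun _ => zero_mem _
  smul_mem' := fun t _ hf m => SMulMemClass.smul_mem t (hf m)
  lie_mem := fun {x f} hf m => by
    rw [LieHom.lie_apply]
    exact sub_mem (N.lie_mem (hf m)) (hf _)

theorem LocFin.hom (h : LocFin K g W) [FiniteDimensional K M] : LocFin K g (M →ₗ[K] W) := by
  intro f
  obtain ⟨N, hN, hf⟩ := h.exists_range_le f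
  refine ⟨homInto M N, ?_, hf⟩
  let φ : homInto M N →ₗ[K] (M →ₗ[K] N) :=
    { toFun := fun f => f.1.codRestrict N.toSubmodule f.2
      map_add' := fun f f' => rfl
      map_smul' := fun t f => rfl }
  refine Module.Finite.of_injective φ fun f f' hff => Subtype.ext (LinearMap.ext fun m => ?_)
  exact congrArg Subtype.val (LinearMap.congr_fun hff m)

theorem LocFin.tensor (h : LocFin K g W) (h' : LocFin K g W') : LocFin K g (W ⊗[K] W') := by
  intro t
  induction t using TensorProduct.induction_on with
  | zero => exact ⟨⊥, inferInstanceAs (FiniteDimensional K (⊥ : Submodule K _)), zero_mem _⟩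
  | tmul w w' =>
    obtain ⟨N, hN, hw⟩ := h w
    obtain ⟨N', hN', hw'⟩ := h' w'
    let f := TensorProduct.LieModule.mapIncl N N'
    refine ⟨f.range, ?_, (LieModuleHom.mem_range _ _).mpr ⟨⟨w, hw⟩ ⊗ₜ ⟨w', hw'⟩, ?_⟩⟩
    · exact Module.Finite.range (f : N ⊗[K] N' →ₗ[K] W ⊗[K] W')
    · simp [f]
  | add s t hs ht =>
    obtain ⟨N, hN, hs⟩ := hs
    obtain ⟨N', hN', ht⟩ := ht
    exact ⟨N ⊔ N', finiteDimensional_sup _ _,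
      add_mem (LieSubmodule.mem_sup_left hs) (LieSubmodule.mem_sup_right ht)⟩

theorem map_mem_maxTriv (f : W →ₗ⁅K, g⁆ W') {w : W} (hw : w ∈ maxTrivSubmodule K g W) :
    f w ∈ maxTrivSubmodule K g W' := by
  rw [mem_maxTrivSubmodule] at hw ⊢
  intro x
  rw [← LieModuleHom.map_lie, hw, map_zero]

variable [CharZero K] [FiniteDimensional K g] [LieAlgebra.IsKilling K g]

/-- An element of gW already lies in gN for some finite-dimensional submodule N, so both halves
reduce to the finite-dimensional case. -/
theorem LocFin.isCompl (h : LocFin K g W) : IsCompl (maxTrivSubmodule K g W) (lieRange K g W) := by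
  constructor
  · rw [disjoint_iff, LieSubmodule.eq_bot_iff]
    rintro w ⟨hw1, hw2⟩
    have key : ∃ N : LieSubmodule K g W, FiniteDimensional K N ∧
        ∃ a ∈ lieRange K g N, (a : W) = w := by
      change w ∈ (lieRange K g W).toSubmodule at hw2
      rw [lieRange, LieSubmodule.lieIdeal_oper_eq_linear_span'] at hw2
      clear hw1
      induction hw2 using Submodule.span_induction with
      | mem u hu =>
        obtain ⟨x, -, v, -, rfl⟩ := hu
        obtain ⟨N, hN, hv⟩ := h v
        exact ⟨N, hN, ⁅x, (⟨v, hv⟩ : N)⁆, lie_mem_lieRange _ _, rfl⟩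
      | zero =>
        exact ⟨⊥, inferInstanceAs (FiniteDimensional K (⊥ : Submodule K _)), 0, zero_mem _, rfl⟩
      | add u v _ _ hu hv =>
        obtain ⟨N, hN, a, ha, rfl⟩ := hu
        obtain ⟨N', hN', a', ha', rfl⟩ := hv
        exact ⟨N ⊔ N', finiteDimensional_sup _ _,
          LieSubmodule.inclusion le_sup_left a + LieSubmodule.inclusion le_sup_right a',
          add_mem (map_mem_lieRange _ ha) (map_mem_lieRange _ ha'), rfl⟩
      | smul t u _ hu =>
        obtain ⟨N, hN, a, ha, rfl⟩ := hu
        exact ⟨N, hN, t • a, SMulMemClass.smul_mem _ ha, rfl⟩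
    obtain ⟨N, hN, a, ha, rfl⟩ := key
    have ha' : a ∈ maxTrivSubmodule K g N ⊓ lieRange K g N := by
      refine ⟨(mem_maxTrivSubmodule K g _ _).mpr fun x => ?_, ha⟩
      exact Subtype.ext ((mem_maxTrivSubmodule K g W _).mp hw1 x)
    rw [isCompl_maxTriv_lieRange.inf_eq_bot] at ha'
    have : a = 0 := by simpa using ha'
    simp [this]
  · rw [codisjoint_iff, eq_top_iff]
    intro w _
    obtain ⟨N, hN, hw⟩ := h w
    have hw' : (⟨w, hw⟩ : N) ∈ maxTrivSubmodule K g N ⊔ lieRange K g N := by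
      rw [isCompl_maxTriv_lieRange.sup_eq_top]; exact LieSubmodule.mem_top _
    obtain ⟨s, hs, t, ht, hst⟩ := (LieSubmodule.mem_sup _ _ _).mp hw'
    exact (LieSubmodule.mem_sup _ _ _).mpr ⟨s, map_mem_maxTriv N.incl hs, t,
      map_mem_lieRange N.incl ht, congrArg Subtype.val hst⟩

/-- The projection of a locally finite module onto its invariants along `g W`. -/
noncomputable def LocFin.reynolds (h : LocFin K g W) : W →ₗ[K] W :=
  Submodule.projection _ _ (LieSubmodule.isCompl_toSubmodule.mpr h.isCompl)

theorem LocFin.reynolds_mem (h : LocFin K g W) (w : W) :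
    h.reynolds w ∈ maxTrivSubmodule K g W :=
  Submodule.projection_apply_mem _ w

theorem LocFin.sub_reynolds_mem (h : LocFin K g W) (w : W) :
    w - h.reynolds w ∈ lieRange K g W :=
  Submodule.sub_projection_mem (LieSubmodule.isCompl_toSubmodule.mpr h.isCompl) w

theorem LocFin.reynolds_eq (h : LocFin K g W) {w : W} (hw : w ∈ maxTrivSubmodule K g W) :
    h.reynolds w = w :=
  Submodule.projection_apply_left (LieSubmodule.isCompl_toSubmodule.mpr h.isCompl) ⟨w, hw⟩

theorem LocFin.reynolds_eq_zero (h : LocFin K g W) {w : W} (hw : w ∈ lieRange K g W) :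
    h.reynolds w = 0 :=
  (Submodule.projection_apply_eq_zero_iff (LieSubmodule.isCompl_toSubmodule.mpr h.isCompl)).mpr hw

/-- The Reynolds operator is natural. -/
theorem LocFin.map_reynolds (h : LocFin K g W) (h' : LocFin K g W') (f : W →ₗ⁅K, g⁆ W') (w : W) :
    f (h.reynolds w) = h'.reynolds (f w) := by
  have h1 := h'.reynolds_eq (map_mem_maxTriv f (h.reynolds_mem w))
  have h2 := h'.reynolds_eq_zero (map_mem_lieRange f (h.sub_reynolds_mem w))
  rw [map_sub, map_sub, h1, sub_eq_zero] at h2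
  exact h2.symm

/-- Invariants lift along surjections. -/
theorem LocFin.exists_invariant_lift (h : LocFin K g W) (f : W →ₗ⁅K, g⁆ W')
    (hf : Function.Surjective f) {w' : W'} (hw' : w' ∈ maxTrivSubmodule K g W') :
    ∃ w ∈ maxTrivSubmodule K g W, f w = w' := by
  obtain ⟨w, rfl⟩ := hf w'
  have h' := h.of_surjective f hf
  exact ⟨h.reynolds w, h.reynolds_mem w, by rw [h.map_reynolds h', h'.reynolds_eq hw']⟩

/-- Homomorphisms from finite-dimensional modules lift along surjections. -/
theorem LocFin.exists_hom_lift (h : LocFin K g W) [FiniteDimensional K M] (f : W →ₗ⁅K, g⁆ W')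
    (hf : Function.Surjective f) (φ : M →ₗ⁅K, g⁆ W') : ∃ ψ : M →ₗ⁅K, g⁆ W, ∀ m, f (ψ m) = φ m := by
  -- Equivariant maps are the invariants of Hom(M, -), and composition with f is a surjection of
  -- such Hom spaces because f has a linear section. Lifting homomorphisms is therefore lifting
  -- invariants.
  let F : (M →ₗ[K] W) →ₗ⁅K, g⁆ (M →ₗ[K] W') :=
    { toFun := fun ψ => (f : W →ₗ[K] W') ∘ₗ ψ
      map_add' := fun ψ ψ' => LinearMap.comp_add _ _ _
      map_smul' := fun t ψ => LinearMap.comp_smul _ _ _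
      map_lie' := fun {x ψ} => by ext m; simp }
  have hF : Function.Surjective F := by
    intro φ
    obtain ⟨s, hs⟩ := (f : W →ₗ[K] W').exists_rightInverse_of_surjective
      (LinearMap.range_eq_top.mpr hf)
    refine ⟨s ∘ₗ φ, LinearMap.ext fun m => ?_⟩
    exact LinearMap.congr_fun hs (φ m)
  obtain ⟨ψ, hψ, hψ'⟩ := (h.hom (M := M)).exists_invariant_lift F hF
    (w' := (maxTrivLinearMapEquivLieModuleHom.symm φ : maxTrivSubmodule K g (M →ₗ[K] W')).1)
    (maxTrivLinearMapEquivLieModuleHom.symm φ).2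
  exact ⟨maxTrivLinearMapEquivLieModuleHom ⟨ψ, hψ⟩, fun m => LinearMap.congr_fun hψ' m⟩

/-- Homomorphisms from a submodule of a finite-dimensional module extend. -/
theorem exists_hom_extend [FiniteDimensional K W] [FiniteDimensional K M] (j : M →ₗ⁅K, g⁆ W)
    (hj : Function.Injective j) (φ : M →ₗ⁅K, g⁆ W') (h' : LocFin K g W') :
    ∃ ψ : W →ₗ⁅K, g⁆ W', ∀ s, ψ (j s) = φ s := by
  let F : (W →ₗ[K] W') →ₗ⁅K, g⁆ (M →ₗ[K] W') :=
    { toFun := fun ψ => ψ ∘ₗ (j : M →ₗ[K] W)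
      map_add' := fun ψ ψ' => LinearMap.add_comp _ _ _
      map_smul' := fun t ψ => LinearMap.smul_comp _ _ _
      map_lie' := fun {x ψ} => by ext m; simp }
  have hF : Function.Surjective F := by
    intro φ
    obtain ⟨s, hs⟩ := (j : M →ₗ[K] W).exists_leftInverse_of_injective (LinearMap.ker_eq_bot.mpr hj)
    refine ⟨φ ∘ₗ s, LinearMap.ext fun m => ?_⟩
    exact congrArg φ (LinearMap.congr_fun hs m)
  obtain ⟨ψ, hψ, hψ'⟩ := (h'.hom (M := W)).exists_invariant_lift F hF
    (w' := (maxTrivLinearMapEquivLieModuleHom.symm φ : maxTrivSubmodule K g (M →ₗ[K] W')).1)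
    (maxTrivLinearMapEquivLieModuleHom.symm φ).2
  exact ⟨maxTrivLinearMapEquivLieModuleHom ⟨ψ, hψ⟩, fun m => LinearMap.congr_fun hψ' m⟩

theorem le_sSup_atoms_aux (n : ℕ) : ∀ N : LieSubmodule K g W, FiniteDimensional K N →
    Module.finrank K N = n → N ≤ sSup {a : LieSubmodule K g W | IsAtom a} := by
  induction n using Nat.strong_induction_on with
  | _ n ih =>
  intro N hN hn
  by_cases h0 : N = ⊥
  · rw [h0]; exact bot_le
  by_cases ha : IsAtom N
  · exact le_sSup ha
  obtain ⟨S, hSN, hS0⟩ : ∃ S, S < N ∧ S ≠ ⊥ := by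
    by_contra hcon
    push Not at hcon
    exact ha ⟨h0, hcon⟩
  have hSfd : FiniteDimensional K S := Submodule.finiteDimensional_of_le (S₂ := N.toSubmodule) hSN.le
  -- The identity of S extends to an equivariant retraction p of N onto S, whose kernel T is a
  -- complement of S in N. Both S and T have smaller dimension.
  obtain ⟨p, hp⟩ := exists_hom_extend (LieSubmodule.inclusion hSN.le)
    (LieSubmodule.inclusion_injective hSN.le) (LieModuleHom.id : S →ₗ⁅K, g⁆ S)
    (LocFin.of_finiteDimensional)
  set T : LieSubmodule K g W := p.ker.map N.incl with hT
  have hTN : T ≤ N := by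
    intro w hw
    obtain ⟨m, -, rfl⟩ := (LieSubmodule.mem_map _).mp hw
    exact m.2
  have hTlt : T < N := by
    refine lt_of_le_of_ne hTN fun hTe => hS0 ?_
    rw [LieSubmodule.eq_bot_iff]
    intro s hs
    have : s ∈ T := by rw [hTe]; exact hSN.le hs
    obtain ⟨m, hm, hms⟩ := (LieSubmodule.mem_map _).mp this
    have h1 := hp ⟨s, hs⟩
    have h2 : LieSubmodule.inclusion hSN.le ⟨s, hs⟩ = m := Subtype.ext hms.symm
    rw [h2, LieModuleHom.mem_ker.mp hm] at h1
    exact (congrArg Subtype.val h1).symm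
  have hTfd : FiniteDimensional K T := Submodule.finiteDimensional_of_le (S₂ := N.toSubmodule) hTN
  have hle : N ≤ S ⊔ T := by
    intro w hw
    refine (LieSubmodule.mem_sup _ _ _).mpr ⟨p ⟨w, hw⟩, (p ⟨w, hw⟩).2, w - p ⟨w, hw⟩, ?_, by simp⟩
    refine (LieSubmodule.mem_map _).mpr ⟨⟨w, hw⟩ - LieSubmodule.inclusion hSN.le (p ⟨w, hw⟩), ?_, rfl⟩
    rw [LieModuleHom.mem_ker, map_sub, hp]
    simp
  refine hle.trans (sup_le ?_ ?_)
  · exact ih _ (hn ▸ Submodule.finrank_lt_finrank_of_lt (s := S.toSubmodule) (t := N.toSubmodule) hSN)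
      S hSfd rfl
  · exact ih _ (hn ▸ Submodule.finrank_lt_finrank_of_lt (s := T.toSubmodule) (t := N.toSubmodule) hTlt)
      T hTfd rfl

theorem LocFin.sSup_atoms (h : LocFin K g W) : sSup {a : LieSubmodule K g W | IsAtom a} = ⊤ := by
  rw [eq_top_iff]
  intro w _
  obtain ⟨N, hN, hw⟩ := h w
  exact le_sSup_atoms_aux _ N hN rfl hw

omit [CharZero K] [FiniteDimensional K g] [LieAlgebra.IsKilling K g] in
theorem isIrreducible_of_isAtom {N : LieSubmodule K g W} (h : IsAtom N) : IsIrreducible K g N := by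
  have : Nontrivial N := (LieSubmodule.nontrivial_iff_ne_bot K g W).mpr h.1
  refine LieModule.IsIrreducible.mk fun S hS => ?_
  have h1 : S.map N.incl ≠ ⊥ := fun h0 => hS <| by
    rw [LieSubmodule.eq_bot_iff] at h0 ⊢
    intro m hm
    exact Subtype.ext (h0 m (LieSubmodule.mem_map_of_mem hm))
  have h2 : S.map N.incl ≤ N := by
    intro w hw
    obtain ⟨m, -, rfl⟩ := (LieSubmodule.mem_map _).mp hw
    exact m.2
  have h3 : S.map N.incl = N := (h.le_iff.mp h2).resolve_left h1
  rw [eq_top_iff]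
  intro m _
  have : (m : W) ∈ S.map N.incl := by rw [h3]; exact m.2
  obtain ⟨m', hm', hmm⟩ := (LieSubmodule.mem_map _).mp this
  rwa [← Subtype.ext hmm]

omit [CharZero K] [FiniteDimensional K g] [LieAlgebra.IsKilling K g] in
theorem LocFin.finiteDimensional_of_isIrreducible (h : LocFin K g W) (hW : IsIrreducible K g W) :
    FiniteDimensional K W := by
  have := LieModule.nontrivial_of_isIrreducible K g W
  obtain ⟨w, hw⟩ := exists_ne (0 : W)
  obtain ⟨N, hN, hwN⟩ := h w
  have : Nontrivial N := ⟨⟨⟨w, hwN⟩, 0, fun h0 => hw (congrArg Subtype.val h0)⟩⟩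
  have hNt : N = ⊤ := N.eq_top_of_isIrreducible K g W
  subst hNt
  exact Module.Finite.equiv (LinearEquiv.ofTop (⊤ : Submodule K W) rfl)

/-- A locally finite module is a direct sum of simple finite-dimensional submodules. -/
theorem LocFin.exists_isInternal (h : LocFin K g W) :
    ∃ s : Set (LieSubmodule K g W),
      (∀ i : s, IsIrreducible K g i.1 ∧ FiniteDimensional K i.1) ∧
      ∀ [DecidableEq s], DirectSum.IsInternal (fun i : s => i.1.toSubmodule) := by
  obtain ⟨s, hs1, hs2, hs3⟩ := exists_sSupIndep_of_sSup_atoms_eq_top h.sSup_atoms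
  refine ⟨s, fun i => ?_, ?_⟩
  · have h1 := isIrreducible_of_isAtom (hs3 i.2)
    exact ⟨h1, (h.lieSubmodule i.1).finiteDimensional_of_isIrreducible h1⟩
  · intro _
    refine DirectSum.isInternal_submodule_of_iSupIndep_of_iSup_eq_top ?_ ?_
    · exact LieSubmodule.iSupIndep_toSubmodule.mpr ((sSupIndep_iff _).mp hs1)
    · rw [LieSubmodule.iSup_toSubmodule_eq_top, ← sSup_eq_iSup', hs2]

end LocallyFinite

/-! ### Schur's lemma and independence of nonisomorphic simple quotients. -/

section SimpleQuotients

open LieModule Module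

variable {K g : Type*} [Field K] [LieRing g] [LieAlgebra K g]

section Schur

variable {V V' P : Type*} [AddCommGroup V] [Module K V] [LieRingModule g V] [LieModule K g V]
  [AddCommGroup V'] [Module K V'] [LieRingModule g V'] [LieModule K g V']
  [AddCommGroup P] [Module K P] [LieRingModule g P] [LieModule K g P]

theorem nonempty_equiv_of_bijective (f : V →ₗ⁅K, g⁆ V') (hf : Function.Bijective f) :
    Nonempty (V ≃ₗ⁅K, g⁆ V') :=
  ⟨{ f with
      invFun := (LinearEquiv.ofBijective (f : V →ₗ[K] V') hf).symm
      left_inv := (LinearEquiv.ofBijective (f : V →ₗ[K] V') hf).symm_apply_apply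
      right_inv := (LinearEquiv.ofBijective (f : V →ₗ[K] V') hf).apply_symm_apply }⟩

theorem injective_of_isIrreducible (hV : IsIrreducible K g V) (f : V →ₗ⁅K, g⁆ V') (hf : f ≠ 0) :
    Function.Injective f := by
  rw [← LieModuleHom.ker_eq_bot]
  refine (hV.eq_bot_or_eq_top _).resolve_right fun h => hf ?_
  ext v
  have : v ∈ f.ker := by rw [h]; exact LieSubmodule.mem_top v
  exact LieModuleHom.mem_ker.mp this

theorem surjective_of_isIrreducible (hV : IsIrreducible K g V') (f : V →ₗ⁅K, g⁆ V') (hf : f ≠ 0) :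
    Function.Surjective f := by
  rw [← LieModuleHom.range_eq_top]
  refine (hV.eq_bot_or_eq_top _).resolve_left fun h => hf ?_
  ext v
  have : f v ∈ f.range := (LieModuleHom.mem_range _ _).mpr ⟨v, rfl⟩
  rw [h] at this
  simpa using this

/-- **Schur's lemma**: a nonzero homomorphism of simple modules is an isomorphism. -/
theorem nonempty_equiv_of_ne_zero (hV : IsIrreducible K g V) (hV' : IsIrreducible K g V')
    (f : V →ₗ⁅K, g⁆ V') (hf : f ≠ 0) : Nonempty (V ≃ₗ⁅K, g⁆ V') :=
  nonempty_equiv_of_bijective f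
    ⟨injective_of_isIrreducible hV f hf, surjective_of_isIrreducible hV' f hf⟩

theorem surjOn_of_isIrreducible (hV : IsIrreducible K g V) (f : P →ₗ⁅K, g⁆ V)
    (S : LieSubmodule K g P) (hS : ∃ p ∈ S, f p ≠ 0) (v : V) : ∃ p ∈ S, f p = v := by
  obtain ⟨p, hp, hfp⟩ := hS
  have h := surjective_of_isIrreducible hV (f.comp S.incl)
    (fun h0 => hfp (LieModuleHom.congr_fun h0 ⟨p, hp⟩))
  obtain ⟨q, hq⟩ := h v
  exact ⟨q, q.2, hq⟩

/-- On S the map f' factors through f, and f maps S onto V. The induced map V → V' is nonzero and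
Schur's lemma applies. -/
theorem nonempty_equiv_of_ker_le (hV : IsIrreducible K g V) (hV' : IsIrreducible K g V')
    (f : P →ₗ⁅K, g⁆ V) (f' : P →ₗ⁅K, g⁆ V') (S : LieSubmodule K g P) (hS : ∃ p ∈ S, f p ≠ 0)
    (hS' : ∃ p ∈ S, f' p ≠ 0) (h : ∀ p ∈ S, f p = 0 → f' p = 0) :
    Nonempty (V ≃ₗ⁅K, g⁆ V') := by
  have hsurj := surjOn_of_isIrreducible hV f S hS
  let F : S →ₗ[K] V := (f.comp S.incl : S →ₗ⁅K, g⁆ V)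
  obtain ⟨σ, hσ⟩ := F.exists_rightInverse_of_surjective (LinearMap.range_eq_top.mpr fun v => by
    obtain ⟨p, hp, hv⟩ := hsurj v
    exact ⟨⟨p, hp⟩, hv⟩)
  have hσ' : ∀ v, f (σ v) = v := fun v => LinearMap.congr_fun hσ v
  have key : ∀ p ∈ S, f' (σ (f p)) = f' p := by
    intro p hp
    rw [← sub_eq_zero, ← map_sub]
    refine h _ (sub_mem (σ (f p)).2 hp) ?_
    rw [map_sub, hσ', sub_self]
  let φ : V →ₗ⁅K, g⁆ V' :=
    { ((f' : P →ₗ[K] V') ∘ₗ S.toSubmodule.subtype ∘ₗ σ) with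
      map_lie' := fun {x v} => by
        change f' (σ ⁅x, v⁆) = ⁅x, f' (σ v)⁆
        have := key ⁅x, (σ v : P)⁆ (S.lie_mem (σ v).2)
        rwa [LieModuleHom.map_lie, hσ', LieModuleHom.map_lie] at this }
  refine nonempty_equiv_of_ne_zero hV hV' φ fun h0 => ?_
  obtain ⟨p, hp, hne⟩ := hS'
  apply hne
  rw [← key p hp]
  exact LieModuleHom.congr_fun h0 (f p)

end Schur

variable {P : Type*} [AddCommGroup P] [Module K P] [LieRingModule g P] [LieModule K g P]
  {ι : Type*} {V : ι → Type*} [∀ i, AddCommGroup (V i)] [∀ i, Module K (V i)]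
  [∀ i, LieRingModule g (V i)] [∀ i, LieModule K g (V i)]

/-- Pairwise nonisomorphic simple quotients of a module are jointly independent. -/
theorem exists_ne_zero_of_notMem (hV : ∀ i, IsIrreducible K g (V i)) (f : ∀ i, P →ₗ⁅K, g⁆ V i)
    (hf : ∀ i, f i ≠ 0) (hne : ∀ i j, Nonempty (V i ≃ₗ⁅K, g⁆ V j) → i = j) (s : Finset ι) :
    ∀ i ∉ s, ∃ p, (∀ j ∈ s, f j p = 0) ∧ f i p ≠ 0 := by
  classical
  induction s using Finset.induction_on with
  | empty =>
    intro i _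
    by_contra hcon
    push Not at hcon
    exact hf i (by ext p; exact hcon p (by simp))
  | insert m s hms ih =>
    intro i hi
    rw [Finset.mem_insert, not_or] at hi
    by_contra hcon
    push Not at hcon
    -- By induction neither `f m` nor `f i` vanishes on S. If the claim failed, the kernel of `f m`
    -- on S would lie in that of `f i`, forcing the two quotients to be isomorphic.
    let S : LieSubmodule K g P := ⨅ j : s, (f j).ker
    have hS : ∀ p, p ∈ S ↔ ∀ j ∈ s, f j p = 0 := by
      intro p
      simp [S, LieSubmodule.mem_iInf]
    refine hi.1 (hne m i (nonempty_equiv_of_ker_le (hV m) (hV i) (f m) (f i) S ?_ ?_ ?_)).symm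
    · obtain ⟨p, hp, hp'⟩ := ih m hms
      exact ⟨p, (hS p).mpr hp, hp'⟩
    · obtain ⟨p, hp, hp'⟩ := ih i hi.2
      exact ⟨p, (hS p).mpr hp, hp'⟩
    · intro p hp hp'
      refine hcon p fun j hj => ?_
      rcases Finset.mem_insert.mp hj with rfl | hj
      · exact hp'
      · exact (hS p).mp hp j hj

/-- A finite-dimensional module has at most `dim P` pairwise nonisomorphic simple quotients. -/
theorem card_le_finrank_of_simple_quotients [FiniteDimensional K P] [Fintype ι]
    (hV : ∀ i, IsIrreducible K g (V i)) (f : ∀ i, P →ₗ⁅K, g⁆ V i)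
    (hf : ∀ i, f i ≠ 0) (hne : ∀ i j, Nonempty (V i ≃ₗ⁅K, g⁆ V j) → i = j) :
    Fintype.card ι ≤ finrank K P := by
  classical
  choose p hp hp' using fun i => exists_ne_zero_of_notMem hV f hf hne (Finset.univ.erase i) i
    (Finset.notMem_erase i _)
  refine LinearIndependent.fintype_card_le_finrank (b := p) ?_
  rw [Fintype.linearIndependent_iff]
  intro c hc i
  have := congrArg (f i) hc
  rw [map_sum, map_zero, Finset.sum_eq_single i] at this
  · rw [map_smul] at this
    exact (smul_eq_zero.mp this).resolve_right (hp' i)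
  · intro j _ hji
    rw [map_smul, hp j i (Finset.mem_erase.mpr ⟨hji.symm, Finset.mem_univ i⟩), smul_zero]
  · simp

end SimpleQuotients

/-! ### The algebra U(r) under the adjoint action. -/

section RadicalAlgebra

open LieModule Module UniversalEnvelopingAlgebra

variable {𝔏 : Type u} [LieRing 𝔏] [LieAlgebra ℂ 𝔏]

theorem ι_lie (x y : 𝔏) : (ι ℂ ⁅x, y⁆ : Env 𝔏) = ι ℂ x * ι ℂ y - ι ℂ y * ι ℂ x := by
  let _ : LieRing (Env 𝔏) := LieRing.ofAssociativeRing
  rw [LieHom.map_lie, LieRing.of_associative_ring_bracket]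

/-- The universal property maps U(𝔏) into the subalgebra, and the composite with the inclusion is
the identity since it fixes the generators. -/
theorem adjoin_range_ι : Algebra.adjoin ℂ (Set.range (ι ℂ : 𝔏 → Env 𝔏)) = ⊤ := by
  set S := Algebra.adjoin ℂ (Set.range (ι ℂ : 𝔏 → Env 𝔏))
  let _ : LieRing (Env 𝔏) := LieRing.ofAssociativeRing
  let _ : LieRing S := LieRing.ofAssociativeRing
  let f : 𝔏 →ₗ⁅ℂ⁆ S :=
    { toFun := fun x => ⟨ι ℂ x, Algebra.subset_adjoin ⟨x, rfl⟩⟩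
      map_add' := fun x y => Subtype.ext (map_add (ι ℂ) x y)
      map_smul' := fun t x => Subtype.ext (map_smul (ι ℂ) t x)
      map_lie' := fun {x y} => Subtype.ext (ι_lie x y) }
  have h : S.val.comp (lift ℂ f) = AlgHom.id ℂ (Env 𝔏) := by
    apply hom_ext
    ext x
    change ((lift ℂ f (ι ℂ x) : S) : Env 𝔏) = ι ℂ x
    rw [lift_ι_apply]
    rfl
  rw [eq_top_iff]
  intro u _
  have := AlgHom.congr_fun h u
  rw [← show ((lift ℂ f u : S) : Env 𝔏) = u from this]
  exact (lift ℂ f u).2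

theorem env_induction {C : Env 𝔏 → Prop} (algebraMap : ∀ c : ℂ, C (algebraMap ℂ _ c))
    (ι : ∀ x : 𝔏, C (ι ℂ x)) (mul : ∀ u v, C u → C v → C (u * v))
    (add : ∀ u v, C u → C v → C (u + v)) (u : Env 𝔏) : C u := by
  have hu : u ∈ Algebra.adjoin ℂ (Set.range (UniversalEnvelopingAlgebra.ι ℂ : 𝔏 → Env 𝔏)) := by
    rw [adjoin_range_ι]; trivial
  induction hu using Algebra.adjoin_induction with
  | mem x hx => obtain ⟨y, rfl⟩ := hx; exact ι y
  | algebraMap r => exact algebraMap r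
  | add x y _ _ hx hy => exact add _ _ hx hy
  | mul x y _ _ hx hy => exact mul _ _ hx hy

/-- The action of `U(𝔏)` on an `𝔏`-module. -/
noncomputable abbrev act (N : Type*) [AddCommGroup N] [Module ℂ N] [LieRingModule 𝔏 N]
    [LieModule ℂ 𝔏 N] : Env 𝔏 →ₐ[ℂ] Module.End ℂ N :=
  lift ℂ (LieModule.toEnd ℂ 𝔏 N)

section Act

variable {N N' : Type*} [AddCommGroup N] [Module ℂ N] [LieRingModule 𝔏 N] [LieModule ℂ 𝔏 N]
  [AddCommGroup N'] [Module ℂ N'] [LieRingModule 𝔏 N'] [LieModule ℂ 𝔏 N']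

theorem act_ι (x : 𝔏) (n : N) : act N (ι ℂ x) n = ⁅x, n⁆ := by
  rw [act, lift_ι_apply, LieModule.toEnd_apply_apply]

theorem act_mul (u v : Env 𝔏) (n : N) : act N (u * v) n = act N u (act N v n) := by
  rw [map_mul, Module.End.mul_apply]

theorem act_algebraMap (c : ℂ) (n : N) : act N (algebraMap ℂ (Env 𝔏) c) n = c • n := by
  rw [AlgHom.commutes, Module.algebraMap_end_apply]

theorem act_mem (S : LieSubmodule ℂ 𝔏 N) (u : Env 𝔏) : ∀ n ∈ S, act N u n ∈ S := by
  induction u using env_induction with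
  | algebraMap c => intro n hn; rw [act_algebraMap]; exact SMulMemClass.smul_mem _ hn
  | ι x => intro n hn; rw [act_ι]; exact S.lie_mem hn
  | mul u v hu hv => intro n hn; rw [act_mul]; exact hu _ (hv _ hn)
  | add u v hu hv =>
    intro n hn; rw [map_add, LinearMap.add_apply]; exact add_mem (hu _ hn) (hv _ hn)

theorem map_act (f : N →ₗ⁅ℂ, 𝔏⁆ N') (u : Env 𝔏) : ∀ n : N, f (act N u n) = act N' u (f n) := by
  induction u using env_induction with
  | algebraMap c => intro n; rw [act_algebraMap, act_algebraMap, map_smul]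
  | ι x => intro n; rw [act_ι, act_ι, LieModuleHom.map_lie]
  | mul u v hu hv => intro n; rw [act_mul, act_mul, hu, hv]
  | add u v hu hv =>
    intro n; rw [map_add, LinearMap.add_apply, map_add, hu, hv, map_add, LinearMap.add_apply]

end Act

variable (𝔏) in
/-- The subalgebra `U(r)` of `U(𝔏)` generated by the radical. -/
noncomputable abbrev radAlg : Subalgebra ℂ (Env 𝔏) :=
  Algebra.adjoin ℂ (ι ℂ '' (LieAlgebra.radical ℂ 𝔏 : Set 𝔏))

theorem ι_mem_radAlg {x : 𝔏} (hx : x ∈ LieAlgebra.radical ℂ 𝔏) : (ι ℂ x : Env 𝔏) ∈ radAlg 𝔏 :=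
  Algebra.subset_adjoin ⟨x, hx, rfl⟩

theorem ad_mem_radAlg (x : 𝔏) {a : Env 𝔏} (ha : a ∈ radAlg 𝔏) :
    ι ℂ x * a - a * ι ℂ x ∈ radAlg 𝔏 := by
  induction ha using Algebra.adjoin_induction with
  | mem y hy =>
    obtain ⟨y, hy, rfl⟩ := hy
    rw [← ι_lie]
    exact ι_mem_radAlg (lie_mem_right ℂ 𝔏 _ x y hy)
  | algebraMap r => rw [← Algebra.commutes, sub_self]; exact zero_mem _
  | add a b _ _ ha hb =>
    have : ι ℂ x * (a + b) - (a + b) * ι ℂ x = (ι ℂ x * a - a * ι ℂ x) + (ι ℂ x * b - b * ι ℂ x) := by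
      noncomm_ring
    rw [this]; exact add_mem ha hb
  | mul a b ha' hb' ha hb =>
    have : ι ℂ x * (a * b) - (a * b) * ι ℂ x =
        (ι ℂ x * a - a * ι ℂ x) * b + a * (ι ℂ x * b - b * ι ℂ x) := by
      noncomm_ring
    rw [this]; exact add_mem (mul_mem ha hb') (mul_mem ha' hb)

/-- The adjoint action of `𝔏` on `U(r)`. -/
noncomputable instance : LieRingModule 𝔏 (radAlg 𝔏) where
  bracket x a := ⟨ι ℂ x * a - a * ι ℂ x, ad_mem_radAlg x a.2⟩
  add_lie x y a := Subtype.ext <| by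
    change ι ℂ (x + y) * (a : Env 𝔏) - a * ι ℂ (x + y) =
      (ι ℂ x * a - a * ι ℂ x) + (ι ℂ y * a - a * ι ℂ y)
    rw [map_add]; noncomm_ring
  lie_add x a b := Subtype.ext <| by
    change ι ℂ x * ((a : Env 𝔏) + b) - (a + b) * ι ℂ x =
      (ι ℂ x * a - a * ι ℂ x) + (ι ℂ x * b - b * ι ℂ x)
    noncomm_ring
  leibniz_lie x y a := Subtype.ext <| by
    change ι ℂ x * (ι ℂ y * (a : Env 𝔏) - a * ι ℂ y) - (ι ℂ y * (a : Env 𝔏) - a * ι ℂ y) * ι ℂ x =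
      (ι ℂ ⁅x, y⁆ * a - a * ι ℂ ⁅x, y⁆) +
      (ι ℂ y * (ι ℂ x * (a : Env 𝔏) - a * ι ℂ x) - (ι ℂ x * (a : Env 𝔏) - a * ι ℂ x) * ι ℂ y)
    rw [ι_lie]; noncomm_ring

theorem coe_lie_radAlg (x : 𝔏) (a : radAlg 𝔏) : (⁅x, a⁆ : radAlg 𝔏) = ι ℂ x * (a : Env 𝔏) - a * ι ℂ x :=
  rfl

noncomputable instance : LieModule ℂ 𝔏 (radAlg 𝔏) where
  smul_lie c x a := Subtype.ext <| by
    change ι ℂ (c • x) * (a : Env 𝔏) - a * ι ℂ (c • x) = c • (ι ℂ x * (a : Env 𝔏) - a * ι ℂ x)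
    rw [map_smul, smul_sub, smul_mul_assoc, mul_smul_comm]
  lie_smul c x a := Subtype.ext <| by
    change ι ℂ x * (c • (a : Env 𝔏)) - (c • (a : Env 𝔏)) * ι ℂ x =
      c • (ι ℂ x * (a : Env 𝔏) - a * ι ℂ x)
    rw [smul_sub, smul_mul_assoc, mul_smul_comm]

/-- The adjoint action is by derivations. -/
theorem lie_mul_radAlg (x : 𝔏) (a b : radAlg 𝔏) : ⁅x, a * b⁆ = ⁅x, a⁆ * b + a * ⁅x, b⁆ :=
  Subtype.ext <| by
    change ι ℂ x * ((a : Env 𝔏) * b) - (a * b) * ι ℂ x =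
      (ι ℂ x * a - a * ι ℂ x) * b + a * (ι ℂ x * b - b * ι ℂ x)
    noncomm_ring

theorem act_lie {N : Type*} [AddCommGroup N] [Module ℂ N] [LieRingModule 𝔏 N] [LieModule ℂ 𝔏 N]
    (x : 𝔏) (a : radAlg 𝔏) (n : N) :
    act N ((⁅x, a⁆ : radAlg 𝔏) : Env 𝔏) n = ⁅x, act N (a : Env 𝔏) n⁆ - act N (a : Env 𝔏) ⁅x, n⁆ := by
  rw [coe_lie_radAlg, map_sub, LinearMap.sub_apply, act_mul, act_mul, act_ι, act_ι]

/-- The generators form an image of r, which is finite-dimensional. As the action is by derivations,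
the product of two finite-dimensional submodules is an equivariant image of their tensor product. -/
theorem locFin_radAlg [FiniteDimensional ℂ 𝔏] : LocFin ℂ 𝔏 (radAlg 𝔏) := by
  rintro ⟨a, ha⟩
  induction ha using Algebra.adjoin_induction with
  | mem y hy =>
    obtain ⟨y, hy, rfl⟩ := hy
    let f : LieAlgebra.radical ℂ 𝔏 →ₗ⁅ℂ, 𝔏⁆ radAlg 𝔏 :=
      { toFun := fun x => ⟨ι ℂ (x : 𝔏), ι_mem_radAlg x.2⟩
        map_add' := fun x y => Subtype.ext (map_add (ι ℂ) (x : 𝔏) y)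
        map_smul' := fun t x => Subtype.ext (map_smul (ι ℂ) t (x : 𝔏))
        map_lie' := fun {x y} => Subtype.ext (ι_lie x (y : 𝔏)) }
    exact ⟨f.range, Module.Finite.range (f : LieAlgebra.radical ℂ 𝔏 →ₗ[ℂ] radAlg 𝔏),
      (LieModuleHom.mem_range _ _).mpr ⟨⟨y, hy⟩, rfl⟩⟩
  | algebraMap r =>
    refine ⟨{ (ℂ ∙ (1 : radAlg 𝔏)) with lie_mem := ?_ }, ?_, ?_⟩
    · intro x m hm
      obtain ⟨c, rfl⟩ := Submodule.mem_span_singleton.mp hm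
      have : ⁅x, c • (1 : radAlg 𝔏)⁆ = 0 := Subtype.ext <| by
        rw [lie_smul]
        change c • (ι ℂ x * (1 : Env 𝔏) - 1 * ι ℂ x) = 0
        simp
      rw [this]
      exact zero_mem (ℂ ∙ (1 : radAlg 𝔏))
    · exact inferInstanceAs (FiniteDimensional ℂ (ℂ ∙ (1 : radAlg 𝔏)))
    · exact Submodule.mem_span_singleton.mpr ⟨r, Subtype.ext (Algebra.algebraMap_eq_smul_one r).symm⟩
  | add a b ha' hb' ha hb =>
    obtain ⟨N, hN, ha⟩ := ha
    obtain ⟨N', hN', hb⟩ := hb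
    exact ⟨N ⊔ N', finiteDimensional_sup _ _,
      add_mem (LieSubmodule.mem_sup_left ha) (LieSubmodule.mem_sup_right hb)⟩
  | mul a b ha' hb' ha hb =>
    obtain ⟨N, hN, ha⟩ := ha
    obtain ⟨N', hN', hb⟩ := hb
    let μ : radAlg 𝔏 →ₗ⁅ℂ, 𝔏⁆ radAlg 𝔏 →ₗ[ℂ] radAlg 𝔏 :=
      { LinearMap.mul ℂ (radAlg 𝔏) with
        map_lie' := fun {x a} => by
          refine LinearMap.ext fun b => ?_
          change ⁅x, a⁆ * b = ⁅x, a * b⁆ - a * ⁅x, b⁆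
          rw [lie_mul_radAlg, add_sub_cancel_right] }
    let f := (TensorProduct.LieModule.liftLie ℂ 𝔏 _ _ _ μ).comp
      (TensorProduct.LieModule.mapIncl N N')
    refine ⟨f.range, Module.Finite.range (f : N ⊗[ℂ] N' →ₗ[ℂ] radAlg 𝔏),
      (LieModuleHom.mem_range _ _).mpr ⟨⟨_, ha⟩ ⊗ₜ ⟨_, hb⟩, ?_⟩⟩
    simp only [f, LieModuleHom.comp_apply, TensorProduct.LieModule.mapIncl_def,
      TensorProduct.LieModule.map_tmul, TensorProduct.LieModule.liftLie_apply]
    rfl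

theorem LocFin.restrict {N : Type*} [AddCommGroup N] [Module ℂ N] [LieRingModule 𝔏 N]
    [LieModule ℂ 𝔏 N] (h : LocFin ℂ 𝔏 N) (g : LieSubalgebra ℂ 𝔏) : LocFin ℂ g N := by
  intro n
  obtain ⟨S, hS, hn⟩ := h n
  exact ⟨{ S.toSubmodule with lie_mem := fun {x m} hm => S.lie_mem (x := (x : 𝔏)) hm }, hS, hn⟩

end RadicalAlgebra

/-! ### U(r) as a commutative Noetherian ring, and modules finitely generated over it. -/

section AbelianRadical

open LieModule Module UniversalEnvelopingAlgebra

variable {𝔏 : Type u} [LieRing 𝔏] [LieAlgebra ℂ 𝔏] [IsLieAbelian (LieAlgebra.radical ℂ 𝔏)]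

noncomputable instance : CommRing (radAlg 𝔏) :=
  { (inferInstance : Ring (radAlg 𝔏)) with
    mul_comm := by
      have h : ∀ a ∈ ι ℂ '' (LieAlgebra.radical ℂ 𝔏 : Set 𝔏),
          ∀ b ∈ ι ℂ '' (LieAlgebra.radical ℂ 𝔏 : Set 𝔏), a * b = b * a := by
        rintro _ ⟨x, hx, rfl⟩ _ ⟨y, hy, rfl⟩
        have h0 : (⁅(⟨x, hx⟩ : LieAlgebra.radical ℂ 𝔏), ⟨y, hy⟩⁆ : LieAlgebra.radical ℂ 𝔏) = 0 :=
          trivial_lie_zero _ _ _ _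
        have h1 : ⁅x, y⁆ = 0 := congrArg Subtype.val h0
        rw [← sub_eq_zero, ← ι_lie, h1, map_zero]
      exact (Algebra.isMulCommutative_adjoin ℂ h).is_comm.comm }

instance [FiniteDimensional ℂ 𝔏] : IsNoetherianRing (radAlg 𝔏) := by
  have hfg : (radAlg 𝔏).FG := by
    obtain ⟨S, hS⟩ := IsNoetherian.noetherian (LieAlgebra.radical ℂ 𝔏).toSubmodule
    classical
    let _ : LieRing (Env 𝔏) := LieRing.ofAssociativeRing
    refine ⟨S.image (ι ℂ : 𝔏 → Env 𝔏), ?_⟩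
    have h : (ι ℂ '' (LieAlgebra.radical ℂ 𝔏 : Set 𝔏) : Set (Env 𝔏)) =
        Submodule.span ℂ (ι ℂ '' (S : Set 𝔏)) := by
      have h1 := Submodule.map_span ((ι ℂ : 𝔏 →ₗ⁅ℂ⁆ Env 𝔏) : 𝔏 →ₗ[ℂ] Env 𝔏) (S : Set 𝔏)
      rw [hS] at h1
      exact congrArg SetLike.coe h1
    rw [radAlg, h, Algebra.adjoin_span, Finset.coe_image]
  have : Algebra.FiniteType ℂ (radAlg 𝔏) := (radAlg 𝔏).fg_iff_finiteType.mp hfg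
  exact Algebra.FiniteType.isNoetherianRing ℂ (radAlg 𝔏)

section Generation

variable {N : Type u} [AddCommGroup N] [Module ℂ N] [LieRingModule 𝔏 N] [LieModule ℂ 𝔏 N]

variable (N) in
/-- `N` as a module over the commutative algebra `U(r)`. -/
noncomputable abbrev radModule : Module (radAlg 𝔏) N :=
  Module.compHom N ((act N).comp (radAlg 𝔏).val : radAlg 𝔏 →ₐ[ℂ] Module.End ℂ N).toRingHom

variable (𝔏 N) in
/-- `N` is finitely generated over `U(r)`. -/
def RadFG : Prop :=
  ∃ S : Finset N, ∀ n : N, ∃ a : N → radAlg 𝔏, n = ∑ s ∈ S, act N (a s : Env 𝔏) s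

theorem RadFG.finite (h : RadFG 𝔏 N) :
    letI := radModule (𝔏 := 𝔏) N
    Module.Finite (radAlg 𝔏) N := by
  let _ := radModule (𝔏 := 𝔏) N
  obtain ⟨S, hS⟩ := h
  refine ⟨⟨S, ?_⟩⟩
  rw [eq_top_iff]
  intro n _
  obtain ⟨a, ha⟩ := hS n
  rw [ha]
  exact sum_mem fun s hs => Submodule.smul_mem _ (a s) (Submodule.subset_span hs)

/-- Noetherianity of U(r) makes the submodule generated by T finitely generated. That the generators
can be taken in T itself is what Hilbert's finiteness argument needs. -/
theorem RadFG.exists_finset_generating [FiniteDimensional ℂ 𝔏] (h : RadFG 𝔏 N) (T : Set N) :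
    ∃ S : Finset N, (S : Set N) ⊆ T ∧
      ∀ n ∈ T, ∃ a : N → radAlg 𝔏, n = ∑ s ∈ S, act N (a s : Env 𝔏) s := by
  let _ := radModule (𝔏 := 𝔏) N
  have : Module.Finite (radAlg 𝔏) N := h.finite
  have hfg : (Submodule.span (radAlg 𝔏) T).FG := IsNoetherian.noetherian _
  obtain ⟨S, hST, hS⟩ := (Submodule.fg_span_iff_fg_span_finset_subset T).mp hfg
  refine ⟨S, hST, fun n hn => ?_⟩
  have hn' : n ∈ Submodule.span (radAlg 𝔏) (S : Set N) := hS ▸ Submodule.subset_span hn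
  obtain ⟨a, -, ha⟩ := Submodule.mem_span_finset.mp hn'
  exact ⟨a, ha.symm⟩

/-- Nakayama's lemma for modules over `U(r)`. -/
theorem RadFG.nakayama (h : RadFG 𝔏 N) (I : Ideal (radAlg 𝔏))
    (hI : ∀ n : N, n ∈ Submodule.span ℂ {m | ∃ b ∈ I, ∃ k : N, m = act N (b : Env 𝔏) k}) :
    ∃ r : radAlg 𝔏, r - 1 ∈ I ∧ ∀ n : N, act N (r : Env 𝔏) n = 0 := by
  let _ := radModule (𝔏 := 𝔏) N
  have : Module.Finite (radAlg 𝔏) N := h.finite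
  obtain ⟨r, hr, hr'⟩ := Submodule.exists_sub_one_mem_and_smul_eq_zero_of_fg_of_le_smul I
    (⊤ : Submodule (radAlg 𝔏) N) Module.Finite.fg_top (by
      intro n hn0
      clear hn0
      have hn := hI n
      induction hn using Submodule.span_induction with
      | mem m hm =>
        obtain ⟨b, hb, k, rfl⟩ := hm
        exact Submodule.smul_mem_smul (r := b) hb (n := k) trivial
      | zero => exact zero_mem _
      | add x y _ _ hx hy => exact add_mem hx hy
      | smul c x _ hx =>
        rw [← act_algebraMap (𝔏 := 𝔏)]
        exact Submodule.smul_mem _ (algebraMap ℂ (radAlg 𝔏) c) hx)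
  exact ⟨r, hr, fun n => hr' n trivial⟩

end Generation

end AbelianRadical

/-! ### The Levi projection, inflation of g-modules, and U(𝔏) modulo U(𝔏)g. -/

section Levi

open LieModule Module UniversalEnvelopingAlgebra

variable {𝔏 : Type u} [LieRing 𝔏] [LieAlgebra ℂ 𝔏] {g : LieSubalgebra ℂ 𝔏}

theorem IsLevi.isKilling [FiniteDimensional ℂ 𝔏] (hg : IsLevi g) : LieAlgebra.IsKilling ℂ g := by
  have := hg.semisimple
  infer_instance

theorem IsLevi.eq_zero (hg : IsLevi g) {x : 𝔏} (h1 : x ∈ g) (h2 : x ∈ LieAlgebra.radical ℂ 𝔏) :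
    x = 0 := by
  have : x ∈ g.toSubmodule ⊓ (LieAlgebra.radical ℂ 𝔏).toSubmodule := ⟨h1, h2⟩
  rw [hg.isCompl.inf_eq_bot] at this
  simpa using this

theorem IsLevi.sub_projectionOnto_mem (hg : IsLevi g) (x : 𝔏) :
    x - (Submodule.projectionOnto _ _ hg.isCompl x : 𝔏) ∈ LieAlgebra.radical ℂ 𝔏 :=
  Submodule.sub_projection_mem hg.isCompl x

/-- The projection of `𝔏 = g ⋉ r` onto `g` along the radical. -/
noncomputable def IsLevi.proj (hg : IsLevi g) : 𝔏 →ₗ⁅ℂ⁆ g :=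
  { Submodule.projectionOnto _ _ hg.isCompl with
    map_lie' := fun {x y} => by
      set p := Submodule.projectionOnto _ _ hg.isCompl with hp
      have hx := hg.sub_projectionOnto_mem x
      have hy := hg.sub_projectionOnto_mem y
      have hxy := hg.sub_projectionOnto_mem ⁅x, y⁆
      rw [← hp] at hx hy hxy
      change p ⁅x, y⁆ = ⁅(⟨p x, (p x).2⟩ : g), (⟨p y, (p y).2⟩ : g)⁆
      refine Subtype.ext ?_
      change (p ⁅x, y⁆ : 𝔏) = ⁅(p x : 𝔏), (p y : 𝔏)⁆
      -- Both sides lie in g and agree modulo the ideal r, so their difference lies in g ∩ r = 0.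
      rw [← sub_eq_zero]
      refine hg.eq_zero (sub_mem (p ⁅x, y⁆).2 (g.lie_mem (p x).2 (p y).2)) ?_
      have h1 : ⁅x - (p x : 𝔏), y⁆ ∈ LieAlgebra.radical ℂ 𝔏 := lie_mem_left ℂ 𝔏 _ _ _ hx
      have h2 : ⁅(p x : 𝔏), y - (p y : 𝔏)⁆ ∈ LieAlgebra.radical ℂ 𝔏 := lie_mem_right ℂ 𝔏 _ _ _ hy
      have : (p ⁅x, y⁆ : 𝔏) - ⁅(p x : 𝔏), (p y : 𝔏)⁆ =
          ⁅x - (p x : 𝔏), y⁆ + ⁅(p x : 𝔏), y - (p y : 𝔏)⁆ - (⁅x, y⁆ - (p ⁅x, y⁆ : 𝔏)) := by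
        rw [sub_lie, lie_sub]; abel
      rw [this]
      exact sub_mem (add_mem h1 h2) hxy }

theorem IsLevi.sub_proj_mem (hg : IsLevi g) (x : 𝔏) :
    x - (hg.proj x : 𝔏) ∈ LieAlgebra.radical ℂ 𝔏 :=
  hg.sub_projectionOnto_mem x

theorem IsLevi.proj_coe (hg : IsLevi g) (x : g) : hg.proj (x : 𝔏) = x :=
  Submodule.projectionOnto_apply_left hg.isCompl x

theorem IsLevi.proj_radical (hg : IsLevi g) {x : 𝔏} (hx : x ∈ LieAlgebra.radical ℂ 𝔏) :
    hg.proj x = 0 :=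
  (Submodule.projectionOnto_apply_eq_zero_iff hg.isCompl).mpr hx

theorem IsLevi.exists_add (hg : IsLevi g) (x : 𝔏) :
    ∃ y : g, ∃ z ∈ LieAlgebra.radical ℂ 𝔏, x = y + z :=
  ⟨hg.proj x, _, hg.sub_proj_mem x, by abel⟩

/-- The `g`-module `L`, considered as an `𝔏`-module on which the radical acts by zero. -/
def Infl (_ : IsLevi g) (L : Type u) : Type u := L

section Infl

variable (hg : IsLevi g) (L : Type u) [AddCommGroup L] [Module ℂ L] [LieRingModule g L]
  [LieModule ℂ g L]

instance : AddCommGroup (Infl hg L) := inferInstanceAs (AddCommGroup L)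
instance : Module ℂ (Infl hg L) := inferInstanceAs (Module ℂ L)
noncomputable instance : LieRingModule 𝔏 (Infl hg L) := LieRingModule.compLieHom L hg.proj
instance : LieModule ℂ 𝔏 (Infl hg L) := LieModule.compLieHom L hg.proj

/-- Restricting an inflated module to `g` gives back the original module. -/
noncomputable def inflEquiv : L ≃ₗ⁅ℂ, g⁆ Infl hg L :=
  { LinearEquiv.refl ℂ L with
    map_lie' := fun {x l} => by
      change ⁅x, l⁆ = ⁅hg.proj (x : 𝔏), l⁆
      rw [hg.proj_coe] }

instance [FiniteDimensional ℂ L] : FiniteDimensional ℂ (Infl hg L) :=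
  inferInstanceAs (FiniteDimensional ℂ L)

theorem radical_lie_infl {x : 𝔏} (hx : x ∈ LieAlgebra.radical ℂ 𝔏) (l : Infl hg L) : ⁅x, l⁆ = 0 := by
  change ⁅hg.proj x, (show L from l)⁆ = (0 : L)
  rw [hg.proj_radical hx, zero_lie]

end Infl

section RadicalTrivial

variable {E V : Type*} [AddCommGroup E] [Module ℂ E] [LieRingModule 𝔏 E] [LieModule ℂ 𝔏 E]
  [AddCommGroup V] [Module ℂ V] [LieRingModule 𝔏 V] [LieModule ℂ 𝔏 V]

/-- With r acting by zero on E, the action of U(r) on Hom(E, V) only sees V. This transfers radical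
characters and annihilators from V to Hom(E, V). -/
theorem act_hom_apply (hE : ∀ x ∈ LieAlgebra.radical ℂ 𝔏, ∀ e : E, ⁅x, e⁆ = 0)
    {a : Env 𝔏} (ha : a ∈ radAlg 𝔏) : ∀ (φ : E →ₗ[ℂ] V) (e : E),
    act (E →ₗ[ℂ] V) a φ e = act V a (φ e) := by
  induction ha using Algebra.adjoin_induction with
  | mem y hy =>
    obtain ⟨y, hy, rfl⟩ := hy
    intro φ e
    rw [act_ι, act_ι, LieHom.lie_apply, hE y hy, map_zero, sub_zero]
  | algebraMap r => intro φ e; rw [act_algebraMap, act_algebraMap, LinearMap.smul_apply]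
  | add a b _ _ ha hb =>
    intro φ e
    rw [map_add, LinearMap.add_apply, LinearMap.add_apply, ha, hb, map_add, LinearMap.add_apply]
  | mul a b _ _ ha hb => intro φ e; rw [act_mul, act_mul, ha, hb]

theorem act_tmul (hE : ∀ x ∈ LieAlgebra.radical ℂ 𝔏, ∀ e : E, ⁅x, e⁆ = 0)
    {a : Env 𝔏} (ha : a ∈ radAlg 𝔏) : ∀ (v : V) (e : E),
    act (V ⊗[ℂ] E) a (v ⊗ₜ e) = act V a v ⊗ₜ e := by
  induction ha using Algebra.adjoin_induction with
  | mem y hy =>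
    obtain ⟨y, hy, rfl⟩ := hy
    intro v e
    rw [act_ι, act_ι, TensorProduct.LieModule.lie_tmul_right, hE y hy, TensorProduct.tmul_zero,
      add_zero]
  | algebraMap r => intro v e; rw [act_algebraMap, act_algebraMap, TensorProduct.smul_tmul']
  | add a b _ _ ha hb =>
    intro v e
    rw [map_add, LinearMap.add_apply, ha, hb, map_add, LinearMap.add_apply, TensorProduct.add_tmul]
  | mul a b _ _ ha hb => intro v e; rw [act_mul, act_mul, hb, ha]

end RadicalTrivial

/-- The orbit map of an invariant vector. -/
noncomputable def orbit (g : LieSubalgebra ℂ 𝔏) {N : Type*} [AddCommGroup N] [Module ℂ N]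
    [LieRingModule 𝔏 N] [LieModule ℂ 𝔏 N] (n : N) (hn : n ∈ maxTrivSubmodule ℂ g N) :
    radAlg 𝔏 →ₗ⁅ℂ, g⁆ N :=
  { ((act N).toLinearMap.flip n) ∘ₗ (radAlg 𝔏).val.toLinearMap with
    map_lie' := fun {x a} => by
      change act N ((⁅(x : 𝔏), a⁆ : radAlg 𝔏) : Env 𝔏) n = ⁅(x : 𝔏), act N (a : Env 𝔏) n⁆
      have : ⁅(x : 𝔏), n⁆ = 0 := (mem_maxTrivSubmodule ℂ g N n).mp hn x
      rw [act_lie, this, map_zero, sub_zero] }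

theorem orbit_apply {N : Type*} [AddCommGroup N] [Module ℂ N]
    [LieRingModule 𝔏 N] [LieModule ℂ 𝔏 N] (n : N) (hn : n ∈ maxTrivSubmodule ℂ g N)
    (a : radAlg 𝔏) : orbit g n hn a = act N (a : Env 𝔏) n :=
  rfl

theorem ι_mem_leftIdeal (x : g) : (ι ℂ (x : 𝔏) : Env 𝔏) ∈ leftIdeal g :=
  Submodule.subset_span ⟨x, x.2, rfl⟩

theorem mul_mem_leftIdeal (u : Env 𝔏) {v : Env 𝔏} (hv : v ∈ leftIdeal g) : u * v ∈ leftIdeal g :=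
  Submodule.smul_mem _ u hv

/-- The statement carries a factor a from U(r) so that products pass through the induction. For y in
g the identity ya = [y, a] + ay moves y to the right, into the left ideal. -/
theorem IsLevi.exists_sub_mem_leftIdeal_aux (hg : IsLevi g) (u : Env 𝔏) :
    ∀ a ∈ radAlg 𝔏, ∃ b ∈ radAlg 𝔏, u * a - b ∈ leftIdeal g := by
  induction u using env_induction with
  | algebraMap c =>
    intro a ha
    exact ⟨algebraMap ℂ _ c * a, mul_mem (Subalgebra.algebraMap_mem _ c) ha, by simp⟩
  | ι x =>
    intro a ha
    obtain ⟨y, z, hz, rfl⟩ := hg.exists_add x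
    refine ⟨(ι ℂ (y : 𝔏) * a - a * ι ℂ (y : 𝔏)) + ι ℂ z * a,
      add_mem (ad_mem_radAlg _ ha) (mul_mem (ι_mem_radAlg hz) ha), ?_⟩
    have : ι ℂ ((y : 𝔏) + z) * a - ((ι ℂ (y : 𝔏) * a - a * ι ℂ (y : 𝔏)) + ι ℂ z * a) =
        a * ι ℂ (y : 𝔏) := by
      rw [map_add]; noncomm_ring
    rw [this]
    exact mul_mem_leftIdeal _ (ι_mem_leftIdeal y)
  | mul u v hu hv =>
    intro a ha
    obtain ⟨b, hb, hb'⟩ := hv a ha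
    obtain ⟨c, hc, hc'⟩ := hu b hb
    refine ⟨c, hc, ?_⟩
    have : u * v * a - c = u * (v * a - b) + (u * b - c) := by noncomm_ring
    rw [this]
    exact add_mem (mul_mem_leftIdeal _ hb') hc'
  | add u v hu hv =>
    intro a ha
    obtain ⟨b, hb, hb'⟩ := hu a ha
    obtain ⟨c, hc, hc'⟩ := hv a ha
    refine ⟨b + c, add_mem hb hc, ?_⟩
    have : (u + v) * a - (b + c) = (u * a - b) + (v * a - c) := by noncomm_ring
    rw [this]
    exact add_mem hb' hc'

/-- `U(𝔏) = U(r) + U(𝔏) g`. -/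
theorem IsLevi.exists_sub_mem_leftIdeal (hg : IsLevi g) (u : Env 𝔏) :
    ∃ a : radAlg 𝔏, u - a ∈ leftIdeal g := by
  obtain ⟨b, hb, h⟩ := hg.exists_sub_mem_leftIdeal_aux u 1 (one_mem _)
  exact ⟨⟨b, hb⟩, by simpa using h⟩

end Levi

/-! ### Invariants of U(r) and Hilbert's finiteness argument. -/

section AbelianRadical

open LieModule Module UniversalEnvelopingAlgebra

variable {𝔏 : Type u} [LieRing 𝔏] [LieAlgebra ℂ 𝔏] {g : LieSubalgebra ℂ 𝔏}
  [IsLieAbelian (LieAlgebra.radical ℂ 𝔏)]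

theorem radical_lie_radAlg {x : 𝔏} (hx : x ∈ LieAlgebra.radical ℂ 𝔏) (a : radAlg 𝔏) :
    ⁅x, a⁆ = 0 := by
  have := mul_comm (⟨ι ℂ x, ι_mem_radAlg hx⟩ : radAlg 𝔏) a
  refine Subtype.ext ?_
  rw [coe_lie_radAlg, sub_eq_zero.mpr]
  · rfl
  · exact congrArg Subtype.val this

/-- The `g`-invariants of `U(r)` are central in `U(𝔏)`. -/
theorem IsLevi.mem_radicalCenter (hg : IsLevi g) {a : radAlg 𝔏}
    (ha : a ∈ maxTrivSubmodule ℂ g (radAlg 𝔏)) : (a : Env 𝔏) ∈ radicalCenter 𝔏 := by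
  refine ⟨?_, a.2⟩
  change (a : Env 𝔏) ∈ Subalgebra.center ℂ (Env 𝔏)
  rw [Subalgebra.mem_center_iff]
  intro u
  induction u using env_induction with
  | algebraMap c => exact Algebra.commutes c _
  | ι x =>
    have h : ⁅x, a⁆ = 0 := by
      obtain ⟨y, z, hz, rfl⟩ := hg.exists_add x
      have : ⁅(y : 𝔏), a⁆ = 0 := (mem_maxTrivSubmodule ℂ g _ a).mp ha y
      rw [add_lie, radical_lie_radAlg hz, this, add_zero]
    have := congrArg Subtype.val h
    rw [coe_lie_radAlg] at this
    exact sub_eq_zero.mp this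
  | mul u v hu hv => rw [mul_assoc, hv, ← mul_assoc, hu, mul_assoc]
  | add u v hu hv => rw [add_mul, mul_add, hu, hv]

/-- A module generated by a finite-dimensional `g`-stable subspace is finitely generated over
`U(r)`. -/
theorem IsLevi.radFG (hg : IsLevi g) {N : Type u} [AddCommGroup N] [Module ℂ N]
    [LieRingModule 𝔏 N] [LieModule ℂ 𝔏 N] (W : Submodule ℂ N) [FiniteDimensional ℂ W]
    (hW : ∀ x : g, ∀ w ∈ W, ⁅(x : 𝔏), w⁆ ∈ W)
    (hgen : LieSubmodule.lieSpan ℂ 𝔏 (W : Set N) = ⊤) : RadFG 𝔏 N := by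
  obtain ⟨S, hS⟩ : W.FG := (Submodule.fg_iff_finiteDimensional W).mpr inferInstance
  let T0 : Submodule ℂ N :=
    { carrier := {n | ∃ a : N → radAlg 𝔏, n = ∑ s ∈ S, act N (a s : Env 𝔏) s}
      add_mem' := by
        rintro _ _ ⟨a, rfl⟩ ⟨b, rfl⟩
        exact ⟨a + b, by simp [Finset.sum_add_distrib]⟩
      zero_mem' := ⟨0, by simp⟩
      smul_mem' := by
        rintro c _ ⟨a, rfl⟩
        exact ⟨c • a, by simp [Finset.smul_sum]⟩ }
  have hWT : ∀ w ∈ W, w ∈ T0 := by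
    intro w hw
    rw [← hS] at hw
    obtain ⟨c, -, hc⟩ := Submodule.mem_span_finset.mp hw
    refine ⟨fun n => algebraMap ℂ _ (c n), ?_⟩
    rw [← hc]
    refine Finset.sum_congr rfl fun s _ => ?_
    exact (act_algebraMap (𝔏 := 𝔏) (c s) s).symm
  have hact : ∀ (b : radAlg 𝔏), ∀ n ∈ T0, act N (b : Env 𝔏) n ∈ T0 := by
    rintro b _ ⟨a, rfl⟩
    refine ⟨fun n => b * a n, ?_⟩
    rw [map_sum]
    refine Finset.sum_congr rfl fun s _ => ?_
    exact (act_mul (b : Env 𝔏) (a s : Env 𝔏) s).symm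
  let T : LieSubmodule ℂ 𝔏 N :=
    { T0 with
      lie_mem := by
        rintro x n ⟨a, rfl⟩
        rw [lie_sum]
        refine Submodule.sum_mem T0 fun s hs => ?_
        have hsW : s ∈ W := hS ▸ Submodule.subset_span hs
        obtain ⟨y, z, hz, rfl⟩ := hg.exists_add x
        rw [add_lie]
        refine add_mem ?_ ?_
        -- Leibniz rule: y(as) = [y, a]s + a(ys), and ys stays in W. The radical part z merely
        -- multiplies the coefficients.
        · rw [eq_add_of_sub_eq (act_lie (y : 𝔏) (a s) s).symm]
          exact add_mem (hact _ _ (hWT _ hsW)) (hact _ _ (hWT _ (hW y s hsW)))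
        · rw [← act_ι]
          exact hact ⟨_, ι_mem_radAlg hz⟩ _ (hact _ _ (hWT _ hsW)) }
  refine ⟨S, fun n => ?_⟩
  have hn : n ∈ LieSubmodule.lieSpan ℂ 𝔏 (W : Set N) := by rw [hgen]; exact LieSubmodule.mem_top n
  exact (LieSubmodule.lieSpan_le (N := T)).mpr hWT hn

variable [FiniteDimensional ℂ 𝔏] [LieAlgebra.IsKilling ℂ g]

variable (g) in
/-- The projection of `U(r)` onto its `g`-invariants. -/
noncomputable def radReynolds : radAlg 𝔏 →ₗ[ℂ] radAlg 𝔏 :=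
  (locFin_radAlg.restrict g).reynolds

theorem radReynolds_mem (a : radAlg 𝔏) : radReynolds g a ∈ maxTrivSubmodule ℂ g (radAlg 𝔏) :=
  (locFin_radAlg.restrict g).reynolds_mem a

/-- The functional `a ↦ χ(a^g)` on `U(r)`. -/
noncomputable def radFunctional (hg : IsLevi g) (χ : radicalCenter 𝔏 →ₐ[ℂ] ℂ) : radAlg 𝔏 →ₗ[ℂ] ℂ :=
  χ.toLinearMap ∘ₗ
    { toFun := fun a => ⟨radReynolds g a, hg.mem_radicalCenter (radReynolds_mem a)⟩
      map_add' := fun a b => Subtype.ext <| by simp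
      map_smul' := fun c a => Subtype.ext <| by simp }

theorem radFunctional_apply (hg : IsLevi g) (χ : radicalCenter 𝔏 →ₐ[ℂ] ℂ) (a : radAlg 𝔏) :
    radFunctional hg χ a = χ ⟨radReynolds g a, hg.mem_radicalCenter (radReynolds_mem a)⟩ :=
  rfl

/-- Since n is invariant, a ↦ an is g-equivariant and commutes with the Reynolds operators. The
invariant part of a is central in U(𝔏), hence acts by its value under χ. -/
theorem reynolds_act (hg : IsLevi g) {χ : radicalCenter 𝔏 →ₐ[ℂ] ℂ} {N : Type u} [AddCommGroup N]
    [Module ℂ N] [LieRingModule 𝔏 N] [LieModule ℂ 𝔏 N] (hN : LocFin ℂ g N)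
    (hχ : HasRadicalCharacter χ N) (n : N) (hn : n ∈ maxTrivSubmodule ℂ g N) (a : radAlg 𝔏) :
    hN.reynolds (act N (a : Env 𝔏) n) = radFunctional hg χ a • n := by
  rw [← orbit_apply n hn, ← (locFin_radAlg.restrict g).map_reynolds hN (orbit g n hn) a]
  exact hχ ⟨radReynolds g a, hg.mem_radicalCenter (radReynolds_mem a)⟩ n

/-- A locally finite module with radical character that is finitely generated over `U(r)` has
finite-dimensional space of invariants. -/
theorem finiteDimensional_maxTriv (hg : IsLevi g) {χ : radicalCenter 𝔏 →ₐ[ℂ] ℂ} {N : Type u}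
    [AddCommGroup N] [Module ℂ N] [LieRingModule 𝔏 N] [LieModule ℂ 𝔏 N] (hN : LocFin ℂ g N)
    (hχ : HasRadicalCharacter χ N) (hfg : RadFG 𝔏 N) :
    FiniteDimensional ℂ (maxTrivSubmodule ℂ g N) := by
  -- Hilbert's argument: the generators are invariants, so applying the Reynolds operator to an
  -- expression of an invariant replaces the U(r)-coefficients by scalars.
  obtain ⟨S, hST, hS⟩ := hfg.exists_finset_generating (maxTrivSubmodule ℂ g N : Set N)
  refine Submodule.finiteDimensional_of_le (S₁ := (maxTrivSubmodule ℂ g N).toSubmodule)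
    (S₂ := Submodule.span ℂ (S : Set N)) ?_
  intro n hn
  obtain ⟨a, ha⟩ := hS n hn
  rw [← hN.reynolds_eq hn, ha, map_sum]
  refine sum_mem fun s hs => ?_
  rw [reynolds_act hg hN hχ s (hST hs)]
  exact Submodule.smul_mem _ _ (Submodule.subset_span hs)

end AbelianRadical

/-! ### Finite multiplicities; the sum of all proper submodules of Q(0, χ) is proper. -/

section UniversalModule

open LieModule Module UniversalEnvelopingAlgebra

variable {𝔏 : Type u} [LieRing 𝔏] [LieAlgebra ℂ 𝔏] {g : LieSubalgebra ℂ 𝔏}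
  [IsLieAbelian (LieAlgebra.radical ℂ 𝔏)]

theorem RadFG.hom {E N : Type u} [AddCommGroup N] [Module ℂ N]
    [LieRingModule 𝔏 N] [LieModule ℂ 𝔏 N] [AddCommGroup E] [Module ℂ E]
    [LieRingModule 𝔏 E] [LieModule ℂ 𝔏 E] [FiniteDimensional ℂ E] (h : RadFG 𝔏 N)
    (hE : ∀ x ∈ LieAlgebra.radical ℂ 𝔏, ∀ e : E, ⁅x, e⁆ = 0) : RadFG 𝔏 (E →ₗ[ℂ] N) := by
  classical
  obtain ⟨S, hS⟩ := h
  let b := Module.finBasis ℂ E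
  choose a ha using hS
  let F : Fin (finrank ℂ E) × N → (E →ₗ[ℂ] N) := fun p => (b.coord p.1).smulRight p.2
  have key : ∀ φ : E →ₗ[ℂ] N, φ = ∑ p ∈ Finset.univ ×ˢ S,
      act (E →ₗ[ℂ] N) (a (φ (b p.1)) p.2 : Env 𝔏) (F p) := by
    intro φ
    refine b.ext fun i => ?_
    rw [LinearMap.sum_apply]
    simp_rw [act_hom_apply hE (SetLike.coe_mem _)]
    rw [Finset.sum_product, Finset.sum_eq_single i]
    · conv_lhs => rw [ha (φ (b i))]
      refine Finset.sum_congr rfl fun s _ => ?_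
      simp [F]
    · intro j _ hj
      refine Finset.sum_eq_zero fun s _ => ?_
      simp [F, Finsupp.single_eq_of_ne hj]
    · simp
  refine ⟨(Finset.univ ×ˢ S).image F, fun φ => ?_⟩
  -- `F` need not be injective, so coefficients are collected along its fibres.
  refine ⟨fun ψ => ∑ p ∈ (Finset.univ ×ˢ S) with F p = ψ, a (φ (b p.1)) p.2, ?_⟩
  conv_lhs => rw [key φ]
  rw [← Finset.sum_fiberwise_of_maps_to (t := (Finset.univ ×ˢ S).image F) (g := F)
    (fun p hp => Finset.mem_image_of_mem F hp)]
  refine Finset.sum_congr rfl fun ψ _ => ?_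
  rw [AddSubmonoidClass.coe_finsetSum, map_sum, LinearMap.sum_apply]
  refine Finset.sum_congr rfl fun p hp => ?_
  rw [(Finset.mem_filter.mp hp).2]

/-- In a locally finite module with radical character that is finitely generated over `U(r)`, all
multiplicities are finite. -/
theorem finiteDimensional_hom [FiniteDimensional ℂ 𝔏] [LieAlgebra.IsKilling ℂ g]
    (hg : IsLevi g) {χ : radicalCenter 𝔏 →ₐ[ℂ] ℂ} {N : Type u}
    [AddCommGroup N] [Module ℂ N] [LieRingModule 𝔏 N] [LieModule ℂ 𝔏 N] (hN : LocFin ℂ g N)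
    (hχ : HasRadicalCharacter χ N) (hfg : RadFG 𝔏 N) (M : Type u) [AddCommGroup M] [Module ℂ M]
    [LieRingModule g M] [LieModule ℂ g M] [FiniteDimensional ℂ M] :
    FiniteDimensional ℂ (M →ₗ⁅ℂ, g⁆ N) := by
  have hE : ∀ x ∈ LieAlgebra.radical ℂ 𝔏, ∀ e : Infl hg M, ⁅x, e⁆ = 0 :=
    fun x hx e => radical_lie_infl hg M hx e
  have hχ' : HasRadicalCharacter χ (Infl hg M →ₗ[ℂ] N) := by
    intro z φ
    refine LinearMap.ext fun e => ?_
    exact (act_hom_apply hE z.2.2 φ e).trans (hχ z (φ e))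
  have hN' : LocFin ℂ g (Infl hg M →ₗ[ℂ] N) := hN.hom
  have := finiteDimensional_maxTriv hg hN' hχ' (hfg.hom hE)
  let f : (M →ₗ⁅ℂ, g⁆ N) →ₗ[ℂ] maxTrivSubmodule ℂ g (Infl hg M →ₗ[ℂ] N) :=
    { toFun := fun φ => maxTrivLinearMapEquivLieModuleHom.symm
        (φ.comp (inflEquiv hg M).symm.toLieModuleHom)
      map_add' := fun φ ψ => rfl
      map_smul' := fun c φ => rfl }
  refine Module.Finite.of_injective f fun φ ψ h => ?_
  ext m
  have := LieModuleHom.congr_fun (maxTrivLinearMapEquivLieModuleHom.symm.injective h)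
    (inflEquiv hg M m)
  simpa using this

section Augmentation

variable (g) (χ : radicalCenter 𝔏 →ₐ[ℂ] ℂ)

/-- The projection `U(𝔏) → Q(0, χ)`. -/
noncomputable def toQ : Env 𝔏 →ₗ[Env 𝔏] Q₀χ g χ :=
  (charSubmodule g χ).mkQ ∘ₗ (leftIdeal g).mkQ

/-- The projection `U(𝔏) → V(0, χ)`. -/
noncomputable def toV : Env 𝔏 →ₗ[Env 𝔏] V₀ g χ :=
  (maxSubmodule g χ).mkQ ∘ₗ toQ g χ

theorem toQ_surjective : Function.Surjective (toQ g χ) :=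
  (Submodule.mkQ_surjective _).comp (Submodule.mkQ_surjective _)

theorem toV_surjective : Function.Surjective (toV g χ) :=
  (Submodule.mkQ_surjective _).comp (toQ_surjective g χ)

variable {g χ}

theorem toV_eq_zero {u : Env 𝔏} : toV g χ u = 0 ↔ toQ g χ u ∈ maxSubmodule g χ :=
  Submodule.Quotient.mk_eq_zero _

theorem toQ_eq_zero_of_mem {u : Env 𝔏} (hu : u ∈ leftIdeal g) : toQ g χ u = 0 := by
  have : (leftIdeal g).mkQ u = 0 := (Submodule.Quotient.mk_eq_zero _).mpr hu
  rw [toQ, LinearMap.comp_apply, this, map_zero]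

theorem toQ_mul_eq_zero (z : radicalCenter 𝔏) (hz : χ z = 0) (u : Env 𝔏) :
    toQ g χ ((z : Env 𝔏) * u) = 0 := by
  refine (Submodule.Quotient.mk_eq_zero _).mpr (Submodule.subset_span ⟨z, hz, (leftIdeal g).mkQ u, ?_⟩)
  rw [← map_smul]
  rfl

theorem toQ_radicalCenter (z : radicalCenter 𝔏) (u : Env 𝔏) :
    toQ g χ ((z : Env 𝔏) * u) = χ z • toQ g χ u := by
  have h := toQ_mul_eq_zero (g := g) (χ := χ) (z - algebraMap ℂ _ (χ z)) (by simp) u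
  have h2 : ((z - algebraMap ℂ _ (χ z) : radicalCenter 𝔏) : Env 𝔏) * u =
      (z : Env 𝔏) * u - algebraMap ℂ (Env 𝔏) (χ z) • u := by
    simp only [AddSubgroupClass.coe_sub, sub_mul, smul_eq_mul]
    rfl
  rw [h2, map_sub, map_smul, algebraMap_smul, sub_eq_zero] at h
  exact h

/-- A left ideal of `U(𝔏)` that contains `g` and `𝐦_χ U(𝔏)` contains the kernel of
`U(𝔏) → Q(0, χ)`. -/
theorem mem_of_toQ_eq_zero (K : Submodule (Env 𝔏) (Env 𝔏)) (h1 : ∀ x : g, (ι ℂ (x : 𝔏) : Env 𝔏) ∈ K)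
    (h2 : ∀ z : radicalCenter 𝔏, χ z = 0 → ∀ u, (z : Env 𝔏) * u ∈ K) {u : Env 𝔏}
    (hu : toQ g χ u = 0) : u ∈ K := by
  have hl : leftIdeal g ≤ K := Submodule.span_le.mpr <| by
    rintro _ ⟨x, hx, rfl⟩
    exact h1 ⟨x, hx⟩
  have hc : charSubmodule g χ ≤ K.map (leftIdeal g).mkQ := Submodule.span_le.mpr <| by
    rintro _ ⟨z, hz, p, rfl⟩
    obtain ⟨v, rfl⟩ := Submodule.mkQ_surjective _ p
    exact ⟨(z : Env 𝔏) * v, h2 z hz v, rfl⟩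
  have hu' : (leftIdeal g).mkQ u ∈ charSubmodule g χ := (Submodule.Quotient.mk_eq_zero _).mp hu
  obtain ⟨k, hk, hku⟩ := hc hu'
  have : u - k ∈ leftIdeal g := by
    rw [← Submodule.Quotient.mk_eq_zero]
    change (leftIdeal g).mkQ (u - k) = 0
    rw [map_sub, hku, sub_self]
  have := add_mem (hl this) hk
  simpa using this

theorem toQ_lie (x : g) (a : radAlg 𝔏) :
    toQ g χ ((⁅(x : 𝔏), a⁆ : radAlg 𝔏) : Env 𝔏) = (ι ℂ (x : 𝔏) : Env 𝔏) • toQ g χ (a : Env 𝔏) := by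
  rw [coe_lie_radAlg, map_sub, toQ_eq_zero_of_mem (mul_mem_leftIdeal (a : Env 𝔏) (ι_mem_leftIdeal x)),
    sub_zero, ← smul_eq_mul, map_smul]

/-- The inclusion of the radical into `U(r)`. -/
noncomputable def radι : LieAlgebra.radical ℂ 𝔏 →ₗ⁅ℂ, 𝔏⁆ radAlg 𝔏 where
  toFun x := ⟨ι ℂ (x : 𝔏), ι_mem_radAlg x.2⟩
  map_add' x y := Subtype.ext (map_add (ι ℂ) (x : 𝔏) y)
  map_smul' t x := Subtype.ext (map_smul (ι ℂ) t (x : 𝔏))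
  map_lie' {x y} := Subtype.ext (ι_lie x (y : 𝔏))

/-- The projection of `𝔏` onto the radical along `g`. -/
noncomputable def IsLevi.radProj (hg : IsLevi g) : 𝔏 →ₗ[ℂ] LieAlgebra.radical ℂ 𝔏 where
  toFun x := ⟨x - (hg.proj x : 𝔏), hg.sub_proj_mem x⟩
  map_add' x y := Subtype.ext <| by
    change x + y - (hg.proj (x + y) : 𝔏) = x - (hg.proj x : 𝔏) + (y - (hg.proj y : 𝔏))
    rw [map_add]; push_cast; abel
  map_smul' c x := Subtype.ext <| by
    change c • x - (hg.proj (c • x) : 𝔏) = c • (x - (hg.proj x : 𝔏))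
    rw [map_smul, smul_sub]; rfl

/-- The missing term is the bracket of the two radical components, which vanishes because r is
abelian. -/
theorem IsLevi.radProj_lie (hg : IsLevi g) (x y : 𝔏) :
    hg.radProj ⁅x, y⁆ = ⁅(hg.proj x : 𝔏), hg.radProj y⁆ - ⁅(hg.proj y : 𝔏), hg.radProj x⁆ := by
  have h0 : ⁅hg.radProj x, hg.radProj y⁆ = 0 := trivial_lie_zero _ _ _ _
  have h1 : ⁅x - (hg.proj x : 𝔏), y - (hg.proj y : 𝔏)⁆ = 0 := congrArg Subtype.val h0
  refine Subtype.ext ?_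
  change ⁅x, y⁆ - (hg.proj ⁅x, y⁆ : 𝔏) =
    ⁅(hg.proj x : 𝔏), y - (hg.proj y : 𝔏)⁆ - ⁅(hg.proj y : 𝔏), x - (hg.proj x : 𝔏)⁆
  have h2 : (hg.proj ⁅x, y⁆ : 𝔏) = ⁅(hg.proj x : 𝔏), (hg.proj y : 𝔏)⁆ := by
    rw [LieHom.map_lie]; rfl
  rw [h2, ← sub_eq_zero, ← h1, ← lie_skew (hg.proj y : 𝔏)]
  simp only [sub_lie, lie_sub]
  abel

theorem radProj_coe (hg : IsLevi g) (x : g) : hg.radProj (x : 𝔏) = 0 :=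
  Subtype.ext <| by
    change (x : 𝔏) - (hg.proj (x : 𝔏) : 𝔏) = 0
    rw [hg.proj_coe, sub_self]

theorem radProj_of_mem (hg : IsLevi g) {x : 𝔏} (hx : x ∈ LieAlgebra.radical ℂ 𝔏) :
    hg.radProj x = ⟨x, hx⟩ :=
  Subtype.ext <| by
    change x - (hg.proj x : 𝔏) = x
    rw [hg.proj_radical hx]; simp

/-- The action of `x` on `U(r) ≃ U(𝔏) / U(𝔏) g`: `g` acts by derivations and the radical by
multiplication. -/
noncomputable def inducedEnd (hg : IsLevi g) : 𝔏 →ₗ[ℂ] Module.End ℂ (radAlg 𝔏) :=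
  (LieModule.toEnd ℂ 𝔏 (radAlg 𝔏) : 𝔏 →ₗ[ℂ] Module.End ℂ (radAlg 𝔏)) ∘ₗ g.toSubmodule.subtype ∘ₗ
    (hg.proj : 𝔏 →ₗ[ℂ] g) +
  LinearMap.mul ℂ (radAlg 𝔏) ∘ₗ (radι (𝔏 := 𝔏)).toLinearMap ∘ₗ hg.radProj

theorem inducedEnd_apply (hg : IsLevi g) (x : 𝔏) (a : radAlg 𝔏) :
    inducedEnd hg x a = ⁅(hg.proj x : 𝔏), a⁆ + radι (hg.radProj x) * a :=
  rfl

/-- This makes U(r) an 𝔏-module in which g kills 1 (`inducedEnd_one`). The map u ↦ u · 1 thus kills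
U(𝔏)g and is the identity on U(r), which gives functionals on U(𝔏) / U(𝔏)g without a
Poincaré–Birkhoff–Witt basis. -/
theorem inducedEnd_lie (hg : IsLevi g) (x y : 𝔏) (a : radAlg 𝔏) :
    inducedEnd hg ⁅x, y⁆ a =
      inducedEnd hg x (inducedEnd hg y a) - inducedEnd hg y (inducedEnd hg x a) := by
  have h2 : (hg.proj ⁅x, y⁆ : 𝔏) = ⁅(hg.proj x : 𝔏), (hg.proj y : 𝔏)⁆ := by
    rw [LieHom.map_lie]; rfl
  simp only [inducedEnd_apply, h2, hg.radProj_lie, map_sub, LieModuleHom.map_lie, lie_add,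
    lie_mul_radAlg, lie_lie]
  ring

/-- The action of `U(𝔏)` on `U(r) ≃ U(𝔏) / U(𝔏) g`. -/
noncomputable def inducedAct (hg : IsLevi g) : Env 𝔏 →ₐ[ℂ] Module.End ℂ (radAlg 𝔏) :=
  letI : LieRing (Module.End ℂ (radAlg 𝔏)) := LieRing.ofAssociativeRing
  lift ℂ { toLinearMap := inducedEnd hg
           map_lie' := fun {x y} => LinearMap.ext fun a => inducedEnd_lie hg x y a }

theorem inducedAct_ι (hg : IsLevi g) (x : 𝔏) : inducedAct hg (ι ℂ x) = inducedEnd hg x := by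
  rw [inducedAct, lift_ι_apply]
  rfl

theorem inducedAct_coe (hg : IsLevi g) {a : Env 𝔏} (ha : a ∈ radAlg 𝔏) : ∀ b : radAlg 𝔏,
    inducedAct hg a b = (⟨a, ha⟩ * b : radAlg 𝔏) := by
  induction ha using Algebra.adjoin_induction with
  | mem y hy =>
    obtain ⟨y, hy, rfl⟩ := hy
    intro b
    rw [inducedAct_ι, inducedEnd_apply, hg.proj_radical hy, radProj_of_mem hg hy,
      ZeroMemClass.coe_zero, zero_lie, zero_add]
    rfl
  | algebraMap r =>
    intro b
    rw [AlgHom.commutes, Module.algebraMap_end_apply]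
    exact Algebra.smul_def r b
  | add a b ha' hb' ha hb =>
    intro c
    rw [map_add, LinearMap.add_apply, ha, hb]
    exact (add_mul (⟨a, ha'⟩ : radAlg 𝔏) ⟨b, hb'⟩ c).symm
  | mul a b ha' hb' ha hb =>
    intro c
    rw [map_mul, Module.End.mul_apply, hb, ha]
    exact (mul_assoc (⟨a, ha'⟩ : radAlg 𝔏) ⟨b, hb'⟩ c).symm

theorem lie_one_radAlg (x : 𝔏) : ⁅x, (1 : radAlg 𝔏)⁆ = 0 :=
  Subtype.ext <| by
    rw [coe_lie_radAlg]
    change ι ℂ x * (1 : Env 𝔏) - 1 * ι ℂ x = 0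
    simp

theorem inducedEnd_one (hg : IsLevi g) (x : g) : inducedEnd hg (x : 𝔏) 1 = 0 := by
  rw [inducedEnd_apply, radProj_coe, map_zero, zero_mul, lie_one_radAlg, add_zero]

variable [FiniteDimensional ℂ 𝔏] [LieAlgebra.IsKilling ℂ g]

/-- The functional on `U(𝔏)` that evaluates the `g`-invariant part of `u · 1 ∈ U(r)` by `χ`. -/
noncomputable def envFunctional (hg : IsLevi g) (χ : radicalCenter 𝔏 →ₐ[ℂ] ℂ) : Env 𝔏 →ₗ[ℂ] ℂ :=
  radFunctional hg χ ∘ₗ (inducedAct hg).toLinearMap.flip 1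

theorem envFunctional_apply (hg : IsLevi g) (u : Env 𝔏) : envFunctional hg χ u =
    radFunctional hg χ (inducedAct hg u 1) :=
  rfl

theorem envFunctional_coe (hg : IsLevi g) (a : radAlg 𝔏) :
    envFunctional hg χ (a : Env 𝔏) = radFunctional hg χ a := by
  rw [envFunctional_apply, inducedAct_coe hg a.2, mul_one]

theorem envFunctional_one (hg : IsLevi g) : envFunctional hg χ 1 = 1 := by
  have h1 : (1 : radAlg 𝔏) ∈ maxTrivSubmodule ℂ g (radAlg 𝔏) :=
    (mem_maxTrivSubmodule ℂ g _ _).mpr fun x => lie_one_radAlg (x : 𝔏)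
  rw [show (1 : Env 𝔏) = ((1 : radAlg 𝔏) : Env 𝔏) from rfl, envFunctional_coe, radFunctional_apply,
    ← map_one χ]
  congr 1
  refine Subtype.ext ?_
  change ((radReynolds g 1 : radAlg 𝔏) : Env 𝔏) = ((1 : radAlg 𝔏) : Env 𝔏)
  exact congrArg _ ((locFin_radAlg.restrict g).reynolds_eq h1)

/-- Multiplication by an invariant commutes with the Reynolds operator. -/
theorem radReynolds_mul {z : radAlg 𝔏} (hz : z ∈ maxTrivSubmodule ℂ g (radAlg 𝔏)) (a : radAlg 𝔏) :
    radReynolds g (z * a) = z * radReynolds g a := by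
  let f : radAlg 𝔏 →ₗ⁅ℂ, g⁆ radAlg 𝔏 :=
    { LinearMap.mulLeft ℂ z with
      map_lie' := fun {x a} => by
        change z * ⁅(x : 𝔏), a⁆ = ⁅(x : 𝔏), z * a⁆
        have : ⁅(x : 𝔏), z⁆ = 0 := (mem_maxTrivSubmodule ℂ g _ _).mp hz x
        rw [lie_mul_radAlg, this, zero_mul, zero_add] }
  exact ((locFin_radAlg.restrict g).map_reynolds (locFin_radAlg.restrict g) f a).symm

theorem radicalCenter_mem_maxTriv (z : radicalCenter 𝔏) :
    (⟨z, z.2.2⟩ : radAlg 𝔏) ∈ maxTrivSubmodule ℂ g (radAlg 𝔏) :=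
  (mem_maxTrivSubmodule ℂ g _ _).mpr fun x => Subtype.ext <| by
    change ι ℂ (x : 𝔏) * (z : Env 𝔏) - (z : Env 𝔏) * ι ℂ (x : 𝔏) = 0
    have : (z : Env 𝔏) ∈ Subalgebra.center ℂ (Env 𝔏) := z.2.1
    rw [Subalgebra.mem_center_iff] at this
    rw [this, sub_self]

theorem radFunctional_radicalCenter_mul (hg : IsLevi g) (z : radicalCenter 𝔏) (a : radAlg 𝔏) :
    radFunctional hg χ (⟨z, z.2.2⟩ * a) = χ z * radFunctional hg χ a := by
  rw [radFunctional_apply, radFunctional_apply, ← map_mul]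
  congr 1
  refine Subtype.ext ?_
  change ((radReynolds g (⟨z, z.2.2⟩ * a) : radAlg 𝔏) : Env 𝔏) =
    ((⟨z, z.2.2⟩ * radReynolds g a : radAlg 𝔏) : Env 𝔏)
  rw [radReynolds_mul (radicalCenter_mem_maxTriv z) a]

/-- The elements u such that the functional vanishes on U(𝔏)u form a left ideal. It contains g since
g kills 1, and zu for z in Ker χ since z is central and the factor χ(z) can be pulled out of the
functional. -/
theorem envFunctional_eq_zero (hg : IsLevi g) {u : Env 𝔏} (hu : toQ g χ u = 0) :
    envFunctional hg χ u = 0 := by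
  let K : Submodule (Env 𝔏) (Env 𝔏) :=
    { carrier := {u | ∀ v, envFunctional hg χ (v * u) = 0}
      add_mem' := fun {a b} ha hb v => by rw [mul_add, map_add, ha, hb, add_zero]
      zero_mem' := fun v => by rw [mul_zero, map_zero]
      smul_mem' := fun c {a} ha v => by rw [smul_eq_mul, ← mul_assoc]; exact ha _ }
  have := mem_of_toQ_eq_zero (χ := χ) K (fun x v => ?_) (fun z hz u v => ?_) hu
  · simpa using this 1
  · rw [envFunctional_apply, map_mul, Module.End.mul_apply, inducedAct_ι, inducedEnd_one, map_zero,
      map_zero]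
  · have hzc : (z : Env 𝔏) ∈ Subalgebra.center ℂ (Env 𝔏) := z.2.1
    rw [Subalgebra.mem_center_iff] at hzc
    rw [← mul_assoc, hzc, mul_assoc, envFunctional_apply, map_mul, Module.End.mul_apply,
      inducedAct_coe hg z.2.2, radFunctional_radicalCenter_mul, hz, zero_mul]

/-- Modulo U(𝔏)g the element u is some a in U(r). The preimage of N in U(r) is g-stable, so it
contains the invariant part of a, whose image is the value of the functional times the generator. A
nonzero value would put the generator into N. -/
theorem envFunctional_eq_zero_of_mem (hg : IsLevi g) {N : Submodule (Env 𝔏) (Q₀χ g χ)} (hN : N ≠ ⊤)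
    {u : Env 𝔏} (hu : toQ g χ u ∈ N) : envFunctional hg χ u = 0 := by
  obtain ⟨a, ha⟩ := hg.exists_sub_mem_leftIdeal u
  have ha' := toQ_eq_zero_of_mem (χ := χ) ha
  have h0 := envFunctional_eq_zero hg ha'
  rw [map_sub, sub_eq_zero] at ha' h0
  rw [h0, envFunctional_coe]
  rw [ha'] at hu
  let I : LieSubmodule ℂ g (radAlg 𝔏) :=
    { carrier := {b | toQ g χ (b : Env 𝔏) ∈ N}
      add_mem' := fun {b c} hb hc => by
        change toQ g χ ((b : Env 𝔏) + c) ∈ N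
        rw [map_add]; exact add_mem hb hc
      zero_mem' := by
        change toQ g χ (0 : Env 𝔏) ∈ N
        rw [map_zero]; exact zero_mem _
      smul_mem' := fun c {b} hb => by
        change toQ g χ (c • (b : Env 𝔏)) ∈ N
        rw [← algebraMap_smul (Env 𝔏) c (b : Env 𝔏), map_smul]
        exact Submodule.smul_mem _ _ hb
      lie_mem := fun {x b} hb => by
        change toQ g χ ((⁅(x : 𝔏), b⁆ : radAlg 𝔏) : Env 𝔏) ∈ N
        rw [toQ_lie]
        exact Submodule.smul_mem _ _ hb }
  have hR : radReynolds g a ∈ I := by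
    have h := (locFin_radAlg.restrict g).lieSubmodule I
    have := h.map_reynolds (locFin_radAlg.restrict g) I.incl ⟨a, hu⟩
    change _ = radReynolds g a at this
    rw [← this]
    exact (h.reynolds ⟨a, hu⟩).2
  by_contra hne
  apply hN
  have h1 : toQ g χ 1 ∈ N := by
    have h2 := toQ_radicalCenter (g := g) (χ := χ) ⟨_, hg.mem_radicalCenter (radReynolds_mem a)⟩ 1
    rw [mul_one, ← radFunctional_apply hg χ a] at h2
    have h3 : radFunctional hg χ a • toQ g χ 1 ∈ N := h2 ▸ hR
    rw [← algebraMap_smul (Env 𝔏)] at h3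
    have h4 := Submodule.smul_mem N (algebraMap ℂ (Env 𝔏) (radFunctional hg χ a)⁻¹) h3
    rwa [← mul_smul, ← map_mul, inv_mul_cancel₀ hne, map_one, one_smul] at h4
  rw [eq_top_iff]
  intro p _
  obtain ⟨v, rfl⟩ := toQ_surjective g χ p
  rw [← mul_one v, ← smul_eq_mul, map_smul]
  exact Submodule.smul_mem _ _ h1

/-- The sum of all proper submodules of `Q(0, χ)` is proper. -/
theorem toQ_one_notMem (hg : IsLevi g) : toQ g χ 1 ∉ maxSubmodule g χ := by
  intro h
  -- The zero set of the functional contains every proper submodule and is a linear subspace, hence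
  -- contains their sum. The functional takes the value 1 at 1.
  have key : ∀ p ∈ maxSubmodule g χ, ∀ u, toQ g χ u = p → envFunctional hg χ u = 0 := by
    intro p hp
    rw [maxSubmodule, sSup_eq_iSup'] at hp
    induction hp using Submodule.iSup_induction' with
    | mem i x hx =>
      rintro u rfl
      exact envFunctional_eq_zero_of_mem hg i.2 hx
    | zero => exact fun u hu => envFunctional_eq_zero hg hu
    | add x y _ _ hx hy =>
      intro u hu
      obtain ⟨v, rfl⟩ := toQ_surjective g χ x
      have h1 := hx v rfl
      have h2 := hy (u - v) (by rw [map_sub, hu, add_sub_cancel_left])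
      rw [map_sub, h1, sub_zero] at h2
      exact h2
  have := key _ h 1 rfl
  rw [envFunctional_one] at this
  exact one_ne_zero this

end Augmentation

end UniversalModule

/-! ### The module V(0, χ) and its maps into Hom(E, V). -/

section SphericalModule

open LieModule Module UniversalEnvelopingAlgebra

variable {𝔏 : Type u} [LieRing 𝔏] [LieAlgebra ℂ 𝔏] {g : LieSubalgebra ℂ 𝔏}
  [IsLieAbelian (LieAlgebra.radical ℂ 𝔏)] {χ : radicalCenter 𝔏 →ₐ[ℂ] ℂ}

theorem toV_smul_complex (c : ℂ) (u : Env 𝔏) : toV g χ (c • u) = c • toV g χ u := by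
  rw [← algebraMap_smul (Env 𝔏) c u, map_smul, algebraMap_smul]

theorem act_V₀ (u : Env 𝔏) : ∀ v : V₀ g χ, act (V₀ g χ) u v = u • v := by
  induction u using env_induction with
  | algebraMap c => intro v; rw [act_algebraMap, algebraMap_smul]
  | ι x => intro v; rw [act_ι]; rfl
  | mul u v hu hv => intro n; rw [act_mul, hv, hu, mul_smul]
  | add u v hu hv => intro n; rw [map_add, LinearMap.add_apply, hu, hv, add_smul]

theorem act_toV (u v : Env 𝔏) : act (V₀ g χ) u (toV g χ v) = toV g χ (u * v) := by
  rw [act_V₀, ← map_smul, smul_eq_mul]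

theorem lie_toV (x : 𝔏) (v : Env 𝔏) : ⁅x, toV g χ v⁆ = toV g χ (ι ℂ x * v) := by
  rw [← act_ι, act_toV]

theorem toV_eq_zero_of_mem {u : Env 𝔏} (hu : u ∈ leftIdeal g) : toV g χ u = 0 := by
  change (maxSubmodule g χ).mkQ (toQ g χ u) = 0
  rw [toQ_eq_zero_of_mem hu, map_zero]

theorem toV_radicalCenter (z : radicalCenter 𝔏) (u : Env 𝔏) :
    toV g χ ((z : Env 𝔏) * u) = χ z • toV g χ u := by
  change (maxSubmodule g χ).mkQ (toQ g χ _) = χ z • (maxSubmodule g χ).mkQ (toQ g χ _)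
  rw [toQ_radicalCenter, ← algebraMap_smul (Env 𝔏) (χ z) (toQ g χ u), map_smul, algebraMap_smul]

variable (g χ) in
theorem hasRadicalCharacter_V₀ : HasRadicalCharacter χ (V₀ g χ) := by
  intro z v
  obtain ⟨u, rfl⟩ := toV_surjective g χ v
  exact (act_toV (z : Env 𝔏) u).trans (toV_radicalCenter z u)

theorem toV_one_mem_maxTriv : toV g χ 1 ∈ maxTrivSubmodule ℂ g (V₀ g χ) :=
  (mem_maxTrivSubmodule ℂ g _ _).mpr fun x => by
    change ⁅(x : 𝔏), toV g χ 1⁆ = 0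
    rw [lie_toV, mul_one, toV_eq_zero_of_mem (ι_mem_leftIdeal x)]

theorem exists_toV_eq (hg : IsLevi g) (v : V₀ g χ) : ∃ a : radAlg 𝔏, toV g χ (a : Env 𝔏) = v := by
  obtain ⟨u, rfl⟩ := toV_surjective g χ v
  obtain ⟨a, ha⟩ := hg.exists_sub_mem_leftIdeal u
  have := toV_eq_zero_of_mem (χ := χ) ha
  rw [map_sub, sub_eq_zero] at this
  exact ⟨a, this.symm⟩

theorem locFin_V₀ [FiniteDimensional ℂ 𝔏] (hg : IsLevi g) : LocFin ℂ g (V₀ g χ) := by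
  refine (locFin_radAlg.restrict g).of_surjective (orbit g (toV g χ 1) toV_one_mem_maxTriv) ?_
  intro v
  obtain ⟨a, rfl⟩ := exists_toV_eq hg v
  exact ⟨a, by rw [orbit_apply, act_toV, mul_one]⟩

theorem radFG_V₀ (hg : IsLevi g) :
    RadFG 𝔏 (V₀ g χ) := by
  refine ⟨{toV g χ 1}, fun v => ?_⟩
  obtain ⟨a, rfl⟩ := exists_toV_eq hg v
  exact ⟨fun _ => a, by rw [Finset.sum_singleton, act_toV, mul_one]⟩

theorem nontrivial_V₀ [FiniteDimensional ℂ 𝔏]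
    [LieAlgebra.IsKilling ℂ g] (hg : IsLevi g) : Nontrivial (V₀ g χ) :=
  ⟨toV g χ 1, 0, fun h => toQ_one_notMem hg (toV_eq_zero.mp h)⟩

/-- The universal property of `V(0, χ)` as a quotient of `U(𝔏)`. -/
theorem exists_hom_V₀ {N : Type*} [AddCommGroup N] [Module ℂ N] [LieRingModule 𝔏 N]
    [LieModule ℂ 𝔏 N] (n : N) (hn : ∀ u, toV g χ u = 0 → act N u n = 0) :
    ∃ F : V₀ g χ →ₗ⁅ℂ, 𝔏⁆ N, ∀ u, F (toV g χ u) = act N u n := by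
  let T : Env 𝔏 →ₗ[ℂ] V₀ g χ :=
    { toFun := toV g χ
      map_add' := map_add _
      map_smul' := toV_smul_complex }
  obtain ⟨σ, hσ⟩ := T.exists_rightInverse_of_surjective
    (LinearMap.range_eq_top.mpr (toV_surjective g χ))
  have hσ' : ∀ v, toV g χ (σ v) = v := fun v => LinearMap.congr_fun hσ v
  have key : ∀ u, act N (σ (toV g χ u)) n = act N u n := by
    intro u
    rw [← sub_eq_zero, ← LinearMap.sub_apply, ← map_sub]
    refine hn _ ?_
    rw [map_sub, hσ', sub_self]
  refine ⟨{ (act N).toLinearMap.flip n ∘ₗ σ with map_lie' := fun {x v} => ?_ }, key⟩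
  change act N (σ ⁅x, v⁆) n = ⁅x, act N (σ v) n⁆
  obtain ⟨u, rfl⟩ := toV_surjective g χ v
  rw [lie_toV, key, key, act_mul, act_ι]

/-- An invariant homomorphism from a module with trivial action of the radical to a simple module
with radical character `χ` is annihilated by the maximal left ideal defining `V(0, χ)`. -/
theorem act_hom_eq_zero [FiniteDimensional ℂ 𝔏]
    [LieAlgebra.IsKilling ℂ g] (hg : IsLevi g) {E V : Type u} [AddCommGroup E] [Module ℂ E]
    [LieRingModule 𝔏 E] [LieModule ℂ 𝔏 E] [AddCommGroup V] [Module ℂ V] [LieRingModule 𝔏 V]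
    [LieModule ℂ 𝔏 V] (hE : ∀ x ∈ LieAlgebra.radical ℂ 𝔏, ∀ e : E, ⁅x, e⁆ = 0)
    (hV : IsIrreducible ℂ 𝔏 V) (hfg : RadFG 𝔏 V) (hχ : HasRadicalCharacter χ V)
    {φ : E →ₗ[ℂ] V} (hφ : φ ∈ maxTrivSubmodule ℂ g (E →ₗ[ℂ] V)) {u : Env 𝔏}
    (hu : toV g χ u = 0) : act (E →ₗ[ℂ] V) u φ = 0 := by
  let K : Submodule (Env 𝔏) (Env 𝔏) :=
    { carrier := {u | act (E →ₗ[ℂ] V) u φ = 0}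
      add_mem' := fun {a b} ha hb => by
        change act (E →ₗ[ℂ] V) (a + b) φ = 0
        rw [map_add, LinearMap.add_apply, show act (E →ₗ[ℂ] V) a φ = 0 from ha,
          show act (E →ₗ[ℂ] V) b φ = 0 from hb, add_zero]
      zero_mem' := by
        change act (E →ₗ[ℂ] V) 0 φ = 0
        rw [map_zero, LinearMap.zero_apply]
      smul_mem' := fun c {a} ha => by
        change act (E →ₗ[ℂ] V) (c * a) φ = 0
        rw [act_mul, show act (E →ₗ[ℂ] V) a φ = 0 from ha, map_zero] }
  have hKr : ∀ a : radAlg 𝔏, (∀ v : V, act V (a : Env 𝔏) v = 0) → (a : Env 𝔏) ∈ K := by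
    intro a ha
    refine LinearMap.ext fun e => ?_
    rw [act_hom_apply hE a.2, ha, LinearMap.zero_apply]
  have hK : ∀ u, toQ g χ u = 0 → u ∈ K := by
    refine fun u => mem_of_toQ_eq_zero K (fun x => ?_) (fun z hz u => ?_)
    · change act (E →ₗ[ℂ] V) _ φ = 0
      rw [act_ι]
      exact (mem_maxTrivSubmodule ℂ g _ _).mp hφ x
    · have hzc : (z : Env 𝔏) ∈ Subalgebra.center ℂ (Env 𝔏) := z.2.1
      rw [Subalgebra.mem_center_iff] at hzc
      rw [← hzc]
      refine K.smul_mem u (hKr ⟨z, z.2.2⟩ fun v => ?_)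
      exact (hχ z v).trans (by rw [hz, zero_smul])
  rw [toV_eq_zero] at hu
  obtain ⟨a, ha⟩ := hg.exists_sub_mem_leftIdeal u
  have ha' := toQ_eq_zero_of_mem (χ := χ) ha
  have hau : u - a ∈ K := hK _ ha'
  rw [map_sub, sub_eq_zero] at ha'
  rw [ha'] at hu
  suffices haK : (a : Env 𝔏) ∈ K by
    have := add_mem hau haK
    rwa [sub_add_cancel] at this
  by_contra haK
  -- Only a in I has to be treated, and it suffices that a annihilates V. The space `T` below is IV,
  -- an 𝔏-submodule because I is a g-stable ideal. If IV = 0 then a is harmless, so the remaining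
  -- case is IV = V.
  let I : Ideal (radAlg 𝔏) :=
    { carrier := {b | toQ g χ (b : Env 𝔏) ∈ maxSubmodule g χ}
      add_mem' := fun {b c} hb hc => by
        change toQ g χ ((b : Env 𝔏) + c) ∈ maxSubmodule g χ
        rw [map_add]; exact add_mem hb hc
      zero_mem' := by
        change toQ g χ (0 : Env 𝔏) ∈ maxSubmodule g χ
        rw [map_zero]; exact zero_mem _
      smul_mem' := fun c {b} hb => by
        change toQ g χ ((c : Env 𝔏) • (b : Env 𝔏)) ∈ maxSubmodule g χ
        rw [map_smul]
        exact Submodule.smul_mem _ _ hb }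
  have hIlie : ∀ (x : g), ∀ b ∈ I, ⁅(x : 𝔏), b⁆ ∈ I := by
    intro x b hb
    change toQ g χ ((⁅(x : 𝔏), b⁆ : radAlg 𝔏) : Env 𝔏) ∈ maxSubmodule g χ
    rw [toQ_lie]
    exact Submodule.smul_mem _ _ hb
  let T : LieSubmodule ℂ 𝔏 V :=
    { Submodule.span ℂ {m | ∃ b ∈ I, ∃ k : V, m = act V (b : Env 𝔏) k} with
      lie_mem := by
        intro x m hm
        change m ∈ Submodule.span ℂ _ at hm
        change ⁅x, m⁆ ∈ Submodule.span ℂ _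
        induction hm using Submodule.span_induction with
        | mem m hm =>
          obtain ⟨b, hb, k, rfl⟩ := hm
          obtain ⟨y, z, hz, rfl⟩ := hg.exists_add x
          rw [add_lie]
          refine add_mem ?_ (Submodule.subset_span
            ⟨⟨ι ℂ z, ι_mem_radAlg hz⟩ * b, I.mul_mem_left _ hb, k, ?_⟩)
          · rw [eq_add_of_sub_eq (act_lie (y : 𝔏) b k).symm]
            exact add_mem (Submodule.subset_span ⟨_, hIlie y b hb, k, rfl⟩)
              (Submodule.subset_span ⟨b, hb, _, rfl⟩)
          · rw [← act_ι]
            exact (act_mul (ι ℂ z) (b : Env 𝔏) k).symm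
        | zero => rw [lie_zero]; exact zero_mem _
        | add m n _ _ hm hn => rw [lie_add]; exact add_mem hm hn
        | smul c m _ hm => rw [lie_smul]; exact Submodule.smul_mem _ c hm }
  have hTtop : T = ⊤ := by
    refine (hV.eq_bot_or_eq_top T).resolve_left fun h => haK (hKr a fun v => ?_)
    have : act V (a : Env 𝔏) v ∈ T := Submodule.subset_span ⟨a, hu, v, rfl⟩
    rw [h] at this
    simpa using this
  -- The element r annihilates V, hence lies in K, while r - 1 lies in I. As the image of K in Q(0,
  -- χ) is proper, r and r - 1, and so also 1, map into the sum of proper submodules.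
  obtain ⟨r, hrI, hr⟩ := hfg.nakayama I fun n => by
    have : n ∈ T := by rw [hTtop]; exact LieSubmodule.mem_top n
    exact this
  have hne : K.map (toQ g χ) ≠ ⊤ := by
    intro htop
    have h1 : toQ g χ 1 ∈ K.map (toQ g χ) := by rw [htop]; trivial
    obtain ⟨k, hk, hk1⟩ := h1
    have h2 : (1 : Env 𝔏) - k ∈ K := hK _ (by rw [map_sub, hk1, sub_self])
    have h3 : (1 : Env 𝔏) ∈ K := by simpa using add_mem h2 hk
    apply haK
    rw [← mul_one (a : Env 𝔏)]
    exact K.smul_mem _ h3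
  have hr2 : toQ g χ (r : Env 𝔏) ∈ maxSubmodule g χ :=
    le_sSup (show K.map (toQ g χ) ∈ {N | N ≠ ⊤} from hne) ⟨r, hKr r hr, rfl⟩
  have hr1 : toQ g χ ((r : Env 𝔏) - 1) ∈ maxSubmodule g χ := hrI
  rw [map_sub] at hr1
  have := sub_mem hr2 hr1
  rw [sub_sub_cancel] at this
  exact toQ_one_notMem hg this

end SphericalModule

/-! ### The multiplicity of L in W ⊗ L. -/

section TensorMultiplicity

open LieModule Module

variable {A : Type u} [LieRing A] [LieAlgebra ℂ A]

section Transport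

variable {V V' : Type*} [AddCommGroup V] [Module ℂ V] [LieRingModule A V] [LieModule ℂ A V]
  [AddCommGroup V'] [Module ℂ V'] [LieRingModule A V'] [LieModule ℂ A V']

theorem isIrreducible_of_equiv (e : V ≃ₗ⁅ℂ, A⁆ V') (h : IsIrreducible ℂ A V) :
    IsIrreducible ℂ A V' :=
  (LieSubmodule.orderIsoMapComap e).symm.isSimpleOrder

theorem isSimpleFinDim_out (M : isoClasses (A := A) IsSimpleFinDim) : IsSimpleFinDim M.1.out := by
  obtain ⟨V, ⟨hV, hV'⟩, hM⟩ := M.2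
  have hM' : Quotient.mk (LieMod.isoSetoid A) V = M.1 := hM
  obtain ⟨e⟩ : Nonempty (V ≃ₗ⁅ℂ, A⁆ M.1.out) := Quotient.exact (hM'.trans M.1.out_eq.symm)
  exact ⟨isIrreducible_of_equiv e hV, Module.Finite.equiv e.toLinearEquiv⟩

end Transport

instance (M : isoClasses (A := A) IsSimpleFinDim) : FiniteDimensional ℂ M.1.out :=
  (isSimpleFinDim_out M).2

theorem eq_of_nonempty_equiv (M M' : isoClasses (A := A) IsSimpleFinDim)
    (h : Nonempty (M.1.out ≃ₗ⁅ℂ, A⁆ M'.1.out)) : M = M' := by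
  refine Subtype.ext ?_
  rw [← M.1.out_eq, ← M'.1.out_eq]
  exact Quotient.sound h

theorem mult_eq_finrank {V M : Type u} [AddCommGroup V] [Module ℂ V] [LieRingModule A V]
    [LieModule ℂ A V] [AddCommGroup M] [Module ℂ M] [LieRingModule A M] [LieModule ℂ A M]
    [FiniteDimensional ℂ (M →ₗ⁅ℂ, A⁆ V)] : mult A V M = (finrank ℂ (M →ₗ⁅ℂ, A⁆ V) : ℕ∞) := by
  rw [mult, ← finrank_eq_rank, Cardinal.toENat_nat]

/-- Homomorphisms between finite-dimensional modules form a finite-dimensional space. -/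
instance finiteDimensional_lieModuleHom {M V : Type*} [AddCommGroup V] [Module ℂ V]
    [LieRingModule A V] [LieModule ℂ A V] [AddCommGroup M] [Module ℂ M] [LieRingModule A M]
    [LieModule ℂ A M] [FiniteDimensional ℂ M] [FiniteDimensional ℂ V] :
    FiniteDimensional ℂ (M →ₗ⁅ℂ, A⁆ V) :=
  Module.Finite.equiv (maxTrivLinearMapEquivLieModuleHom (R := ℂ) (L := A) (M := M) (N := V))

section Projections

variable {W L : Type*} [AddCommGroup W] [Module ℂ W] [LieRingModule A W] [LieModule ℂ A W]
  [AddCommGroup L] [Module ℂ L] [LieRingModule A L] [LieModule ℂ A L]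

/-- The equivariant projections of an internal direct sum. -/
theorem exists_projections {ι : Type*} [DecidableEq ι] (S : ι → LieSubmodule ℂ A W)
    (hS : DirectSum.IsInternal (fun i => (S i).toSubmodule)) :
    ∃ p : ∀ i, W →ₗ⁅ℂ, A⁆ S i, ∀ w, ∃ T : Finset ι, ∀ T', T ⊆ T' → w = ∑ i ∈ T', (p i w : W) := by
  classical
  let _ := hS.chooseDecomposition
  let ℳ := fun i => (S i).toSubmodule
  refine ⟨fun i =>
    { toFun := fun w => DirectSum.decompose ℳ w i
      map_add' := fun v w => by rw [DirectSum.decompose_add]; rfl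
      map_smul' := fun c w => by rw [DirectSum.decompose_smul]; rfl
      map_lie' := fun {x w} => ?_ }, fun w => ?_⟩
  · induction w using DirectSum.Decomposition.inductionOn ℳ with
    | zero => rw [lie_zero, DirectSum.decompose_zero]; exact (lie_zero x).symm
    | @homogeneous j m =>
      refine Subtype.ext ?_
      change (DirectSum.decompose ℳ ⁅x, (m : W)⁆ i : W) = ⁅x, (DirectSum.decompose ℳ (m : W) i : W)⁆
      have hxm : ⁅x, (m : W)⁆ ∈ ℳ j := (S j).lie_mem m.2
      by_cases hij : j = i
      · subst hij
        rw [DirectSum.decompose_of_mem_same ℳ hxm, DirectSum.decompose_of_mem_same ℳ m.2]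
      · rw [DirectSum.decompose_of_mem_ne ℳ hxm hij, DirectSum.decompose_of_mem_ne ℳ m.2 hij,
          lie_zero]
    | add v w hv hw =>
      change DirectSum.decompose ℳ ⁅x, v⁆ i = (⁅x, (DirectSum.decompose ℳ v i : S i)⁆ : S i) at hv
      change DirectSum.decompose ℳ ⁅x, w⁆ i = (⁅x, (DirectSum.decompose ℳ w i : S i)⁆ : S i) at hw
      change DirectSum.decompose ℳ ⁅x, v + w⁆ i =
        (⁅x, (DirectSum.decompose ℳ (v + w) i : S i)⁆ : S i)
      rw [lie_add, DirectSum.decompose_add, DirectSum.add_apply, hv, hw, DirectSum.decompose_add,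
        DirectSum.add_apply]
      exact (lie_add (M := S i) x _ _).symm
  · refine ⟨(DirectSum.decompose ℳ w).support, fun T' hT' => ?_⟩
    conv_lhs => rw [← DirectSum.sum_support_decompose ℳ w]
    refine Finset.sum_subset hT' fun i _ hi => ?_
    rw [DFinsupp.notMem_support_iff.mp hi]
    rfl

theorem exists_projections_tensor {ι : Type*} [DecidableEq ι] (S : ι → LieSubmodule ℂ A W)
    (p : ∀ i, W →ₗ⁅ℂ, A⁆ S i)
    (hp : ∀ w, ∃ T : Finset ι, ∀ T', T ⊆ T' → w = ∑ i ∈ T', (p i w : W)) (t : W ⊗[ℂ] L) :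
    ∃ T : Finset ι, ∀ T', T ⊆ T' → t = ∑ i ∈ T', TensorProduct.LieModule.map (S i).incl
      (LieModuleHom.id : L →ₗ⁅ℂ, A⁆ L) (TensorProduct.LieModule.map (p i) LieModuleHom.id t) := by
  induction t using TensorProduct.induction_on with
  | zero => exact ⟨∅, fun T' _ => by simp⟩
  | tmul w l =>
    obtain ⟨T, hT⟩ := hp w
    refine ⟨T, fun T' hT' => ?_⟩
    conv_lhs => rw [hT T' hT', TensorProduct.sum_tmul]
    simp
  | add s t hs ht =>
    obtain ⟨T₁, h₁⟩ := hs
    obtain ⟨T₂, h₂⟩ := ht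
    refine ⟨T₁ ∪ T₂, fun T' hT' => ?_⟩
    simp only [map_add, Finset.sum_add_distrib]
    rw [← h₁ T' (Finset.union_subset_left hT'), ← h₂ T' (Finset.union_subset_right hT')]

theorem lieModuleHom_sum_apply {ι M : Type*} [AddCommGroup M] [Module ℂ M] [LieRingModule A M]
    [LieModule ℂ A M] (T : Finset ι) (f : ι → M →ₗ⁅ℂ, A⁆ W) (m : M) :
    (∑ i ∈ T, f i) m = ∑ i ∈ T, f i m :=
  map_sum ({ toFun := fun f => f m, map_zero' := rfl, map_add' := fun _ _ => rfl } :
    (M →ₗ⁅ℂ, A⁆ W) →+ W) f T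

/-- A basis of the finite-dimensional L meets only finitely many of the summands of W ⊗ L. -/
theorem exists_projections_hom [FiniteDimensional ℂ L] {ι : Type*} [DecidableEq ι]
    (S : ι → LieSubmodule ℂ A W) (p : ∀ i, W →ₗ⁅ℂ, A⁆ S i)
    (hp : ∀ w, ∃ T : Finset ι, ∀ T', T ⊆ T' → w = ∑ i ∈ T', (p i w : W))
    (h : L →ₗ⁅ℂ, A⁆ W ⊗[ℂ] L) :
    ∃ T : Finset ι, h = ∑ i ∈ T, (TensorProduct.LieModule.map (S i).incl LieModuleHom.id).comp
      ((TensorProduct.LieModule.map (p i) LieModuleHom.id).comp h) := by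
  choose T hT using fun l => exists_projections_tensor S p hp (h l)
  let b := Module.finBasis ℂ L
  refine ⟨Finset.univ.biUnion fun i => T (b i), ?_⟩
  refine LieModuleHom.ext fun l => ?_
  refine LinearMap.congr_fun (f := (h : L →ₗ[ℂ] W ⊗[ℂ] L)) (g := LieModuleHom.toLinearMap _)
    (b.ext fun i => ?_) l
  have := hT (b i) _ (Finset.subset_biUnion_of_mem (fun i => T (b i)) (Finset.mem_univ i))
  refine this.trans (lieModuleHom_sum_apply (Finset.univ.biUnion fun i => T (b i))
    (fun i => (TensorProduct.LieModule.map (S i).incl LieModuleHom.id).comp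
      ((TensorProduct.LieModule.map (p i) LieModuleHom.id).comp h)) (b i)).symm

end Projections

variable (L : Type u) [AddCommGroup L] [Module ℂ L] [LieRingModule A L] [LieModule ℂ A L]

/-- Composition `Hom(M, W) × Hom(L, M ⊗ L) → Hom(L, W ⊗ L)`. -/
noncomputable def tensorComp (M W : Type u) [AddCommGroup W] [Module ℂ W] [LieRingModule A W]
    [LieModule ℂ A W] [AddCommGroup M] [Module ℂ M] [LieRingModule A M] [LieModule ℂ A M] :
    (L →ₗ⁅ℂ, A⁆ M ⊗[ℂ] L) →ₗ[ℂ] (M →ₗ⁅ℂ, A⁆ W) →ₗ[ℂ] (L →ₗ⁅ℂ, A⁆ W ⊗[ℂ] L) :=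
  LinearMap.mk₂ ℂ (fun k f => (TensorProduct.LieModule.map f LieModuleHom.id).comp k)
    (fun k k' f => by ext l; simp)
    (fun c k f => by ext l; simp)
    (fun k f f' => by
      ext l
      exact LinearMap.congr_fun (TensorProduct.map_add_left (f : M →ₗ[ℂ] W) f'
        (LinearMap.id : L →ₗ[ℂ] L)) (k l))
    (fun c k f => by
      ext l
      exact LinearMap.congr_fun (TensorProduct.map_smul_left c (f : M →ₗ[ℂ] W)
        (LinearMap.id : L →ₗ[ℂ] L)) (k l))

theorem tensorComp_apply {M W : Type u} [AddCommGroup W] [Module ℂ W] [LieRingModule A W]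
    [LieModule ℂ A W] [AddCommGroup M] [Module ℂ M] [LieRingModule A M] [LieModule ℂ A M]
    (k : L →ₗ⁅ℂ, A⁆ M ⊗[ℂ] L) (f : M →ₗ⁅ℂ, A⁆ W) :
    tensorComp L M W k f = (TensorProduct.LieModule.map f LieModuleHom.id).comp k :=
  rfl

variable [FiniteDimensional ℂ A] [LieAlgebra.IsKilling ℂ A] [FiniteDimensional ℂ L]
  (hL : IsIrreducible ℂ A L)

include hL in
-- The embedding k of L splits, giving a nonzero map M ⊗ L → L and hence a nonzero map M → End(L).
-- The latter is injective as M is simple, and splits in turn.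
theorem exists_hom_end_ne_zero (M : LieMod A) (hM : IsSimpleFinDim M)
    (k : L →ₗ⁅ℂ, A⁆ M ⊗[ℂ] L) (hk : k ≠ 0) : ∃ f : (L →ₗ[ℂ] L) →ₗ⁅ℂ, A⁆ M, f ≠ 0 := by
  have := hM.2
  have hL0 := LieModule.nontrivial_of_isIrreducible ℂ A L
  have := hM.1
  have hM0 := LieModule.nontrivial_of_isIrreducible ℂ A M
  obtain ⟨ψ, hψ⟩ := exists_hom_extend k (injective_of_isIrreducible hL k hk)
    (LieModuleHom.id : L →ₗ⁅ℂ, A⁆ L) LocFin.of_finiteDimensional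
  have hψ0 : ψ ≠ 0 := by
    rintro rfl
    obtain ⟨l, hl⟩ := exists_ne (0 : L)
    exact hl (hψ l).symm
  let c := (TensorProduct.LieModule.liftLie ℂ A M L L).symm ψ
  have hc : c ≠ 0 := fun h => hψ0 ((LinearEquiv.map_eq_zero_iff _).mp h)
  obtain ⟨f, hf⟩ := exists_hom_extend c (injective_of_isIrreducible hM.1 c hc)
    (LieModuleHom.id : M →ₗ⁅ℂ, A⁆ M) LocFin.of_finiteDimensional
  refine ⟨f, ?_⟩
  rintro rfl
  obtain ⟨m, hm⟩ := exists_ne (0 : M)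
  exact hm (hf m).symm

include hL in
/-- Only finitely many simple modules `M` satisfy `[M ⊗ L : L] ≠ 0`. -/
theorem finite_setOf_exists_hom :
    {M : isoClasses (A := A) IsSimpleFinDim | ∃ k : L →ₗ⁅ℂ, A⁆ M.1.out ⊗[ℂ] L, k ≠ 0}.Finite := by
  by_contra hinf
  -- All these M are pairwise nonisomorphic simple quotients of End(L), of which there are at most
  -- dim End(L).
  obtain ⟨T, hT, hcard⟩ := Set.Infinite.exists_subset_card_eq hinf (finrank ℂ (L →ₗ[ℂ] L) + 1)
  choose f hf using fun M : T => exists_hom_end_ne_zero L hL M.1.1.out (isSimpleFinDim_out M.1)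
    (hT M.2).choose (hT M.2).choose_spec
  have := card_le_finrank_of_simple_quotients (K := ℂ) (g := A) (ι := T)
    (V := fun M => M.1.1.out) (fun M => (isSimpleFinDim_out M.1).1) f hf
    (fun M M' h => Subtype.ext (eq_of_nonempty_equiv M.1 M'.1 h))
  rw [Fintype.card_coe, hcard] at this
  omega

variable (W : Type u) [AddCommGroup W] [Module ℂ W] [LieRingModule A W] [LieModule ℂ A W]

include hL in
/-- The multiplicity of `L` in `W ⊗ L`. -/
theorem finrank_hom_tensor_le (hW : LocFin ℂ A W)
    (hfin : ∀ M : isoClasses (A := A) IsSimpleFinDim, FiniteDimensional ℂ (M.1.out →ₗ⁅ℂ, A⁆ W)) :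
    (finrank ℂ (L →ₗ⁅ℂ, A⁆ W ⊗[ℂ] L) : ℕ∞) ≤
      ∑' M : isoClasses (A := A) IsSimpleFinDim, mult A (M.1.out ⊗[ℂ] L) L * mult A W M.1.out ∧
    ∑' M : isoClasses (A := A) IsSimpleFinDim,
      mult A (M.1.out ⊗[ℂ] L) L * mult A W M.1.out < ⊤ := by
  classical
  let F := (finite_setOf_exists_hom L hL).toFinset
  have hF : ∀ M, M ∉ F → ∀ k : L →ₗ⁅ℂ, A⁆ M.1.out ⊗[ℂ] L, k = 0 := by
    intro M hM k
    by_contra hk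
    exact hM ((finite_setOf_exists_hom L hL).mem_toFinset.mpr ⟨k, hk⟩)
  have hsum : ∑' M : isoClasses (A := A) IsSimpleFinDim,
      mult A (M.1.out ⊗[ℂ] L) L * mult A W M.1.out =
      ((∑ M ∈ F, finrank ℂ (L →ₗ⁅ℂ, A⁆ M.1.out ⊗[ℂ] L) *
        finrank ℂ (M.1.out →ₗ⁅ℂ, A⁆ W) : ℕ) : ℕ∞) := by
    rw [tsum_eq_sum (s := F)]
    · push_cast
      refine Finset.sum_congr rfl fun M _ => ?_
      rw [mult_eq_finrank, mult_eq_finrank]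
    · intro M hM
      have : Subsingleton (L →ₗ⁅ℂ, A⁆ M.1.out ⊗[ℂ] L) :=
        ⟨fun k k' => (hF M hM k).trans (hF M hM k').symm⟩
      rw [mult_eq_finrank, finrank_zero_of_subsingleton, Nat.cast_zero, zero_mul]
  rw [hsum]
  refine ⟨?_, ENat.natCast_lt_top _⟩
  rw [Nat.cast_le]
  let Φ : (∀ M : F, (L →ₗ⁅ℂ, A⁆ M.1.1.out ⊗[ℂ] L) ⊗[ℂ] (M.1.1.out →ₗ⁅ℂ, A⁆ W)) →ₗ[ℂ]
      (L →ₗ⁅ℂ, A⁆ W ⊗[ℂ] L) :=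
    ∑ M : F, TensorProduct.lift (tensorComp L M.1.1.out W) ∘ₗ LinearMap.proj M
  have hmem : ∀ (M : isoClasses (A := A) IsSimpleFinDim) k f, tensorComp L M.1.out W k f ∈
      LinearMap.range Φ := by
    intro M k f
    by_cases hM : M ∈ F
    · refine ⟨Pi.single ⟨M, hM⟩ (k ⊗ₜ f), ?_⟩
      rw [LinearMap.sum_apply, Finset.sum_eq_single ⟨M, hM⟩]
      · simp
      · intro M' _ hM'
        simp [Pi.single_eq_of_ne hM']
      · simp
    · rw [hF M hM k, map_zero, LinearMap.zero_apply]
      exact zero_mem _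
  -- A map L → W ⊗ L is a finite sum of its components through simple summands of W. Each component
  -- factors through M ⊗ L, with M the representative of the class of the summand.
  have hsurj : Function.Surjective Φ := by
    intro h
    obtain ⟨s, hs, hs'⟩ := hW.exists_isInternal
    obtain ⟨p, hp⟩ := exists_projections (fun i : s => i.1) hs'
    obtain ⟨T, hT⟩ := exists_projections_hom (fun i : s => i.1) p hp h
    change h ∈ LinearMap.range Φ
    rw [hT]
    refine sum_mem fun i _ => ?_
    let S : LieMod A := ⟨i.1⟩
    let M : isoClasses (A := A) IsSimpleFinDim :=
      ⟨Quotient.mk (LieMod.isoSetoid A) S, ⟨S, hs i, rfl⟩⟩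
    obtain ⟨e⟩ : Nonempty (S ≃ₗ⁅ℂ, A⁆ M.1.out) := Quotient.exact M.1.out_eq.symm
    have := hmem M ((TensorProduct.LieModule.map
      ((e : i.1 →ₗ⁅ℂ, A⁆ M.1.out).comp (p i)) LieModuleHom.id).comp h)
      (i.1.incl.comp (e.symm : M.1.out →ₗ⁅ℂ, A⁆ i.1))
    convert this using 1
    ext l
    rw [tensorComp_apply]
    simp only [LieModuleHom.comp_apply]
    generalize h l = t
    induction t using TensorProduct.induction_on with
    | zero => simp
    | tmul w l =>
      simp only [TensorProduct.LieModule.map_tmul, LieModuleHom.comp_apply]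
      congr 1
      exact congrArg _ (e.symm_apply_apply (p i w)).symm
    | add s t hs ht => simp only [map_add, hs, ht]
  refine (LinearMap.finrank_le_finrank_of_surjective hsurj).trans_eq ?_
  rw [Module.finrank_pi_fintype, ← Finset.sum_coe_sort F]
  exact Finset.sum_congr rfl fun M _ => Module.finrank_tensorProduct

end TensorMultiplicity

/-! ### g-types, the Harish-Chandra property, and counting quotients by a g-type. -/

section Types

open LieModule Module

variable {𝔏 : Type u} [LieRing 𝔏] [LieAlgebra ℂ 𝔏] {g : LieSubalgebra ℂ 𝔏}
  {N : Type u} [AddCommGroup N] [Module ℂ N] [LieRingModule 𝔏 N] [LieModule ℂ 𝔏 N]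
  {L : Type u} [AddCommGroup L] [Module ℂ L] [LieRingModule g L] [LieModule ℂ g L]

theorem hasType_of_ne_zero (hL : IsIrreducible ℂ g L) (f : L →ₗ⁅ℂ, g⁆ N) (hf : f ≠ 0) :
    HasType g N L := by
  have hinj := injective_of_isIrreducible hL f hf
  refine ⟨f.range, ?_⟩
  obtain ⟨e⟩ := nonempty_equiv_of_bijective (f.codRestrict f.range fun l =>
    (LieModuleHom.mem_range f _).mpr ⟨l, rfl⟩) ⟨fun l l' h => hinj (congrArg Subtype.val h), by
      rintro ⟨n, hn⟩
      obtain ⟨l, rfl⟩ := (LieModuleHom.mem_range f _).mp hn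
      exact ⟨l, rfl⟩⟩
  exact ⟨e.symm⟩

theorem HasType.exists_hom (h : HasType g N L) :
    ∃ φ : L →ₗ⁅ℂ, g⁆ N, Function.Injective φ := by
  obtain ⟨S, ⟨e⟩⟩ := h
  exact ⟨S.incl.comp (e.symm : L →ₗ⁅ℂ, g⁆ S), S.injective_incl.comp e.symm.injective⟩

/-- A locally finite module with finite multiplicities is a Harish-Chandra module. -/
theorem isHarishChandra_of_locFin [FiniteDimensional ℂ g] [LieAlgebra.IsKilling ℂ g]
    (hN : LocFin ℂ g N) (hfin : ∀ S : LieSubmodule ℂ g N, FiniteDimensional ℂ S →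
      FiniteDimensional ℂ (S →ₗ⁅ℂ, g⁆ N)) : IsHarishChandra g N := by
  classical
  obtain ⟨s, hs, hs'⟩ := hN.exists_isInternal
  refine ⟨s, _, fun i => i.1, hs, hs', fun i => ?_⟩
  have := (hs i).1
  have := hfin i.1 (hs i).2
  have := LieModule.nontrivial_of_isIrreducible ℂ g i.1
  obtain ⟨v, hv⟩ := exists_ne (0 : i.1)
  let J := {j : s | Nonempty (j.1 ≃ₗ⁅ℂ, g⁆ i.1)}
  let e : ∀ j : J, i.1 →ₗ⁅ℂ, g⁆ j.1.1 := fun j => (j.2.some.symm : i.1 →ₗ⁅ℂ, g⁆ j.1.1)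
  let F : J → (i.1 →ₗ⁅ℂ, g⁆ N) := fun j => j.1.1.incl.comp (e j)
  let ev : (i.1 →ₗ⁅ℂ, g⁆ N) →ₗ[ℂ] N :=
    { toFun := fun f => f v
      map_add' := fun _ _ => rfl
      map_smul' := fun _ _ => rfl }
  -- The maps embed one simple module into distinct summands of N. Evaluated at a fixed nonzero v
  -- they give nonzero vectors of independent submodules, so their number is bounded by a finite
  -- dimension.
  have hF : LinearIndependent ℂ F := by
    refine LinearIndependent.of_comp ev ?_
    refine iSupIndep.linearIndependent (fun j : J => j.1.1.toSubmodule)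
      ((hs'.submodule_iSupIndep).comp Subtype.val_injective) (fun j => (e j v).2) fun j h => hv ?_
    have h0 : e j v = 0 := Subtype.ext h
    exact j.2.some.symm.injective (h0.trans (map_zero _).symm)
  exact hF.finite_of_isNoetherian

/-- The copy of L is finite-dimensional, g-stable and nonzero, so it generates the simple module. -/
theorem IsLevi.radFG_of_hasType [IsLieAbelian (LieAlgebra.radical ℂ 𝔏)] (hg : IsLevi g)
    (hN : IsIrreducible ℂ 𝔏 N) [FiniteDimensional ℂ L] (hL : IsIrreducible ℂ g L)
    (h : HasType g N L) : RadFG 𝔏 N := by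
  obtain ⟨S, ⟨e⟩⟩ := h
  have hS : FiniteDimensional ℂ S := Module.Finite.equiv e.symm.toLinearEquiv
  have : FiniteDimensional ℂ S.toSubmodule := hS
  refine hg.radFG S.toSubmodule (fun x w hw => S.lie_mem (x := x) hw) ?_
  refine (hN.eq_bot_or_eq_top _).resolve_left fun h0 => ?_
  have := LieModule.nontrivial_of_isIrreducible ℂ g L
  obtain ⟨l, hl⟩ := exists_ne (0 : L)
  have hmem : (e.symm l : N) ∈ LieSubmodule.lieSpan ℂ 𝔏 (S.toSubmodule : Set N) :=
    LieSubmodule.subset_lieSpan (e.symm l).2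
  rw [h0, LieSubmodule.mem_bot] at hmem
  have h1 : e.symm l = 0 := Subtype.ext hmem
  exact hl (e.symm.injective (h1.trans (map_zero _).symm))

/-- The number of pairwise nonisomorphic simple quotients containing a `g`-type `L` is at most the
multiplicity of `L`. -/
theorem card_le_finrank_of_hasType [FiniteDimensional ℂ g] [LieAlgebra.IsKilling ℂ g]
    [FiniteDimensional ℂ L] [FiniteDimensional ℂ (L →ₗ⁅ℂ, g⁆ N)] (hL : IsIrreducible ℂ g L)
    (hN : LocFin ℂ g N) {ι : Type*} [Fintype ι]
    {V : ι → Type u} [∀ i, AddCommGroup (V i)] [∀ i, Module ℂ (V i)] [∀ i, LieRingModule 𝔏 (V i)]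
    [∀ i, LieModule ℂ 𝔏 (V i)] (hV : ∀ i, IsIrreducible ℂ 𝔏 (V i)) (f : ∀ i, N →ₗ⁅ℂ, 𝔏⁆ V i)
    (hf : ∀ i, f i ≠ 0) (hne : ∀ i j, Nonempty (V i ≃ₗ⁅ℂ, 𝔏⁆ V j) → i = j)
    (ht : ∀ i, HasType g (V i) L) : Fintype.card ι ≤ finrank ℂ (L →ₗ⁅ℂ, g⁆ N) := by
  classical
  have := LieModule.nontrivial_of_isIrreducible ℂ g L
  obtain ⟨l, hl⟩ := exists_ne (0 : L)
  have key : ∀ i, ∃ ψ : L →ₗ⁅ℂ, g⁆ N, (∀ j, j ≠ i → ∀ m, f j (ψ m) = 0) ∧ f i (ψ l) ≠ 0 := by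
    intro i
    obtain ⟨φ, hφ⟩ := (ht i).exists_hom
    -- By independence of the quotients, `f i` still maps this intersection of the other kernels
    -- onto `V i`. The embedding of L then lifts to S, giving a map that only the i-th quotient
    -- detects.
    let S : LieSubmodule ℂ 𝔏 N := ⨅ j : Finset.univ.erase i, (f j).ker
    have hS : ∀ p, p ∈ S ↔ ∀ j, j ≠ i → f j p = 0 := by
      intro p
      simp [S, LieSubmodule.mem_iInf]
    obtain ⟨p, hp, hp'⟩ := exists_ne_zero_of_notMem hV f hf hne (Finset.univ.erase i) i
      (Finset.notMem_erase i _)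
    have hsurj := surjOn_of_isIrreducible (hV i) (f i) S
      ⟨p, (hS p).mpr fun j hj => hp j (Finset.mem_erase.mpr ⟨hj, Finset.mem_univ j⟩), hp'⟩
    let F : S →ₗ⁅ℂ, g⁆ V i := ((f i).comp S.incl).restrictLie g
    have hSl : LocFin ℂ g S := hN.of_injective (S.incl.restrictLie g) S.injective_incl
    obtain ⟨ψ, hψ⟩ := hSl.exists_hom_lift F (fun v => by
      obtain ⟨q, hq, rfl⟩ := hsurj v
      exact ⟨⟨q, hq⟩, rfl⟩) φ
    refine ⟨(S.incl.restrictLie g).comp ψ, fun j hj m => (hS _).mp (ψ m).2 j hj, fun h0 => hl ?_⟩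
    exact hφ ((hψ l).symm.trans (h0.trans (map_zero φ).symm))
  choose ψ hψ hψ' using key
  refine LinearIndependent.fintype_card_le_finrank (b := ψ) ?_
  rw [Fintype.linearIndependent_iff]
  intro c hc i
  have h1 : (∑ j, c j • ψ j : L →ₗ⁅ℂ, g⁆ N) l = 0 := by rw [hc]; rfl
  rw [lieModuleHom_sum_apply] at h1
  have h2 := congrArg (f i) h1
  rw [map_sum, map_zero, Finset.sum_eq_single i] at h2
  · change f i (c i • ψ i l) = 0 at h2
    rw [map_smul] at h2
    exact (smul_eq_zero.mp h2).resolve_right (hψ' i)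
  · intro j _ hji
    change f i (c j • ψ j l) = 0
    rw [map_smul, hψ j i hji.symm, smul_zero]
  · simp

end Types

/-! ### The module V(0, χ) ⊗ L and its universal property. -/

section Cover

open LieModule Module UniversalEnvelopingAlgebra

variable {𝔏 : Type u} [LieRing 𝔏] [LieAlgebra ℂ 𝔏] {g : LieSubalgebra ℂ 𝔏}

/-- The `𝔏`-module `V(0, χ) ⊗ L`, where the radical acts on `L` by zero. -/
def Cover (hg : IsLevi g) (χ : radicalCenter 𝔏 →ₐ[ℂ] ℂ) (L : Type u) [AddCommGroup L] [Module ℂ L]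
    [LieRingModule g L] [LieModule ℂ g L] : Type u :=
  V₀ g χ ⊗[ℂ] Infl hg L

variable (hg : IsLevi g) (χ : radicalCenter 𝔏 →ₐ[ℂ] ℂ) (L : Type u) [AddCommGroup L] [Module ℂ L]
  [LieRingModule g L] [LieModule ℂ g L]

noncomputable instance : AddCommGroup (Cover hg χ L) :=
  inferInstanceAs (AddCommGroup (V₀ g χ ⊗[ℂ] Infl hg L))
noncomputable instance : Module ℂ (Cover hg χ L) :=
  inferInstanceAs (Module ℂ (V₀ g χ ⊗[ℂ] Infl hg L))
noncomputable instance : LieRingModule 𝔏 (Cover hg χ L) :=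
  inferInstanceAs (LieRingModule 𝔏 (V₀ g χ ⊗[ℂ] Infl hg L))
instance : LieModule ℂ 𝔏 (Cover hg χ L) :=
  inferInstanceAs (LieModule ℂ 𝔏 (V₀ g χ ⊗[ℂ] Infl hg L))

/-- The identification of `V(0, χ) ⊗ L` with `Cover hg χ L`. -/
noncomputable def coverMk : V₀ g χ ⊗[ℂ] Infl hg L ≃ₗ⁅ℂ, 𝔏⁆ Cover hg χ L :=
  (LieModuleEquiv.refl : V₀ g χ ⊗[ℂ] Infl hg L ≃ₗ⁅ℂ, 𝔏⁆ V₀ g χ ⊗[ℂ] Infl hg L)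

/-- The pure tensors in `Cover hg χ L`. -/
noncomputable def coverTmul : V₀ g χ →ₗ[ℂ] L →ₗ[ℂ] Cover hg χ L :=
  LinearMap.mk₂ ℂ (fun v l => coverMk hg χ L (v ⊗ₜ inflEquiv hg L l))
    (fun v v' l => by rw [TensorProduct.add_tmul, map_add])
    (fun c v l => by rw [← TensorProduct.smul_tmul', map_smul])
    (fun v l l' => by rw [map_add, TensorProduct.tmul_add, map_add])
    (fun c v l => by rw [map_smul, TensorProduct.tmul_smul, map_smul])

theorem coverTmul_apply (v : V₀ g χ) (l : L) :
    coverTmul hg χ L v l = coverMk hg χ L (v ⊗ₜ inflEquiv hg L l) :=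
  rfl

theorem cover_induction {C : Cover hg χ L → Prop} (zero : C 0)
    (tmul : ∀ v l, C (coverTmul hg χ L v l)) (add : ∀ s t, C s → C t → C (s + t))
    (t : Cover hg χ L) : C t :=
  TensorProduct.induction_on (motive := fun t => C (coverMk hg χ L t)) t zero
    (fun v l => tmul v l) fun _ _ hs ht => add _ _ hs ht

theorem act_coverTmul {a : Env 𝔏} (ha : a ∈ radAlg 𝔏) (v : V₀ g χ) (l : L) :
    act (Cover hg χ L) a (coverTmul hg χ L v l) = coverTmul hg χ L (act (V₀ g χ) a v) l := by
  rw [coverTmul_apply, coverTmul_apply,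
    ← act_tmul (fun x hx e => radical_lie_infl hg L hx e) ha]
  exact (map_act (coverMk hg χ L : V₀ g χ ⊗[ℂ] Infl hg L →ₗ⁅ℂ, 𝔏⁆ Cover hg χ L) a _).symm

theorem lie_coverTmul (x : g) (v : V₀ g χ) (l : L) : ⁅x, coverTmul hg χ L v l⁆ =
    coverTmul hg χ L ⁅x, v⁆ l + coverTmul hg χ L v ⁅x, l⁆ := by
  have h := LieModuleHom.map_lie
    (coverMk hg χ L : V₀ g χ ⊗[ℂ] Infl hg L →ₗ⁅ℂ, 𝔏⁆ Cover hg χ L) (x : 𝔏)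
    (v ⊗ₜ inflEquiv hg L l)
  rw [TensorProduct.LieModule.lie_tmul_right, map_add] at h
  refine h.symm.trans (congrArg₂ (· + ·) rfl ?_)
  rw [coverTmul_apply, show inflEquiv hg L ⁅x, l⁆ = ⁅(x : 𝔏), inflEquiv hg L l⁆ from
    LieModuleHom.map_lie (inflEquiv hg L : L →ₗ⁅ℂ, g⁆ Infl hg L) x l]
  rfl

/-- `Cover hg χ L` is `V(0, χ) ⊗ L` as a `g`-module. -/
noncomputable def coverHom : V₀ g χ ⊗[ℂ] L →ₗ⁅ℂ, g⁆ Cover hg χ L :=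
  TensorProduct.LieModule.liftLie ℂ g _ _ _
    { coverTmul hg χ L with
      map_lie' := fun {x v} => LinearMap.ext fun l => by
        change coverTmul hg χ L ⁅x, v⁆ l =
          ⁅x, coverTmul hg χ L v l⁆ - coverTmul hg χ L v ⁅x, l⁆
        rw [lie_coverTmul, add_sub_cancel_right] }

theorem coverHom_tmul (v : V₀ g χ) (l : L) : coverHom hg χ L (v ⊗ₜ l) = coverTmul hg χ L v l :=
  TensorProduct.LieModule.liftLie_apply ..

theorem coverHom_bijective : Function.Bijective (coverHom hg χ L) := by
  have h : (coverHom hg χ L : V₀ g χ ⊗[ℂ] L →ₗ[ℂ] Cover hg χ L) =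
      ((coverMk hg χ L).toLinearEquiv.toLinearMap ∘ₗ
        (TensorProduct.congr (LinearEquiv.refl ℂ (V₀ g χ)) (inflEquiv hg L).toLinearEquiv)) :=
    TensorProduct.ext' fun v l => coverHom_tmul hg χ L v l
  change Function.Bijective (coverHom hg χ L : V₀ g χ ⊗[ℂ] L →ₗ[ℂ] Cover hg χ L)
  rw [h]
  exact (coverMk hg χ L).toLinearEquiv.bijective.comp
    (TensorProduct.congr (LinearEquiv.refl ℂ (V₀ g χ)) (inflEquiv hg L).toLinearEquiv).bijective

theorem finrank_hom_cover :
    finrank ℂ (L →ₗ⁅ℂ, g⁆ Cover hg χ L) = finrank ℂ (L →ₗ⁅ℂ, g⁆ V₀ g χ ⊗[ℂ] L) := by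
  obtain ⟨e⟩ := nonempty_equiv_of_bijective _ (coverHom_bijective hg χ L)
  exact LinearEquiv.finrank_eq
    { toFun := fun f => (e.symm : Cover hg χ L →ₗ⁅ℂ, g⁆ V₀ g χ ⊗[ℂ] L).comp f
      invFun := fun f => (e : V₀ g χ ⊗[ℂ] L →ₗ⁅ℂ, g⁆ Cover hg χ L).comp f
      map_add' := fun f f' => LieModuleHom.ext fun l => map_add e.symm (f l) (f' l)
      map_smul' := fun c f => LieModuleHom.ext fun l => map_smul e.symm c (f l)
      left_inv := fun f => LieModuleHom.ext fun l => e.apply_symm_apply (f l)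
      right_inv := fun f => LieModuleHom.ext fun l => e.symm_apply_apply (f l) }

variable {χ L} [FiniteDimensional ℂ L] [IsLieAbelian (LieAlgebra.radical ℂ 𝔏)]

theorem hasRadicalCharacter_cover : HasRadicalCharacter χ (Cover hg χ L) := by
  intro z t
  induction t using cover_induction with
  | zero => rw [map_zero, smul_zero]
  | tmul v l =>
    refine (act_coverTmul hg χ L z.2.2 v l).trans ?_
    rw [show act (V₀ g χ) (z : Env 𝔏) v = χ z • v from hasRadicalCharacter_V₀ g χ z v, map_smul,
      LinearMap.smul_apply]
  | add s t hs ht => rw [map_add, hs, ht, smul_add]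

theorem locFin_cover [FiniteDimensional ℂ 𝔏] : LocFin ℂ g (Cover hg χ L) :=
  ((locFin_V₀ hg).tensor LocFin.of_finiteDimensional).of_surjective (coverHom hg χ L)
    (coverHom_bijective hg χ L).2

/-- The embedding of `L` into `Cover hg χ L`. -/
noncomputable def coverIncl : L →ₗ⁅ℂ, g⁆ Cover hg χ L :=
  { coverTmul hg χ L (toV g χ 1) with
    map_lie' := fun {x l} => by
      have h : ⁅x, toV g χ 1⁆ = 0 := (mem_maxTrivSubmodule ℂ g _ _).mp toV_one_mem_maxTriv x
      have := lie_coverTmul hg χ L x (toV g χ 1) l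
      rw [h, map_zero, LinearMap.zero_apply, zero_add] at this
      exact this.symm }

theorem coverIncl_apply (l : L) : coverIncl hg l = coverTmul hg χ L (toV g χ 1) l :=
  rfl

/-- U(r) acts on the left factor only, and V(0, χ) is the U(r)-orbit of its generator. -/
theorem lieSpan_cover : LieSubmodule.lieSpan ℂ 𝔏 (Set.range (coverIncl (χ := χ) (L := L) hg)) = ⊤ := by
  rw [eq_top_iff]
  intro t ht
  clear ht
  induction t using cover_induction with
  | zero => exact zero_mem _
  | tmul v l =>
    obtain ⟨a, rfl⟩ := exists_toV_eq hg v
    have := act_mem (LieSubmodule.lieSpan ℂ 𝔏 (Set.range (coverIncl (χ := χ) (L := L) hg)))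
      (a : Env 𝔏) _ (LieSubmodule.subset_lieSpan ⟨l, rfl⟩)
    rwa [coverIncl_apply, act_coverTmul hg χ L a.2, act_toV, mul_one] at this
  | add s t hs ht => exact add_mem hs ht

theorem radFG_cover : RadFG 𝔏 (Cover hg χ L) := by
  let f : L →ₗ⁅ℂ, g⁆ Cover hg χ L := coverIncl hg
  have hfd : FiniteDimensional ℂ f.range.toSubmodule :=
    Module.Finite.range (f : L →ₗ[ℂ] Cover hg χ L)
  refine hg.radFG f.range.toSubmodule (fun x w hw => f.range.lie_mem (x := x) hw) ?_
  rw [LieSubmodule.coe_toSubmodule, LieModuleHom.coe_range]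
  exact lieSpan_cover hg

/-- Every simple module with radical character `χ` and `g`-type `L` is a quotient of
`Cover hg χ L`. -/
theorem exists_hom_cover [FiniteDimensional ℂ 𝔏] [LieAlgebra.IsKilling ℂ g] {V : Type u}
    [AddCommGroup V] [Module ℂ V] [LieRingModule 𝔏 V] [LieModule ℂ 𝔏 V]
    (hL : IsIrreducible ℂ g L) (hV : IsIrreducible ℂ 𝔏 V) (hχ : HasRadicalCharacter χ V)
    (ht : HasType g V L) : ∃ f : Cover hg χ L →ₗ⁅ℂ, 𝔏⁆ V, f ≠ 0 := by
  have := LieModule.nontrivial_of_isIrreducible ℂ g L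
  obtain ⟨l, hl⟩ := exists_ne (0 : L)
  obtain ⟨φ, hφ⟩ := ht.exists_hom
  -- The orbit of this invariant vector is a map V(0, χ) → Hom(L, V). Its adjoint V(0, χ) ⊗ L → V
  -- sends 1 ⊗ l to φ(l), so it is nonzero.
  let ψ : Infl hg L →ₗ⁅ℂ, g⁆ V := φ.comp ((inflEquiv hg L).symm : Infl hg L →ₗ⁅ℂ, g⁆ L)
  have hψ : (ψ : Infl hg L →ₗ[ℂ] V) ∈ maxTrivSubmodule ℂ g (Infl hg L →ₗ[ℂ] V) :=
    (maxTrivLinearMapEquivLieModuleHom.symm ψ).2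
  obtain ⟨F, hF⟩ := exists_hom_V₀ (g := g) (χ := χ) (ψ : Infl hg L →ₗ[ℂ] V) fun u hu =>
    act_hom_eq_zero hg (fun x hx e => radical_lie_infl hg L hx e) hV
      (hg.radFG_of_hasType hV hL ht) hχ hψ hu
  refine ⟨(TensorProduct.LieModule.liftLie ℂ 𝔏 _ _ _ F).comp
    ((coverMk hg χ L).symm : Cover hg χ L →ₗ⁅ℂ, 𝔏⁆ V₀ g χ ⊗[ℂ] Infl hg L), fun h0 => hl ?_⟩
  apply hφ
  have h1 := LieModuleHom.congr_fun h0 (coverMk hg χ L (toV g χ 1 ⊗ₜ inflEquiv hg L l))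
  have h2 : (TensorProduct.LieModule.liftLie ℂ 𝔏 (V₀ g χ) (Infl hg L) V F)
      (toV g χ 1 ⊗ₜ inflEquiv hg L l) = 0 := h1
  rw [TensorProduct.LieModule.liftLie_apply, hF, map_one] at h2
  exact (h2.trans (map_zero φ).symm)

end Cover

/-! ### Maximal submodules and simple quotients. -/

section Quotient

open LieModule Module

variable {𝔏 : Type u} [LieRing 𝔏] [LieAlgebra ℂ 𝔏] {N : Type u} [AddCommGroup N] [Module ℂ N]
  [LieRingModule 𝔏 N] [LieModule ℂ 𝔏 N]

/-- Every 𝔏-submodule is a U(r)-submodule, so the ascending chain condition over U(r) carries over.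
-/
theorem RadFG.isCoatomic [FiniteDimensional ℂ 𝔏] [IsLieAbelian (LieAlgebra.radical ℂ 𝔏)]
    (h : RadFG 𝔏 N) : IsCoatomic (LieSubmodule ℂ 𝔏 N) := by
  let _ := radModule (𝔏 := 𝔏) N
  have : Module.Finite (radAlg 𝔏) N := h.finite
  have : IsNoetherian (radAlg 𝔏) N := inferInstance
  let F : LieSubmodule ℂ 𝔏 N → Submodule (radAlg 𝔏) N := fun S =>
    { carrier := S
      add_mem' := S.add_mem'
      zero_mem' := S.zero_mem'
      smul_mem' := fun a n hn => act_mem S (a : Env 𝔏) n hn }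
  have hF : StrictMono F := fun S T hST => hST
  have := hF.wellFoundedGT
  exact isCoatomic_of_orderTop_gt_wellFounded wellFounded_gt

theorem isIrreducible_quotient {S : LieSubmodule ℂ 𝔏 N} (hS : IsCoatom S) :
    IsIrreducible ℂ 𝔏 (N ⧸ S) := by
  have hne : ∃ n, n ∉ S := by
    by_contra! h
    exact hS.1 (eq_top_iff.mpr fun n _ => h n)
  obtain ⟨n, hn⟩ := hne
  have : Nontrivial (N ⧸ S) :=
    ⟨LieSubmodule.Quotient.mk' S n, 0, fun h => hn ((LieSubmodule.Quotient.mk_eq_zero S).mp h)⟩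
  refine LieModule.IsIrreducible.mk fun T hT => ?_
  have hST : S < T.comap (LieSubmodule.Quotient.mk' S) := by
    refine lt_of_le_of_ne (fun m hm => ?_) fun h => hT ?_
    · rw [LieSubmodule.mem_comap, (LieSubmodule.Quotient.mk_eq_zero S).mpr hm]
      exact zero_mem T
    · rw [LieSubmodule.eq_bot_iff]
      intro q hq
      obtain ⟨m, rfl⟩ := LieSubmodule.Quotient.surjective_mk' S q
      have hm : m ∈ S := by rw [h]; exact hq
      exact (LieSubmodule.Quotient.mk_eq_zero S).mpr hm
  have := hS.2 _ hST
  rw [eq_top_iff]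
  intro q _
  obtain ⟨m, rfl⟩ := LieSubmodule.Quotient.surjective_mk' S q
  have hm : m ∈ T.comap (LieSubmodule.Quotient.mk' S) := by rw [this]; exact LieSubmodule.mem_top m
  exact hm

end Quotient

/-! ### Existence and the upper bound. -/

section Classification

open LieModule Module

variable {𝔏 : Type u} [LieRing 𝔏] [LieAlgebra ℂ 𝔏] [FiniteDimensional ℂ 𝔏]
  [IsLieAbelian (LieAlgebra.radical ℂ 𝔏)] {g : LieSubalgebra ℂ 𝔏} [LieAlgebra.IsKilling ℂ g]
  (hg : IsLevi g) (χ : radicalCenter 𝔏 →ₐ[ℂ] ℂ)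
  (L : Type u) [AddCommGroup L] [Module ℂ L] [LieRingModule g L] [LieModule ℂ g L]
  [FiniteDimensional ℂ L] (hL : IsIrreducible ℂ g L)

include hg hL

/-- A simple quotient of `Cover hg χ L` works: it inherits local finiteness and the radical
character, and L maps nontrivially to it because the copy 1 ⊗ L generates the cover. -/
theorem exists_isSimpleHC : ∃ V : LieMod 𝔏, IsSimpleHC g χ L V := by
  have := LieModule.nontrivial_of_isIrreducible ℂ g L
  have := nontrivial_V₀ (χ := χ) hg
  have hfg := radFG_cover (χ := χ) (L := L) hg
  have := hfg.isCoatomic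
  have hnt : Nontrivial (Cover hg χ L) :=
    have : Nontrivial (V₀ g χ ⊗[ℂ] L) := inferInstance
    (coverHom_bijective hg χ L).1.nontrivial
  have hbt : (⊥ : LieSubmodule ℂ 𝔏 (Cover hg χ L)) ≠ ⊤ := bot_ne_top
  obtain ⟨S, hS, -⟩ := (eq_top_or_exists_le_coatom
    (⊥ : LieSubmodule ℂ 𝔏 (Cover hg χ L))).resolve_left hbt
  let π := LieSubmodule.Quotient.mk' S
  have hπ : Function.Surjective π := LieSubmodule.Quotient.surjective_mk' S
  have hirr := isIrreducible_quotient hS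
  have hχ : HasRadicalCharacter χ (Cover hg χ L ⧸ S) := by
    intro z q
    obtain ⟨t, rfl⟩ := hπ q
    refine (map_act π (z : Env 𝔏) t).symm.trans ?_
    rw [show act (Cover hg χ L) (z : Env 𝔏) t = χ z • t from hasRadicalCharacter_cover hg z t,
      map_smul]
  have hloc : LocFin ℂ g (Cover hg χ L ⧸ S) :=
    (locFin_cover hg).of_surjective (π.restrictLie g) hπ
  have htype : HasType g (Cover hg χ L ⧸ S) L := by
    refine hasType_of_ne_zero hL ((π.restrictLie g).comp (coverIncl hg)) fun h0 => hS.1 ?_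
    rw [eq_top_iff, ← lieSpan_cover hg, LieSubmodule.lieSpan_le]
    rintro _ ⟨l, rfl⟩
    exact (LieSubmodule.Quotient.mk_eq_zero S).mp (LieModuleHom.congr_fun h0 l)
  have hfg' := hg.radFG_of_hasType hirr hL htype
  exact ⟨⟨Cover hg χ L ⧸ S⟩, hirr, isHarishChandra_of_locFin hloc
    (fun T _ => finiteDimensional_hom hg hloc hχ hfg' T), hχ, htype⟩

theorem encard_isoClasses_le :
    (isoClasses (IsSimpleHC g χ L)).encard ≤ (finrank ℂ (L →ₗ⁅ℂ, g⁆ V₀ g χ ⊗[ℂ] L) : ℕ∞) := by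
  rw [← finrank_hom_cover hg]
  have := finiteDimensional_hom hg (locFin_cover hg) (hasRadicalCharacter_cover hg)
    (radFG_cover (χ := χ) (L := L) hg) L
  by_contra! hlt
  -- The set of classes is not yet known to be finite, so a subset with exactly one element too many
  -- is used.
  obtain ⟨T, hT, hcard⟩ := Set.exists_subset_encard_eq (Order.add_one_le_of_lt hlt)
  have hfin : T.Finite := Set.finite_of_encard_eq_coe (k := finrank ℂ (L →ₗ⁅ℂ, g⁆ Cover hg χ L) + 1)
    (by rw [hcard]; rfl)
  have := hfin.fintype
  choose V hV hVT using fun c : T => hT c.2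
  choose f hf using fun c : T => exists_hom_cover hg hL (hV c).1 (hV c).2.2.1 (hV c).2.2.2
  have hle := card_le_finrank_of_hasType hL (locFin_cover hg) (V := fun c : T => (V c).carrier)
    (fun c => (hV c).1) f hf (fun c c' h => Subtype.ext <| by
      rw [← hVT c, ← hVT c']
      exact Quotient.sound h) (fun c => (hV c).2.2.2)
  rw [← Set.coe_fintypeCard T] at hcard
  have : Fintype.card T = finrank ℂ (L →ₗ⁅ℂ, g⁆ Cover hg χ L) + 1 := by exact_mod_cast hcard
  omega

theorem finrank_hom_le_bound :
    (finrank ℂ (L →ₗ⁅ℂ, g⁆ V₀ g χ ⊗[ℂ] L) : ℕ∞) ≤ bound g χ L ∧ bound g χ L < ⊤ :=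
  finrank_hom_tensor_le L hL (V₀ g χ) (locFin_V₀ hg) fun M =>
    finiteDimensional_hom hg (locFin_V₀ hg) (hasRadicalCharacter_V₀ g χ) (radFG_V₀ hg) M.1.out

end Classification

end GenTakiff

theorem proposition6p6 {𝔏 : Type u} [LieRing 𝔏] [LieAlgebra ℂ 𝔏] [FiniteDimensional ℂ 𝔏]
    (g : LieSubalgebra ℂ 𝔏) (hg : GenTakiff.IsLevi g)
    (hr : IsLieAbelian (LieAlgebra.radical ℂ 𝔏))
    (χ : GenTakiff.radicalCenter 𝔏 →ₐ[ℂ] ℂ)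
    (L : Type u) [AddCommGroup L] [Module ℂ L] [LieRingModule g L] [LieModule ℂ g L]
    (hL : LieModule.IsIrreducible ℂ g L) (hL' : FiniteDimensional ℂ L) :
    (∃ V : GenTakiff.LieMod 𝔏, GenTakiff.IsSimpleHC g χ L V) ∧
    (GenTakiff.isoClasses (GenTakiff.IsSimpleHC g χ L)).encard ≤ GenTakiff.bound g χ L ∧
    GenTakiff.bound g χ L < ⊤ := by
  have := hg.isKilling
  have h := GenTakiff.finrank_hom_le_bound hg χ L hL
  exact ⟨GenTakiff.exists_isSimpleHC hg χ L hL,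
    (GenTakiff.encard_isoClasses_le hg χ L hL).trans h.1, h.2⟩
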